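/- **Definitions.** A complex of rank $\frac74$ is a simplicial complex of dimension at most $2$ in which the link of every vertex is isomorphic to the Moebius–Kantor graph (the generalized Petersen graph $G(8,3)$). Its links are metrized so that every edge has length $\pi/3$. A root $\alpha$ in a link $L$ is an isometric embedding $\alpha\colon[0,\pi]\to L$ with $\alpha(0)$ a vertex (thus a path of $3$ edges with end points at distance $3$); its rank is $1+N(\alpha)/q_\alpha$, where $N(\alpha)$ is the number of roots $\beta\neq\alpha$ with the same end points $\beta(0)=\alpha(0)$, $\beta(\pi)=\alpha(\pi)$, and $q_\alpha+1$ is the valency of $\alpha(0)$. A 2-triangle is a simplicial equilateral triangle with sides of length $2$: it consists of a central face together with one further face attached along each of the three edges of the central face. Each of its three sides passes through a vertex of the central face and defines there a root (up to reversing the direction); the rank of the side is the rank of that root. The parity in $\mathbb Z/2\mathbb Z$ of a face $f$ is the number modulo $2$ of the sides of rank $2$ in any 2-triangle with central face $f$ (it does not depend on the 2-triangle). For a vertex $x$ of $X$, $B_n(X,x)$ is the simplicial ball of radius $n$, i.e. the subcomplex of all simplices whose vertices are at distance at most $n$ from $x$ in the 1-skeleton, and the faces of the sphere $S_n(X,x)$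 are the triangles of $B_n(X,x)$ that are not in $B_{n-1}(X,x)$. **Theorem (Free constructions).** Fix an infinite set $V$; all complexes below have their vertices in $V$. 1. (Extension of balls.) Let $X$ be a simply connected complex of rank $\frac74$, $x$ a vertex of $X$, $n\ge 0$, and let $p$ be any map from the triangles of $S_n(X,x)$ to $\mathbb Z/2\mathbb Z$. Then there is a simply connected complex $Y$ of rank $\frac74$ with $B_n(Y,x)=B_n(X,x)$, so that the ball $B_{n+1}(Y,x)$ contains $B_n(X,x)$, in which every triangle $f$ of $S_n(X,x)$ has parity $p(f)$. 2. (Free construction, ball by ball.) Let $X$ be a simply connected complex of rank $\frac74$, $x$ a vertex of $X$, $m\ge0$, and let $P$ be any rule which assigns to every $n\geq m$ and every complex $B$ a map $P_{n,B}$ from the triangles of $B$ to $\mathbb Z/2\mathbb Z$. Then there is a simply connected complex $Y$ of rank $\frac74$ with $B_m(Y,x)=B_m(X,x)$ such that for every $n\ge m$ and every triangle $f$ of $S_n(Y,x)$, the parity of $f$ in $Y$ is $P_{n,B_n(Y,x)}(f)$. 3. (Prescribed parity map.) For every map $p$ from the three-element subsets of $V$ to $\mathbb Z/2\mathbb Z$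 there is a simply connected complex $Y$ of rank $\frac74$ in which every triangle $f$ has parity $p(f)$. 4. There is an uncountable set of simply connected complexes of rank $\frac74$ that are pairwise non isomorphic (as simplicial complexes). -/

import Mathlib

namespace Rank74

/-! ### The Moebius-Kantor graph -/

/-- Half of the adjacency relation of the generalized Petersen graph `G(8,3)`:
`u i ~ u (i + 1)`, `u i ~ v i`, `v i ~ v (i + 3)`, indices modulo `8`. -/
def moebiusKantorRel : ZMod 8 ⊕ ZMod 8 → ZMod 8 ⊕ ZMod 8 → Prop
  | Sum.inl i, Sum.inl j => j = i + 1
  | Sum.inl i, Sum.inr j => j = i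
  | Sum.inr i, Sum.inr j => j = i + 3
  | Sum.inr _, Sum.inl _ => False

/-- The Moebius-Kantor graph, i.e. the generalized Petersen graph `G(8,3)`. -/
def moebiusKantor : SimpleGraph (ZMod 8 ⊕ ZMod 8) :=
  SimpleGraph.fromRel moebiusKantorRel

/-! ### Roots in a graph and their rank

In the links every edge has length `π / 3`, so that an isometric embedding of `[0, π]` which starts
at a vertex is a path of three edges whose end points are at graph distance `3`. -/

/-- `α 0, α 1, α 2, α 3` are the successive vertices of a root of the graph `G`. -/
def IsRoot {V : Type*} (G : SimpleGraph V) (α : Fin 4 → V) : Prop :=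
  G.Adj (α 0) (α 1) ∧ G.Adj (α 1) (α 2) ∧ G.Adj (α 2) (α 3) ∧ G.dist (α 0) (α 3) = 3

/-- The rank `1 + N(α) / q_α` of a root `α`: here `N(α)` is the number of roots different from `α`
with the same end points, and `q_α` is the valency of `α 0` minus one. -/
noncomputable def rootRank {V : Type*} (G : SimpleGraph V) (α : Fin 4 → V) : ℚ :=
  1 + ({β : Fin 4 → V | IsRoot G β ∧ β ≠ α ∧ β 0 = α 0 ∧ β 3 = α 3}.ncard : ℚ) /
    (((G.neighborSet (α 0)).ncard : ℚ) - 1)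

section Complexes

variable {V : Type*} [DecidableEq V]

/-! ### Simplicial complexes whose vertices belong to `V`

A `PreAbstractSimplicialComplex V` does not need to contain all the elements of `V` as vertices. -/

/-- The vertices of a complex. -/
def vertices (X : PreAbstractSimplicialComplex V) : Set V := {v | {v} ∈ X}

/-- The 1-skeleton of a complex. Elements of `V` that are not vertices of `X` are isolated. -/
def skeleton (X : PreAbstractSimplicialComplex V) : SimpleGraph V where
  Adj u v := u ≠ v ∧ {u, v} ∈ X
  symm := ⟨fun u v h => ⟨h.1.symm, by rw [Finset.pair_comm]; exact h.2⟩⟩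
  loopless := ⟨fun _ h => h.1 rfl⟩

/-- The triangle faces of a complex. -/
def triangles (X : PreAbstractSimplicialComplex V) : Set (Finset V) := {s | s ∈ X ∧ s.card = 3}

/-- The graph on `V` whose edges are the pairs `{u, w}` such that `v, u, w` span a triangle of `X`.
The link of `v` is obtained by restricting it to the neighbours of `v`; all other elements of `V`
are isolated in it. -/
def linkGraph (X : PreAbstractSimplicialComplex V) (v : V) : SimpleGraph V where
  Adj u w := ({v, u, w} : Finset V) ∈ triangles X
  symm := ⟨fun u w h => by
    have e : ({v, w, u} : Finset V) = {v, u, w} := by rw [Finset.pair_comm]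
    rw [e]; exact h⟩
  loopless := ⟨fun u h => by
    have h3 := h.2
    have h2 := Finset.card_le_two (a := v) (b := u)
    simp only [Finset.pair_eq_singleton] at h3
    omega⟩

/-- The link of `v` in a complex of dimension at most `2`, a graph on the set of neighbours
of `v`. -/
def link (X : PreAbstractSimplicialComplex V) (v : V) :
    SimpleGraph ((skeleton X).neighborSet v) :=
  (linkGraph X v).induce ((skeleton X).neighborSet v)

/-- A (simplicial) complex of rank `7/4`: a complex of dimension at most two all of whose vertex
links are isomorphic to the Moebius-Kantor graph. -/
def IsRankSevenFourths (X : PreAbstractSimplicialComplex V) : Prop :=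
  (∀ s ∈ X, s.card ≤ 3) ∧ ∀ v ∈ vertices X, Nonempty (link X v ≃g moebiusKantor)

/-! ### Simple connectedness -/

/-- Homotopy (with fixed end points) of edge paths in a simplicial complex: the congruence
generated by removing a backtracking and by replacing two consecutive sides of a triangle face
by its third side. -/
inductive EdgeHomotopic (X : PreAbstractSimplicialComplex V) :
    {u v : V} → (skeleton X).Walk u v → (skeleton X).Walk u v → Prop
  | refl {u v : V} (p : (skeleton X).Walk u v) : EdgeHomotopic X p p
  | symm {u v : V} {p q : (skeleton X).Walk u v} :
      EdgeHomotopic X p q → EdgeHomotopic X q p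
  | trans {u v : V} {p q r : (skeleton X).Walk u v} :
      EdgeHomotopic X p q → EdgeHomotopic X q r → EdgeHomotopic X p r
  | cons {u v w : V} (h : (skeleton X).Adj u v) {p q : (skeleton X).Walk v w} :
      EdgeHomotopic X p q →
        EdgeHomotopic X (SimpleGraph.Walk.cons h p) (SimpleGraph.Walk.cons h q)
  | backtrack {u v w : V} (h : (skeleton X).Adj u v) (h' : (skeleton X).Adj v u)
      (p : (skeleton X).Walk u w) :
      EdgeHomotopic X (SimpleGraph.Walk.cons h (SimpleGraph.Walk.cons h' p)) p
  | triangle {u v w z : V} (huv : (skeleton X).Adj u v) (hvw : (skeleton X).Adj v w)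
      (huw : (skeleton X).Adj u w) (hX : ({u, v, w} : Finset V) ∈ X)
      (p : (skeleton X).Walk w z) :
      EdgeHomotopic X (SimpleGraph.Walk.cons huv (SimpleGraph.Walk.cons hvw p))
        (SimpleGraph.Walk.cons huw p)

/-- A complex is simply connected if it is nonempty, connected, and every closed edge path is
homotopic to a constant path (that is, its edge path group is trivial). -/
def IsSimplyConnected (X : PreAbstractSimplicialComplex V) : Prop :=
  (vertices X).Nonempty ∧
  (∀ u ∈ vertices X, ∀ v ∈ vertices X, (skeleton X).Reachable u v) ∧
  ∀ u ∈ vertices X, ∀ p : (skeleton X).Walk u u, EdgeHomotopic X p SimpleGraph.Walk.nil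

/-! ### Parity -/

/-- A 2-triangle of `X`, i.e. a simplicial equilateral triangle with sides of length two. Its
centerpiece is the triangle `a b c`, its corners are `x`, `y`, `z`, and `x`, `y`, `z` lie
respectively opposite to `a`, `b`, `c`. Its sides are `y c x`, `z a y` and `x b z`. -/
structure TwoTriangle (X : PreAbstractSimplicialComplex V) where
  a : V
  b : V
  c : V
  x : V
  y : V
  z : V
  center_mem : ({a, b, c} : Finset V) ∈ triangles X
  x_mem : ({x, b, c} : Finset V) ∈ triangles X
  y_mem : ({a, y, c} : Finset V) ∈ triangles X
  z_mem : ({a, b, z} : Finset V) ∈ triangles X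
  x_ne : x ≠ a
  y_ne : y ≠ b
  z_ne : z ≠ c

/-- The centerpiece of a 2-triangle. -/
def TwoTriangle.center {X : PreAbstractSimplicialComplex V} (T : TwoTriangle X) : Finset V :=
  {T.a, T.b, T.c}

/-- The number of sides of rank two of a 2-triangle. The side with midpoint `a` defines the root
`y c b z` in the link of `a`, and likewise for `b` and `c`; a root and the same root in the opposite
direction are counted once. -/
noncomputable def TwoTriangle.rankTwoSides {X : PreAbstractSimplicialComplex V}
    (T : TwoTriangle X) : ℕ :=
  (if rootRank (linkGraph X T.a) ![T.y, T.c, T.b, T.z] = 2 then 1 else 0) +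
  (if rootRank (linkGraph X T.b) ![T.z, T.a, T.c, T.x] = 2 then 1 else 0) +
  (if rootRank (linkGraph X T.c) ![T.x, T.b, T.a, T.y] = 2 then 1 else 0)

/-- The triangle face `f` is the centerpiece of some 2-triangle, and the number of sides of rank
two of every such 2-triangle is congruent to `ε` modulo two: the parity of `f` is `ε`. -/
def HasParity (X : PreAbstractSimplicialComplex V) (f : Finset V) (ε : ZMod 2) : Prop :=
  (∃ T : TwoTriangle X, T.center = f) ∧
  ∀ T : TwoTriangle X, T.center = f → (T.rankTwoSides : ZMod 2) = ε

/-! ### Balls and spheres -/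

/-- The simplicial ball of radius `n` centered at `x`: the full subcomplex spanned by the vertices
at distance at most `n` from `x` in the 1-skeleton. -/
def ball (X : PreAbstractSimplicialComplex V) (x : V) (n : ℕ) : PreAbstractSimplicialComplex V where
  faces := {s | s ∈ X ∧ ∀ v ∈ s, (skeleton X).edist x v ≤ n}
  isRelLowerSet_faces := fun _ hs =>
    ⟨(X.isRelLowerSet_faces hs.1).1, fun _ hts ht =>
      ⟨(X.isRelLowerSet_faces hs.1).2 hts ht, fun v hv => hs.2 v (hts hv)⟩⟩

/-- The triangle faces of the simplicial sphere `S_n`, i.e. of the ball of radius `n` with the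
interior of the ball of radius `n - 1` removed. (For `n = 0` there are none.) -/
def sphereTriangles (X : PreAbstractSimplicialComplex V) (x : V) (n : ℕ) : Set (Finset V) :=
  triangles (ball X x n) \ triangles (ball X x (n - 1))

end Complexes

/-- Simplicial isomorphism: a bijection between the vertices which, in both directions, takes
simplices to simplices. -/
def AreIsomorphic {U V : Type*} (X : PreAbstractSimplicialComplex U)
    (Y : PreAbstractSimplicialComplex V) : Prop :=
  ∃ e : vertices X ≃ vertices Y, ∀ s : Finset (vertices X),
    s.map (Function.Embedding.subtype _) ∈ X ↔
      (s.map e.toEmbedding).map (Function.Embedding.subtype _) ∈ Y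

end Rank74

/-!
Complexes of rank `7/4` are built layer by layer around a base vertex `x`. The combinatorial reason
why this works is that the Moebius-Kantor graph is cubic of girth six. A complex `B` with a level
function `ℓ` is called *good* of radius `n` (`IsGood`) if the vertices of level less than `n` have
the correct link, the neighbours of a vertex in the preceding level form a vertex or an edge of its
link, an edge between two vertices of the same level is in exactly one triangle with a vertex of the
preceding level, and no triangle has all its vertices in the same level. Then `ℓ` is the distance
to `x`, and balls in good complexes are good. Shortest paths to `x` can be compared with each other
across triangles, so good complexes are simply connected; a good complex of infinite radius has rank
`7/4`.

*Extension.* In a good ball of radius `n`, the link of a vertex of level `n > 0` is the star of a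
vertex or the ball of radius one around an edge of the Moebius-Kantor graph. Embed all these links
in the Moebius-Kantor graph, fill each of them up with new vertices, and on every edge `v v'` of the
sphere identify in some way the two new vertices seen from `v` with the two new vertices seen from
`v'`. The girth shows that a new vertex of the link of `v` is adjacent there to at most one vertex
of level `n`, so that there is no other constraint, and that the outcome is a good ball of radius
`n + 1` (`LabelData.exists_extData`, `ExtData.isGood_extend`).

*Every simply connected complex of rank `7/4` is good* (`exists_isGood`). Using the links of `X` to
make these choices, one gets a good complex of infinite radius which maps to `X` by a map that is
bijective on stars, hence lifts edge paths and homotopies. If `X` is simply connected then this map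
is an isomorphism.

*Parity.* A path of length two in the Moebius-Kantor graph has two prolongations at each end, and
exactly one of the two has rank two as a root. Changing a corner of a 2-triangle thus changes the
rank of two sides, and the parity of a face can be computed from any 2-triangle
(`IsTwoTriangle.hasParity`). A triangle of the sphere of radius `n` has one or two vertices of level
`n`. In the first case, with vertex `v` of level `n`, the link of `v` is the ball around an edge; it
has two different embeddings in the Moebius-Kantor graph, and they give different parities. In the
second case, exchanging the two new vertices on the edge `v v'` as seen from `v'` changes the rank
of exactly one side. These choices are independent of each other, so that all parities on the
sphere can be prescribed (`IsGood.exists_extend_parity`).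

*Conclusion.* Iterating the extension and passing to the union (`exists_limit`) gives the free
construction `IsGood.exists_free`, from which the first three assertions follow, starting with a
ball of `X` or with a single vertex. For the last one, prescribe the same parity `s n` for all the
triangles of the sphere of radius `n + 1`. A good complex is countable, and an isomorphism preserves
parities and takes spheres to spheres, so that for fixed `Y` only countably many sequences `s` give
a complex isomorphic to `Y` (`exists_uncountable`).
-/

namespace Rank74

/-! ### Finite computations in the Moebius-Kantor graph -/

instance : DecidableRel moebiusKantorRel
  | Sum.inl i, Sum.inl j => inferInstanceAs (Decidable (j = i + 1))
  | Sum.inl i, Sum.inr j => inferInstanceAs (Decidable (j = i))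
  | Sum.inr i, Sum.inr j => inferInstanceAs (Decidable (j = i + 3))
  | Sum.inr _, Sum.inl _ => inferInstanceAs (Decidable False)

instance : DecidableRel moebiusKantor.Adj := fun a b =>
  inferInstanceAs (Decidable (a ≠ b ∧ (moebiusKantorRel a b ∨ moebiusKantorRel b a)))

/-- The three neighbours of a vertex of the Moebius-Kantor graph. -/
def mkNbr : ZMod 8 ⊕ ZMod 8 → Fin 3 → ZMod 8 ⊕ ZMod 8
  | Sum.inl i => ![Sum.inl (i + 1), Sum.inl (i - 1), Sum.inr i]
  | Sum.inr i => ![Sum.inr (i + 3), Sum.inr (i - 3), Sum.inl i]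

lemma mk_adj_iff : ∀ a b, moebiusKantor.Adj a b ↔ ∃ i, mkNbr a i = b := by
  decide +kernel

lemma mkNbr_injective : ∀ a i j, mkNbr a i = mkNbr a j → i = j := by
  decide +kernel

lemma mkNbr_triangle : ∀ a i j k, mkNbr (mkNbr (mkNbr a i) j) k ≠ a := by
  decide +kernel

lemma mkNbr_quad : ∀ a i j k, ∀ l, mkNbr (mkNbr (mkNbr (mkNbr a i) j) k) l = a →
    mkNbr (mkNbr a i) j = a ∨ mkNbr (mkNbr (mkNbr a i) j) k = mkNbr a i := by
  decide +kernel

lemma mkNbr_pent : ∀ a i j k l m,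
    mkNbr (mkNbr (mkNbr (mkNbr (mkNbr a i) j) k) l) m ≠ a := by
  decide +kernel

lemma mk_no_triangle {a b c : ZMod 8 ⊕ ZMod 8} (h1 : moebiusKantor.Adj a b)
    (h2 : moebiusKantor.Adj b c) (h3 : moebiusKantor.Adj c a) : False := by
  rw [mk_adj_iff] at h1 h2 h3
  obtain ⟨i, rfl⟩ := h1
  obtain ⟨j, rfl⟩ := h2
  obtain ⟨k, hk⟩ := h3
  exact mkNbr_triangle _ _ _ _ hk

lemma mk_quad {a b c d : ZMod 8 ⊕ ZMod 8} (h1 : moebiusKantor.Adj a b)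
    (h2 : moebiusKantor.Adj b c) (h3 : moebiusKantor.Adj c d) (h4 : moebiusKantor.Adj d a) :
    a = c ∨ b = d := by
  rw [mk_adj_iff] at h1 h2 h3 h4
  obtain ⟨i, rfl⟩ := h1
  obtain ⟨j, rfl⟩ := h2
  obtain ⟨k, rfl⟩ := h3
  obtain ⟨l, hl⟩ := h4
  exact (mkNbr_quad _ _ _ _ _ hl).imp Eq.symm Eq.symm

lemma mk_pent {a b c d e : ZMod 8 ⊕ ZMod 8} (h1 : moebiusKantor.Adj a b)
    (h2 : moebiusKantor.Adj b c) (h3 : moebiusKantor.Adj c d) (h4 : moebiusKantor.Adj d e)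
    (h5 : moebiusKantor.Adj e a) : False := by
  rw [mk_adj_iff] at h1 h2 h3 h4 h5
  obtain ⟨i, rfl⟩ := h1
  obtain ⟨j, rfl⟩ := h2
  obtain ⟨k, rfl⟩ := h3
  obtain ⟨l, rfl⟩ := h4
  obtain ⟨m, hm⟩ := h5
  exact mkNbr_pent _ _ _ _ _ _ hm

/-- Every neighbour of `a` lies on a path of length three from `a` to `d`. When `a` and `d` are
the end points of a root of the Moebius-Kantor graph, this means that the root has rank two. -/
def Full {W : Type*} (G : SimpleGraph W) (a d : W) : Prop :=
  ∀ b, G.Adj a b → ∃ c, G.Adj b c ∧ G.Adj c d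

lemma mk_full_iff (a d : ZMod 8 ⊕ ZMod 8) :
    Full moebiusKantor a d ↔ ∀ i, ∃ j, ∃ k, mkNbr (mkNbr (mkNbr a i) j) k = d := by
  simp only [Full, mk_adj_iff]
  constructor
  · intro h i
    obtain ⟨c, ⟨j, rfl⟩, k, hk⟩ := h _ ⟨i, rfl⟩
    exact ⟨j, k, hk⟩
  · rintro h b ⟨i, rfl⟩
    obtain ⟨j, k, hk⟩ := h i
    exact ⟨_, ⟨j, rfl⟩, k, hk⟩

lemma mk_full_symm : ∀ a d : ZMod 8 ⊕ ZMod 8, Full moebiusKantor a d ↔ Full moebiusKantor d a := by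
  simp only [mk_full_iff]
  decide +kernel

lemma mkNbr_full_toggle : ∀ (c : ZMod 8 ⊕ ZMod 8) (i j k l : Fin 3), i ≠ j → k ≠ l →
    mkNbr (mkNbr c j) k ≠ c → mkNbr (mkNbr c j) l ≠ c →
    (Full moebiusKantor (mkNbr c i) (mkNbr (mkNbr c j) k) ↔
      ¬ Full moebiusKantor (mkNbr c i) (mkNbr (mkNbr c j) l)) := by
  simp only [mk_full_iff]
  decide +kernel

lemma mk_full_toggle {y c b z z' : ZMod 8 ⊕ ZMod 8} (h1 : moebiusKantor.Adj y c)
    (h2 : moebiusKantor.Adj c b) (h3 : moebiusKantor.Adj b z) (h3' : moebiusKantor.Adj b z')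
    (hyb : y ≠ b) (hz : z ≠ c) (hz' : z' ≠ c) (hzz : z ≠ z') :
    Full moebiusKantor y z ↔ ¬ Full moebiusKantor y z' := by
  rw [SimpleGraph.adj_comm, mk_adj_iff] at h1
  rw [mk_adj_iff] at h2 h3 h3'
  obtain ⟨i, rfl⟩ := h1
  obtain ⟨j, rfl⟩ := h2
  obtain ⟨k, rfl⟩ := h3
  obtain ⟨l, rfl⟩ := h3'
  exact mkNbr_full_toggle c i j k l (by rintro rfl; exact hyb rfl) (by rintro rfl; exact hzz rfl)
    hz hz'

/-! ### Triangles and charts of links -/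

lemma mem_of_subset {V : Type*} {X : PreAbstractSimplicialComplex V} {s t : Finset V}
    (hs : s ∈ X) (hts : t ⊆ s) (ht : t.Nonempty) : t ∈ X :=
  (X.isRelLowerSet_faces hs).2 hts ht

lemma nonempty_of_mem {V : Type*} {X : PreAbstractSimplicialComplex V} {s : Finset V}
    (hs : s ∈ X) : s.Nonempty :=
  (X.isRelLowerSet_faces hs).1

lemma mem_vertices_of_mem {V : Type*} {X : PreAbstractSimplicialComplex V} {s : Finset V}
    (hs : s ∈ X) {v : V} (hv : v ∈ s) : v ∈ vertices X :=
  mem_of_subset hs (by simpa) (by simp)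

section Charts

variable {V : Type*} [DecidableEq V] {X : PreAbstractSimplicialComplex V}

/-- `a`, `b`, `c` span a triangle of `X`. -/
abbrev Tri (X : PreAbstractSimplicialComplex V) (a b c : V) : Prop := (linkGraph X a).Adj b c

lemma tri_def {a b c : V} : Tri X a b c ↔ ({a, b, c} : Finset V) ∈ X ∧
    ({a, b, c} : Finset V).card = 3 := Iff.rfl

lemma card_triple_eq {a b c : V} : ({a, b, c} : Finset V).card = 3 ↔ a ≠ b ∧ a ≠ c ∧ b ≠ c := by
  constructor
  · intro h
    refine ⟨?_, ?_, ?_⟩ <;> rintro rfl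
    · have := Finset.card_le_two (a := a) (b := c); simp at h; omega
    · have := Finset.card_le_two (a := a) (b := b)
      rw [Finset.pair_comm b a] at h; simp at h; omega
    · have := Finset.card_le_two (a := a) (b := b); simp at h; omega
  · rintro ⟨h1, h2, h3⟩
    exact Finset.card_eq_three.2 ⟨a, b, c, h1, h2, h3, rfl⟩

lemma tri_iff {a b c : V} : Tri X a b c ↔
    ({a, b, c} : Finset V) ∈ X ∧ a ≠ b ∧ a ≠ c ∧ b ≠ c := by
  rw [tri_def, card_triple_eq]

lemma Tri.right {a b c : V} (h : Tri X a b c) : Tri X a c b := SimpleGraph.Adj.symm h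

lemma Tri.left {a b c : V} (h : Tri X a b c) : Tri X b a c := by
  have e : ({b, a, c} : Finset V) = {a, b, c} := by ext; simp; tauto
  change _ ∈ triangles X
  rw [e]; exact h

lemma Tri.rot {a b c : V} (h : Tri X a b c) : Tri X b c a := h.left.right

lemma Tri.mem {a b c : V} (h : Tri X a b c) : ({a, b, c} : Finset V) ∈ X := h.1

lemma Tri.ne {a b c : V} (h : Tri X a b c) : a ≠ b := (tri_iff.1 h).2.1

lemma Tri.adj {a b c : V} (h : Tri X a b c) : (skeleton X).Adj a b :=
  ⟨h.ne, mem_of_subset h.mem (by intro; simp; tauto) (by simp)⟩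

lemma Tri.adj' {a b c : V} (h : Tri X a b c) : (skeleton X).Adj b c := h.rot.adj

lemma adj_mem_left {a b : V} (h : (skeleton X).Adj a b) : a ∈ vertices X :=
  mem_vertices_of_mem h.2 (by simp)

lemma adj_mem_right {a b : V} (h : (skeleton X).Adj a b) : b ∈ vertices X :=
  adj_mem_left h.symm

/-- `φ` identifies the Moebius-Kantor graph with the link of `v`. -/
structure IsChart (X : PreAbstractSimplicialComplex V) (v : V) (φ : ZMod 8 ⊕ ZMod 8 → V) :
    Prop where
  inj : Function.Injective φ
  adj_iff : ∀ u, (skeleton X).Adj v u ↔ u ∈ Set.range φ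
  tri_iff : ∀ m m', Tri X v (φ m) (φ m') ↔ moebiusKantor.Adj m m'

/-- The link of `v` is isomorphic to the Moebius-Kantor graph. -/
def HasMKLink (X : PreAbstractSimplicialComplex V) (v : V) : Prop := ∃ φ, IsChart X v φ

lemma hasMKLink_iff {v : V} : Nonempty (link X v ≃g moebiusKantor) ↔ HasMKLink X v := by
  constructor
  · rintro ⟨e⟩
    refine ⟨fun m => (e.symm m).1, fun m m' h => e.symm.injective (Subtype.ext h), fun u => ?_,
      fun m m' => ?_⟩
    · constructor
      · exact fun h => ⟨e ⟨u, h⟩, by simp⟩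
      · rintro ⟨m, rfl⟩
        exact (e.symm m).2
    · rw [← e.symm.map_adj_iff]
      rfl
  · rintro ⟨φ, h⟩
    let f : ZMod 8 ⊕ ZMod 8 → (skeleton X).neighborSet v :=
      fun m => ⟨φ m, (h.adj_iff _).2 ⟨m, rfl⟩⟩
    have hf : Function.Bijective f := by
      refine ⟨fun m m' e => h.inj (congrArg Subtype.val e), fun ⟨u, hu⟩ => ?_⟩
      obtain ⟨m, rfl⟩ := (h.adj_iff u).1 hu
      exact ⟨m, rfl⟩
    exact ⟨RelIso.symm ⟨Equiv.ofBijective f hf, fun {m m'} => h.tri_iff m m'⟩⟩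

lemma IsChart.tri_cases {v : V} {φ : ZMod 8 ⊕ ZMod 8 → V} (h : IsChart X v φ) {m} {b : V}
    (hb : Tri X v (φ m) b) : ∃ i, b = φ (mkNbr m i) := by
  obtain ⟨m', rfl⟩ := (h.adj_iff b).1 hb.right.adj
  obtain ⟨i, rfl⟩ := (mk_adj_iff _ _).1 ((h.tri_iff _ _).1 hb)
  exact ⟨i, rfl⟩

lemma IsChart.tri_mkNbr {v : V} {φ : ZMod 8 ⊕ ZMod 8 → V} (h : IsChart X v φ) (m) (i) :
    Tri X v (φ m) (φ (mkNbr m i)) :=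
  (h.tri_iff _ _).2 ((mk_adj_iff _ _).2 ⟨i, rfl⟩)

lemma IsChart.full_iff {v : V} {φ : ZMod 8 ⊕ ZMod 8 → V} (h : IsChart X v φ) (m m') :
    Full (linkGraph X v) (φ m) (φ m') ↔ Full moebiusKantor m m' := by
  constructor
  · intro hf b hb
    obtain ⟨c, h1, h2⟩ := hf (φ b) ((h.tri_iff _ _).2 hb)
    obtain ⟨i, rfl⟩ := h.tri_cases h1
    exact ⟨_, (h.tri_iff _ _).1 h1, (h.tri_iff _ _).1 h2⟩
  · intro hf b hb
    obtain ⟨i, rfl⟩ := h.tri_cases hb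
    obtain ⟨c, h1, h2⟩ := hf _ ((h.tri_iff _ _).1 hb)
    exact ⟨φ c, (h.tri_iff _ _).2 h1, (h.tri_iff _ _).2 h2⟩

namespace HasMKLink

variable {v : V}

lemma no_triangle (hv : HasMKLink X v) {a b c : V} (h1 : Tri X v a b) (h2 : Tri X v b c)
    (h3 : Tri X v c a) : False := by
  obtain ⟨φ, h⟩ := hv
  obtain ⟨m, rfl⟩ := (h.adj_iff a).1 h1.adj
  obtain ⟨m', rfl⟩ := (h.adj_iff b).1 h2.adj
  obtain ⟨m'', rfl⟩ := (h.adj_iff c).1 h3.adj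
  rw [h.tri_iff] at h1 h2 h3
  exact mk_no_triangle h1 h2 h3

lemma quad (hv : HasMKLink X v) {a b c d : V} (h1 : Tri X v a b) (h2 : Tri X v b c)
    (h3 : Tri X v c d) (h4 : Tri X v d a) : a = c ∨ b = d := by
  obtain ⟨φ, h⟩ := hv
  obtain ⟨m, rfl⟩ := (h.adj_iff a).1 h1.adj
  obtain ⟨m', rfl⟩ := (h.adj_iff b).1 h2.adj
  obtain ⟨p, rfl⟩ := (h.adj_iff c).1 h3.adj
  obtain ⟨p', rfl⟩ := (h.adj_iff d).1 h4.adj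
  rw [h.tri_iff] at h1 h2 h3 h4
  exact (mk_quad h1 h2 h3 h4).imp (congrArg φ) (congrArg φ)

lemma pent (hv : HasMKLink X v) {a b c d e : V} (h1 : Tri X v a b) (h2 : Tri X v b c)
    (h3 : Tri X v c d) (h4 : Tri X v d e) (h5 : Tri X v e a) : False := by
  obtain ⟨φ, h⟩ := hv
  obtain ⟨m, rfl⟩ := (h.adj_iff a).1 h1.adj
  obtain ⟨m', rfl⟩ := (h.adj_iff b).1 h2.adj
  obtain ⟨p, rfl⟩ := (h.adj_iff c).1 h3.adj
  obtain ⟨p', rfl⟩ := (h.adj_iff d).1 h4.adj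
  obtain ⟨q, rfl⟩ := (h.adj_iff e).1 h5.adj
  rw [h.tri_iff] at h1 h2 h3 h4 h5
  exact mk_pent h1 h2 h3 h4 h5

/-- Every edge at `v` is contained in exactly three triangles. -/
lemma cubic (hv : HasMKLink X v) {a : V} (ha : (skeleton X).Adj v a) :
    ∃ f : Fin 3 → V, Function.Injective f ∧ ∀ w, Tri X v a w ↔ ∃ i, w = f i := by
  obtain ⟨φ, h⟩ := hv
  obtain ⟨m, rfl⟩ := (h.adj_iff a).1 ha
  refine ⟨fun i => φ (mkNbr m i), fun i j e => mkNbr_injective _ _ _ (h.inj e), fun w => ?_⟩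
  constructor
  · exact h.tri_cases
  · rintro ⟨i, rfl⟩
    exact h.tri_mkNbr m i

lemma exists_tri (hv : HasMKLink X v) {a : V} (ha : (skeleton X).Adj v a) :
    ∃ b, Tri X v a b := by
  obtain ⟨f, -, hf⟩ := hv.cubic ha
  exact ⟨f 0, (hf _).2 ⟨0, rfl⟩⟩

/-- If `b` is one of the three neighbours of `a` in the link of `v`, then there are exactly two
others. -/
lemma cubic_of_tri (hv : HasMKLink X v) {a b : V} (hb : Tri X v a b) :
    ∃ c d, b ≠ c ∧ b ≠ d ∧ c ≠ d ∧ ∀ w, Tri X v a w ↔ w = b ∨ w = c ∨ w = d := by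
  obtain ⟨f, hi, hf⟩ := hv.cubic hb.adj
  obtain ⟨i, rfl⟩ := (hf b).1 hb
  have key : ∀ i : Fin 3, ∃ j k : Fin 3, i ≠ j ∧ i ≠ k ∧ j ≠ k ∧ ∀ l, l = i ∨ l = j ∨ l = k := by
    decide
  obtain ⟨j, k, h1, h2, h3, h4⟩ := key i
  refine ⟨f j, f k, hi.ne h1, hi.ne h2, hi.ne h3, fun w => ?_⟩
  rw [hf]
  constructor
  · rintro ⟨l, rfl⟩
    rcases h4 l with rfl | rfl | rfl <;> simp
  · rintro (rfl | rfl | rfl) <;> exact ⟨_, rfl⟩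

lemma exists_other (hv : HasMKLink X v) {a b : V} (hb : Tri X v a b) :
    ∃ c, c ≠ b ∧ Tri X v a c := by
  obtain ⟨c, d, h1, -, -, h⟩ := hv.cubic_of_tri hb
  exact ⟨c, h1.symm, (h c).2 (by simp)⟩

lemma full_symm (hv : HasMKLink X v) {a b : V} (ha : (skeleton X).Adj v a)
    (hb : (skeleton X).Adj v b) :
    Full (linkGraph X v) a b ↔ Full (linkGraph X v) b a := by
  obtain ⟨φ, h⟩ := hv
  obtain ⟨m, rfl⟩ := (h.adj_iff a).1 ha
  obtain ⟨m', rfl⟩ := (h.adj_iff b).1 hb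
  rw [h.full_iff, h.full_iff, mk_full_symm]

/-- A path of length two in the link of `v` has two extensions to a root, and exactly one of them
has rank two. -/
lemma full_toggle (hv : HasMKLink X v) {y c b z z' : V} (h1 : Tri X v y c) (h2 : Tri X v c b)
    (h3 : Tri X v b z) (h3' : Tri X v b z') (hyb : y ≠ b) (hz : z ≠ c) (hz' : z' ≠ c)
    (hzz : z ≠ z') : Full (linkGraph X v) y z ↔ ¬ Full (linkGraph X v) y z' := by
  obtain ⟨φ, h⟩ := hv
  obtain ⟨m₁, rfl⟩ := (h.adj_iff y).1 h1.adj
  obtain ⟨m₂, rfl⟩ := (h.adj_iff c).1 h2.adj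
  obtain ⟨m₃, rfl⟩ := (h.adj_iff b).1 h3.adj
  obtain ⟨m₄, rfl⟩ := (h.adj_iff z).1 h3.right.adj
  obtain ⟨m₅, rfl⟩ := (h.adj_iff z').1 h3'.right.adj
  rw [h.tri_iff] at h1 h2 h3 h3'
  rw [h.full_iff, h.full_iff]
  exact mk_full_toggle h1 h2 h3 h3' (fun e => hyb (by rw [e])) (fun e => hz (by rw [e]))
    (fun e => hz' (by rw [e])) (fun e => hzz (by rw [e]))

/-- The end points of a path of length three without backtracking are at distance three. -/
lemma dist_eq_three (hv : HasMKLink X v) {y c b z : V} (h1 : Tri X v y c) (h2 : Tri X v c b)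
    (h3 : Tri X v b z) (hyb : y ≠ b) (hcz : c ≠ z) : (linkGraph X v).dist y z = 3 := by
  let p : (linkGraph X v).Walk y z := .cons h1 (.cons h2 (.cons h3 .nil))
  have hle : (linkGraph X v).dist y z ≤ 3 := SimpleGraph.dist_le p
  obtain ⟨q, hq⟩ := p.reachable.exists_walk_length_eq_dist
  rw [← hq] at hle ⊢
  match q with
  | .nil => exact (hv.no_triangle h1 h2 h3).elim
  | .cons g1 .nil => exact ((hv.quad h1 h2 h3 (Tri.right g1)).elim hyb hcz).elim
  | .cons g1 (.cons g2 .nil) =>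
    exact (hv.pent h1 h2 h3 (Tri.right g2) (Tri.right g1)).elim
  | .cons g1 (.cons g2 (.cons g3 r)) =>
    simp only [SimpleGraph.Walk.length_cons] at hle ⊢
    omega

lemma rootRank_eq_two_iff (hv : HasMKLink X v) {y c b z : V} (h1 : Tri X v y c) (h2 : Tri X v c b)
    (h3 : Tri X v b z) (hyb : y ≠ b) (hcz : c ≠ z) :
    rootRank (linkGraph X v) ![y, c, b, z] = 2 ↔ Full (linkGraph X v) y z := by
  have hd := hv.dist_eq_three h1 h2 h3 hyb hcz
  set G := linkGraph X v with hG
  obtain ⟨f, hfi, hf⟩ := hv.cubic h1.adj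
  have hnbr : G.neighborSet y = Set.range f := by
    ext w
    rw [SimpleGraph.mem_neighborSet, Set.mem_range]
    exact (hf w).trans (exists_congr fun _ => eq_comm)
  have hn3 : (G.neighborSet y).ncard = 3 := by
    rw [hnbr, ← Set.image_univ, Set.ncard_image_of_injective _ hfi]
    simp
  have hfin : (G.neighborSet y).Finite := by rw [hnbr]; exact Set.finite_range f
  set R : Set (Fin 4 → V) := {β | IsRoot G β ∧ β 0 = y ∧ β 3 = z} with hR
  set I : Set V := {u | G.Adj y u ∧ ∃ w, G.Adj u w ∧ G.Adj w z} with hI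
  have hIs : I ⊆ G.neighborSet y := fun u hu => hu.1
  -- a root between fixed end points is determined by its second vertex, the girth being six
  have hinj : Set.InjOn (fun β : Fin 4 → V => β 1) R := by
    rintro β ⟨⟨b1, b2, b3, b4⟩, b5, b6⟩ γ ⟨⟨c1, c2, c3, c4⟩, c5, c6⟩ e
    simp only at e
    have e2 : β 2 = γ 2 := by
      rw [b6] at b3; rw [c6] at c3
      rcases hv.quad b2 b3 (Tri.right c3) (by rw [e]; exact Tri.right c2) with h | h
      · rw [b6, ← h, SimpleGraph.dist_eq_one_iff_adj.2 b1] at b4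
        omega
      · exact h
    funext i
    fin_cases i
    · simp [b5, c5]
    · exact e
    · exact e2
    · simp [b6, c6]
  have himg : (fun β : Fin 4 → V => β 1) '' R = I := by
    ext u
    constructor
    · rintro ⟨β, ⟨⟨b1, b2, b3, b4⟩, rfl, rfl⟩, rfl⟩
      exact ⟨b1, β 2, b2, b3⟩
    · rintro ⟨g1, w, g2, g3⟩
      exact ⟨![y, u, w, z], ⟨⟨g1, g2, g3, hd⟩, rfl, rfl⟩, rfl⟩
  have hRI : R.ncard = I.ncard := by rw [← himg, hinj.ncard_image]
  have hRfin : R.Finite := Set.Finite.of_finite_image (himg ▸ hfin.subset hIs) hinj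
  have hα : ![y, c, b, z] ∈ R := ⟨⟨h1, h2, h3, hd⟩, rfl, rfl⟩
  have hN : {β : Fin 4 → V | IsRoot G β ∧ β ≠ ![y, c, b, z] ∧ β 0 = (![y, c, b, z] : Fin 4 → V) 0 ∧
      β 3 = (![y, c, b, z] : Fin 4 → V) 3} = R \ {![y, c, b, z]} := by
    ext β
    simp only [hR, Set.mem_ofPred_eq, Set.mem_sdiff, Set.mem_singleton_iff]
    exact ⟨fun h => ⟨⟨h.1, h.2.2⟩, h.2.1⟩, fun h => ⟨h.1.1, h.2, h.1.2⟩⟩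
  have hcard := Set.ncard_sdiff_singleton_add_one hα hRfin
  have hfull : Full G y z ↔ I = G.neighborSet y := by
    constructor
    · exact fun h => hIs.antisymm fun u hu => ⟨hu, h u hu⟩
    · exact fun h u hu => (h.symm ▸ hu : u ∈ I).2
  have hcardI : I = G.neighborSet y ↔ I.ncard = 3 := by
    constructor
    · rintro h; rw [h, hn3]
    · exact fun h => Set.eq_of_subset_of_ncard_le hIs (by rw [h, hn3]) hfin
  rw [hfull, hcardI, ← hRI, ← hcard, rootRank, hN]
  simp only [Matrix.cons_val_zero, hn3]
  constructor
  · intro h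
    have : ((R \ {![y, c, b, z]}).ncard : ℚ) = 2 := by push_cast at h; linarith
    have h' : (R \ {![y, c, b, z]}).ncard = 2 := by exact_mod_cast this
    omega
  · intro h
    have h' : (R \ {![y, c, b, z]}).ncard = 2 := by omega
    rw [h']; norm_num

end HasMKLink
end Charts

/-! ### Good complexes -/

section Good

variable {V : Type*} [DecidableEq V] {X Y : PreAbstractSimplicialComplex V}

lemma HasMKLink.transfer {v : V} (h : HasMKLink X v)
    (hadj : ∀ u, (skeleton Y).Adj v u ↔ (skeleton X).Adj v u)
    (htri : ∀ a b, Tri Y v a b ↔ Tri X v a b) : HasMKLink Y v := by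
  obtain ⟨φ, hφ⟩ := h
  exact ⟨φ, hφ.inj, fun u => (hadj u).trans (hφ.adj_iff u), fun m m' => (htri _ _).trans
    (hφ.tri_iff m m')⟩

/-- A complex `X` of dimension at most two, with a level function `ℓ` on its vertices, which looks
like the ball of radius `n` around `x` in a simply connected complex of rank `7/4`: the links of the
vertices of level less than `n` are Moebius-Kantor graphs, the vertices of the preceding level
adjacent to a given vertex form a vertex or an edge of its link, and every edge joining two
vertices of the same level is in exactly one triangle with a vertex of the preceding level.
The value `n = ⊤` is allowed. -/
structure IsGood (X : PreAbstractSimplicialComplex V) (x : V) (n : ℕ∞) (ℓ : V → ℕ) : Prop where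
  card_le : ∀ s ∈ X, s.card ≤ 3
  base_mem : x ∈ vertices X
  level_eq_zero : ∀ v ∈ vertices X, ℓ v = 0 ↔ v = x
  level_le : ∀ v ∈ vertices X, (ℓ v : ℕ∞) ≤ n
  level_adj : ∀ u v, (skeleton X).Adj u v → ℓ u ≤ ℓ v + 1
  finite : ∀ k : ℕ, {v | v ∈ vertices X ∧ ℓ v ≤ k}.Finite
  hasMKLink : ∀ v ∈ vertices X, (ℓ v : ℕ∞) < n → HasMKLink X v
  down_exists : ∀ v ∈ vertices X, v ≠ x → ∃ u, (skeleton X).Adj v u ∧ ℓ u + 1 = ℓ v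
  down_tri : ∀ v u u', (skeleton X).Adj v u → (skeleton X).Adj v u' → ℓ u + 1 = ℓ v →
    ℓ u' + 1 = ℓ v → u ≠ u' → Tri X v u u'
  down_two : ∀ v u u' u'', (skeleton X).Adj v u → (skeleton X).Adj v u' →
    (skeleton X).Adj v u'' → ℓ u + 1 = ℓ v → ℓ u' + 1 = ℓ v → ℓ u'' + 1 = ℓ v →
    u = u' ∨ u = u'' ∨ u' = u''
  same_exists : ∀ v w, (skeleton X).Adj v w → ℓ v = ℓ w → ∃ u, Tri X v w u ∧ ℓ u + 1 = ℓ v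
  same_unique : ∀ v w u u', Tri X v w u → Tri X v w u' → ℓ v = ℓ w → ℓ u + 1 = ℓ v →
    ℓ u' + 1 = ℓ v → u = u'
  no_flat : ∀ u v w, Tri X u v w → ℓ u = ℓ v → ℓ v = ℓ w → False

namespace IsGood

variable {x : V} {n : ℕ∞} {ℓ : V → ℕ}

lemma level_base (h : IsGood X x n ℓ) : ℓ x = 0 := (h.level_eq_zero x h.base_mem).2 rfl

lemma congr_level (h : IsGood X x n ℓ) {ℓ' : V → ℕ} (e : ∀ v ∈ vertices X, ℓ' v = ℓ v) :
    IsGood X x n ℓ' := by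
  have tr : ∀ {a b c}, Tri X a b c → ℓ' a = ℓ a ∧ ℓ' b = ℓ b ∧ ℓ' c = ℓ c := fun t =>
    ⟨e _ (adj_mem_left t.adj), e _ (adj_mem_left t.adj'), e _ (adj_mem_right t.adj')⟩
  have ad : ∀ {a b}, (skeleton X).Adj a b → ℓ' a = ℓ a ∧ ℓ' b = ℓ b := fun t =>
    ⟨e _ (adj_mem_left t), e _ (adj_mem_right t)⟩
  refine ⟨h.card_le, h.base_mem, fun v hv => by rw [e v hv]; exact h.level_eq_zero v hv,
    fun v hv => by rw [e v hv]; exact h.level_le v hv,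
    fun u v a => by rw [(ad a).1, (ad a).2]; exact h.level_adj u v a, fun k => ?_,
    fun v hv => by rw [e v hv]; exact h.hasMKLink v hv, fun v hv hx => ?_,
    fun v u u' a a' g g' ne => ?_, fun v u u' u'' a a' a'' g g' g'' => ?_,
    fun v w a g => ?_, fun v w u u' t t' g g1 g2 => ?_, fun u v w t g g' => ?_⟩
  · exact (h.finite k).subset fun v hv => ⟨hv.1, by rw [← e v hv.1]; exact hv.2⟩
  · obtain ⟨u, a, g⟩ := h.down_exists v hv hx
    exact ⟨u, a, by rw [(ad a).1, (ad a).2]; exact g⟩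
  · rw [(ad a).1, (ad a).2] at g
    rw [(ad a').1, (ad a').2] at g'
    exact h.down_tri v u u' a a' g g' ne
  · rw [(ad a).1, (ad a).2] at g
    rw [(ad a').1, (ad a').2] at g'
    rw [(ad a'').1, (ad a'').2] at g''
    exact h.down_two v u u' u'' a a' a'' g g' g''
  · rw [(ad a).1, (ad a).2] at g
    obtain ⟨u, t, g1⟩ := h.same_exists v w a g
    exact ⟨u, t, by rw [(tr t).1, (tr t).2.2]; exact g1⟩
  · rw [(tr t).1, (tr t).2.1] at g
    rw [(tr t).1, (tr t).2.2] at g1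
    rw [(tr t).1, (tr t').2.2] at g2
    exact h.same_unique v w u u' t t' g g1 g2
  · rw [(tr t).1, (tr t).2.1] at g
    rw [(tr t).2.2, (tr t).2.1] at g'
    exact h.no_flat u v w t g g'

lemma exists_walk (h : IsGood X x n ℓ) (k : ℕ) :
    ∀ v ∈ vertices X, ℓ v = k → ∃ p : (skeleton X).Walk v x, p.length = k := by
  induction k with
  | zero =>
    intro v hv hk
    obtain rfl := (h.level_eq_zero v hv).1 hk
    exact ⟨.nil, rfl⟩
  | succ k ih =>
    intro v hv hk
    have hx : v ≠ x := by rintro rfl; rw [h.level_base] at hk; omega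
    obtain ⟨u, a, g⟩ := h.down_exists v hv hx
    obtain ⟨p, hp⟩ := ih u (adj_mem_right a) (by omega)
    exact ⟨.cons a p, by simp [hp]⟩

lemma level_le_length (h : IsGood X x n ℓ) {u v : V} (p : (skeleton X).Walk u v) :
    ℓ u ≤ ℓ v + p.length := by
  induction p with
  | nil => simp
  | cons a p ih =>
    have := h.level_adj _ _ a
    simp only [SimpleGraph.Walk.length_cons]
    omega

lemma edist_eq (h : IsGood X x n ℓ) {v : V} (hv : v ∈ vertices X) :
    (skeleton X).edist x v = ℓ v := by
  obtain ⟨p, hp⟩ := h.exists_walk _ v hv rfl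
  rw [SimpleGraph.edist_comm]
  apply le_antisymm
  · rw [← hp]
    exact SimpleGraph.edist_le p
  · obtain ⟨q, hq⟩ := p.reachable.exists_walk_length_eq_edist
    rw [← hq]
    have := h.level_le_length q
    rw [h.level_base, zero_add] at this
    exact_mod_cast this

lemma dist_eq (h : IsGood X x n ℓ) {v : V} (hv : v ∈ vertices X) :
    (skeleton X).dist x v = ℓ v := by
  rw [SimpleGraph.dist, h.edist_eq hv]; rfl

lemma mem_ball_iff (h : IsGood X x n ℓ) {k : ℕ} {s : Finset V} :
    s ∈ ball X x k ↔ s ∈ X ∧ ∀ v ∈ s, ℓ v ≤ k := by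
  refine and_congr_right fun hs => forall₂_congr fun v hv => ?_
  rw [h.edist_eq (mem_vertices_of_mem hs hv)]
  exact Nat.cast_le

lemma mem_vertices_ball_iff (h : IsGood X x n ℓ) {k : ℕ} {v : V} :
    v ∈ vertices (ball X x k) ↔ v ∈ vertices X ∧ ℓ v ≤ k := by
  refine h.mem_ball_iff.trans ?_
  simp [vertices]

lemma ball_adj_iff (h : IsGood X x n ℓ) {k : ℕ} {a b : V} :
    (skeleton (ball X x k)).Adj a b ↔ (skeleton X).Adj a b ∧ ℓ a ≤ k ∧ ℓ b ≤ k := by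
  simp only [skeleton, h.mem_ball_iff]
  simp [and_assoc]

lemma ball_tri_iff (h : IsGood X x n ℓ) {k : ℕ} {a b c : V} :
    Tri (ball X x k) a b c ↔ Tri X a b c ∧ ℓ a ≤ k ∧ ℓ b ≤ k ∧ ℓ c ≤ k := by
  rw [tri_iff, tri_iff, h.mem_ball_iff]
  simp only [Finset.mem_insert, Finset.mem_singleton, forall_eq_or_imp, forall_eq]
  tauto

lemma ball_hasMKLink (h : IsGood X x n ℓ) {k : ℕ} {v : V} (hv : HasMKLink X v) (hk : ℓ v < k) :
    HasMKLink (ball X x k) v := by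
  refine hv.transfer (fun u => ?_) fun a b => ?_
  · rw [h.ball_adj_iff]
    refine ⟨fun g => g.1, fun g => ⟨g, hk.le, ?_⟩⟩
    have := h.level_adj _ _ g.symm
    omega
  · rw [h.ball_tri_iff]
    refine ⟨fun g => g.1, fun g => ⟨g, hk.le, ?_, ?_⟩⟩
    · have := h.level_adj _ _ g.adj.symm
      omega
    · have := h.level_adj _ _ g.right.adj.symm
      omega

/-- The ball of radius `k` in a good complex is good. -/
lemma ball_isGood (h : IsGood X x n ℓ) {k : ℕ} (hk : (k : ℕ∞) ≤ n) :
    IsGood (ball X x k) x k ℓ := by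
  have hx0 := h.level_base
  constructor
  case card_le => exact fun s hs => h.card_le s hs.1
  case base_mem => exact h.mem_vertices_ball_iff.2 ⟨h.base_mem, by omega⟩
  case level_eq_zero => exact fun v hv => h.level_eq_zero v (h.mem_vertices_ball_iff.1 hv).1
  case level_le => exact fun v hv => Nat.cast_le.2 (h.mem_vertices_ball_iff.1 hv).2
  case level_adj => exact fun u v a => h.level_adj u v (h.ball_adj_iff.1 a).1
  case finite =>
    exact fun j => (h.finite j).subset fun v hv => ⟨(h.mem_vertices_ball_iff.1 hv.1).1, hv.2⟩
  case hasMKLink =>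
    exact fun v hv g => h.ball_hasMKLink
      (h.hasMKLink v (h.mem_vertices_ball_iff.1 hv).1 (g.trans_le hk)) (Nat.cast_lt.1 g)
  case down_exists =>
    intro v hv hx
    rw [h.mem_vertices_ball_iff] at hv
    obtain ⟨u, a, g⟩ := h.down_exists v hv.1 hx
    exact ⟨u, h.ball_adj_iff.2 ⟨a, hv.2, by omega⟩, g⟩
  case down_tri =>
    intro v u u' a a' g g' ne
    rw [h.ball_adj_iff] at a a'
    exact h.ball_tri_iff.2 ⟨h.down_tri v u u' a.1 a'.1 g g' ne, a.2.1, a.2.2, a'.2.2⟩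
  case down_two =>
    intro v u u' u'' a a' a''
    rw [h.ball_adj_iff] at a a' a''
    exact h.down_two v u u' u'' a.1 a'.1 a''.1
  case same_exists =>
    intro v w a g
    rw [h.ball_adj_iff] at a
    obtain ⟨u, t, g1⟩ := h.same_exists v w a.1 g
    exact ⟨u, h.ball_tri_iff.2 ⟨t, a.2.1, a.2.2, by omega⟩, g1⟩
  case same_unique =>
    intro v w u u' t t'
    exact h.same_unique v w u u' (h.ball_tri_iff.1 t).1 (h.ball_tri_iff.1 t').1
  case no_flat =>
    exact fun u v w t => h.no_flat u v w (h.ball_tri_iff.1 t).1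

lemma isRankSevenFourths (h : IsGood X x ⊤ ℓ) : IsRankSevenFourths X :=
  ⟨h.card_le, fun v hv => hasMKLink_iff.2 (h.hasMKLink v hv (ENat.natCast_lt_top _))⟩

end IsGood
end Good

/-! ### Good complexes are simply connected -/

section Homotopy

variable {V : Type*} [DecidableEq V] {X : PreAbstractSimplicialComplex V}

namespace EdgeHomotopic

lemma append_left {u v w : V} (p : (skeleton X).Walk u v) {q q' : (skeleton X).Walk v w}
    (h : EdgeHomotopic X q q') : EdgeHomotopic X (p.append q) (p.append q') := by
  induction p with
  | nil => exact h
  | cons a p ih => exact .cons a (ih h)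

lemma append_right {u v w : V} {p p' : (skeleton X).Walk u v} (h : EdgeHomotopic X p p')
    (q : (skeleton X).Walk v w) : EdgeHomotopic X (p.append q) (p'.append q) := by
  induction h with
  | refl p => exact .refl _
  | symm _ ih => exact .symm (ih q)
  | trans _ _ ih ih' => exact .trans (ih q) (ih' q)
  | cons a _ ih => exact .cons a (ih q)
  | backtrack a a' p => exact .backtrack a a' _
  | triangle a b c h p => exact .triangle a b c h _

lemma append_reverse {u v : V} (p : (skeleton X).Walk u v) :
    EdgeHomotopic X (p.append p.reverse) .nil := by
  induction p with
  | nil => exact .refl _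
  | cons a p ih =>
    rw [SimpleGraph.Walk.reverse_cons, SimpleGraph.Walk.cons_append,
      SimpleGraph.Walk.append_assoc]
    exact .trans (.cons a (ih.append_right _)) (.backtrack a a.symm .nil)

lemma nil_of_append {u v : V} {p : (skeleton X).Walk u u} {c : (skeleton X).Walk u v}
    (h : EdgeHomotopic X (p.append c) c) : EdgeHomotopic X p .nil := by
  have h1 : EdgeHomotopic X (p.append (c.append c.reverse)) p := by
    simpa using append_left p (append_reverse c)
  refine h1.symm.trans ?_
  rw [SimpleGraph.Walk.append_assoc]
  exact (h.append_right _).trans (append_reverse c)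

end EdgeHomotopic

namespace IsGood

variable {x : V} {n : ℕ∞} {ℓ : V → ℕ}

/-- Any two geodesics from `v` to the base point are homotopic. -/
lemma geodesic_homotopic (h : IsGood X x n ℓ) (k : ℕ) : ∀ v, ℓ v = k →
    ∀ p q : (skeleton X).Walk v x, p.length = k → q.length = k → EdgeHomotopic X p q := by
  induction k with
  | zero =>
    intro v _ p q hp hq
    obtain rfl := SimpleGraph.Walk.eq_of_length_eq_zero hp
    rw [SimpleGraph.Walk.length_eq_zero_iff] at hp hq
    rw [hp.eq_nil, hq.eq_nil]
    exact .refl _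
  | succ k ih =>
    intro v hv p q hp hq
    match p, q, hp, hq with
    | .cons (v := u) a p, .cons (v := u') b q, hp, hq =>
      simp only [SimpleGraph.Walk.length_cons, add_left_inj] at hp hq
      have e : ℓ u = k := by
        have h1 := h.level_le_length p
        have h2 := h.level_adj _ _ a
        have h3 := h.level_base
        omega
      have e' : ℓ u' = k := by
        have h1 := h.level_le_length q
        have h2 := h.level_adj _ _ b
        have h3 := h.level_base
        omega
      by_cases huu : u = u'
      · subst huu
        exact .cons a (ih u e p q hp hq)
      · have t := h.down_tri v u u' a b (by omega) (by omega) huu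
        obtain ⟨w, t', g⟩ := h.same_exists u u' t.adj' (by omega)
        obtain ⟨r, hr⟩ := h.exists_walk _ w (adj_mem_right t'.adj') rfl
        have h1 := ih u e p (.cons t'.right.adj r) hp (by simp; omega)
        have h2 := ih u' e' q (.cons t'.adj' r) hq (by simp; omega)
        refine .trans (.cons a h1) (.trans (.cons a (.symm (.triangle t'.adj t'.adj' _ t'.mem r))) ?_)
        exact .trans (.triangle a t.adj' b t.mem _) (.cons b h2.symm)

lemma cons_homotopic (h : IsGood X x n ℓ) {u v : V} (a : (skeleton X).Adj u v)
    (p : (skeleton X).Walk u x) (q : (skeleton X).Walk v x) (hp : p.length = ℓ u)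
    (hq : q.length = ℓ v) : EdgeHomotopic X (.cons a q) p := by
  have h1 := h.level_adj _ _ a
  have h2 := h.level_adj _ _ a.symm
  obtain g | g | g : ℓ v + 1 = ℓ u ∨ ℓ u = ℓ v ∨ ℓ u + 1 = ℓ v := by omega
  · exact h.geodesic_homotopic _ u rfl _ _ (by simp; omega) hp
  · obtain ⟨w, t, gw⟩ := h.same_exists u v a g
    obtain ⟨r, hr⟩ := h.exists_walk _ w (adj_mem_right t.adj') rfl
    refine .trans (.cons a (h.geodesic_homotopic _ v rfl q (.cons t.adj' r) hq (by simp; omega))) ?_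
    exact .trans (.triangle a t.adj' t.right.adj t.mem r)
      (h.geodesic_homotopic _ u rfl _ _ (by simp; omega) hp)
  · exact .trans (.cons a (h.geodesic_homotopic _ v rfl q (.cons a.symm p) hq (by simp; omega)))
      (.backtrack a a.symm p)

lemma append_homotopic (h : IsGood X x n ℓ) {u v : V} (p : (skeleton X).Walk u v)
    (hv : v ∈ vertices X)
    (c : (skeleton X).Walk u x) (d : (skeleton X).Walk v x) (hc : c.length = ℓ u)
    (hd : d.length = ℓ v) : EdgeHomotopic X (p.append d) c := by
  induction p with
  | nil => exact h.geodesic_homotopic _ _ rfl _ _ hd hc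
  | cons a p ih =>
    obtain ⟨r, hr⟩ := h.exists_walk _ _ (adj_mem_right a) rfl
    exact .trans (.cons a (ih hv r d hr hd)) (h.cons_homotopic a c r hc hr)

lemma isSimplyConnected (h : IsGood X x n ℓ) : IsSimplyConnected X := by
  refine ⟨⟨x, h.base_mem⟩, fun u hu v hv => ?_, fun u hu p => ?_⟩
  · obtain ⟨p, -⟩ := h.exists_walk _ u hu rfl
    obtain ⟨q, -⟩ := h.exists_walk _ v hv rfl
    exact ⟨p.append q.reverse⟩
  · obtain ⟨c, hc⟩ := h.exists_walk _ u hu rfl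
    exact (h.append_homotopic p hu c c hc hc).nil_of_append

end IsGood
end Homotopy

/-! ### Extension of a good ball by one layer -/

section Extend

variable {V : Type*} [DecidableEq V] {X Y B : PreAbstractSimplicialComplex V}

/-- Membership of a simplex of dimension at most two can be tested on vertices, edges and
triangles. -/
lemma mem_of_card_le {s : Finset V} (hs : s ∈ Y) (hc : s.card ≤ 3)
    (h1 : ∀ a ∈ s, a ∈ vertices X)
    (h2 : ∀ a ∈ s, ∀ b ∈ s, (skeleton Y).Adj a b → (skeleton X).Adj a b)
    (h3 : ∀ a ∈ s, ∀ b ∈ s, ∀ c ∈ s, Tri Y a b c → Tri X a b c) : s ∈ X := by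
  have h0 : 0 < s.card := Finset.card_pos.2 (nonempty_of_mem hs)
  obtain h | h | h : s.card = 1 ∨ s.card = 2 ∨ s.card = 3 := by omega
  · obtain ⟨a, rfl⟩ := Finset.card_eq_one.1 h
    exact h1 a (by simp)
  · obtain ⟨a, b, hab, rfl⟩ := Finset.card_eq_two.1 h
    exact (h2 a (by simp) b (by simp) ⟨hab, hs⟩).2
  · obtain ⟨a, b, c, hab, hac, hbc, rfl⟩ := Finset.card_eq_three.1 h
    exact (h3 a (by simp) b (by simp) c (by simp) (tri_iff.2 ⟨hs, hab, hac, hbc⟩)).mem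

/-- The vertices of level `n`. -/
def IsSphere (B : PreAbstractSimplicialComplex V) (n : ℕ) (ℓ : V → ℕ) (v : V) : Prop :=
  v ∈ vertices B ∧ ℓ v = n

/-- The image of the Moebius-Kantor graph under `φ`. -/
def ChartAdj (φ : ZMod 8 ⊕ ZMod 8 → V) (a b : V) : Prop :=
  ∃ m m', moebiusKantor.Adj m m' ∧ φ m = a ∧ φ m' = b

omit [DecidableEq V] in
lemma ChartAdj.symm {φ : ZMod 8 ⊕ ZMod 8 → V} {a b : V} (h : ChartAdj φ a b) :
    ChartAdj φ b a := by
  obtain ⟨m, m', h, rfl, rfl⟩ := h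
  exact ⟨m', m, h.symm, rfl, rfl⟩

/-- Data for the extension of a good ball `B` of radius `n` by one layer. For every vertex `v`
of level `n`, the map `φ v` is the future chart of the link of `v`; it extends the part of this link
contained in `B`. The future links of two vertices of level `n` meet outside `B` exactly along the
triangles containing both of them. -/
structure ExtData (B : PreAbstractSimplicialComplex V) (n : ℕ) (ℓ : V → ℕ)
    (φ : V → ZMod 8 ⊕ ZMod 8 → V) : Prop where
  inj : ∀ v, IsSphere B n ℓ v → Function.Injective (φ v)
  nbr : ∀ v, IsSphere B n ℓ v → ∀ u, (skeleton B).Adj v u → u ∈ Set.range (φ v)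
  old : ∀ v, IsSphere B n ℓ v → ∀ m, φ v m ∈ vertices B → (skeleton B).Adj v (φ v m)
  tri : ∀ v, IsSphere B n ℓ v → ∀ m m', φ v m ∈ vertices B → φ v m' ∈ vertices B →
    (Tri B v (φ v m) (φ v m') ↔ moebiusKantor.Adj m m')
  compat : ∀ v v' w, IsSphere B n ℓ v → IsSphere B n ℓ v' → w ∉ vertices B →
    ChartAdj (φ v) v' w → ChartAdj (φ v') v w
  meet : ∀ v v' w, IsSphere B n ℓ v → IsSphere B n ℓ v' → v ≠ v' → w ∉ vertices B →
    w ∈ Set.range (φ v) → w ∈ Set.range (φ v') → ChartAdj (φ v) v' w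

/-- The complex obtained from `B` by adding the triangles prescribed by the charts `φ v`, for all
`v` which satisfy `S`. -/
def extend (B : PreAbstractSimplicialComplex V) (S : V → Prop) (φ : V → ZMod 8 ⊕ ZMod 8 → V) :
    PreAbstractSimplicialComplex V where
  faces := {s | s ∈ B ∨ (s.Nonempty ∧ ∃ v m m', S v ∧ moebiusKantor.Adj m m' ∧
    s ⊆ {v, φ v m, φ v m'})}
  isRelLowerSet_faces := by
    rintro s (hs | ⟨hs, v, m, m', hv, hm, h⟩)
    · exact ⟨nonempty_of_mem hs, fun t hts ht => Or.inl (mem_of_subset hs hts ht)⟩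
    · exact ⟨hs, fun t hts ht => Or.inr ⟨ht, v, m, m', hv, hm, subset_trans hts h⟩⟩

lemma mem_extend {S : V → Prop} {φ : V → ZMod 8 ⊕ ZMod 8 → V} {s : Finset V} :
    s ∈ extend B S φ ↔ s ∈ B ∨ (s.Nonempty ∧ ∃ v m m', S v ∧ moebiusKantor.Adj m m' ∧
      s ⊆ {v, φ v m, φ v m'}) := Iff.rfl

open Classical in
/-- The level function of an extension: the new vertices have level `n + 1`. -/
noncomputable def extendLevel (B : PreAbstractSimplicialComplex V) (n : ℕ) (ℓ : V → ℕ) (v : V) : ℕ :=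
  if v ∈ vertices B then ℓ v else n + 1

namespace ExtData

variable {x : V} {n : ℕ} {ℓ : V → ℕ} {φ : V → ZMod 8 ⊕ ZMod 8 → V}

lemma self_notMem (E : ExtData B n ℓ φ) {v : V} (hv : IsSphere B n ℓ v) (m) : φ v m ≠ v := by
  intro e
  have := E.old v hv m (by rw [e]; exact hv.1)
  rw [e] at this
  exact this.ne rfl

lemma tri_of_chartAdj (E : ExtData B n ℓ φ) {v a b : V} (hv : IsSphere B n ℓ v)
    (h : ChartAdj (φ v) a b) : Tri (extend B (IsSphere B n ℓ) φ) v a b := by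
  obtain ⟨m, m', h, rfl, rfl⟩ := h
  refine tri_iff.2 ⟨Or.inr ⟨by simp, v, m, m', hv, h, subset_rfl⟩, (E.self_notMem hv m).symm,
    (E.self_notMem hv m').symm, fun e => h.ne (E.inj v hv e)⟩

lemma chartAdj_of_tri (E : ExtData B n ℓ φ) {v a b : V} (hv : IsSphere B n ℓ v)
    (h : Tri B v a b) : ChartAdj (φ v) a b := by
  obtain ⟨m, rfl⟩ := E.nbr v hv a h.adj
  obtain ⟨m', rfl⟩ := E.nbr v hv b h.right.adj
  exact ⟨m, m', (E.tri v hv m m' (adj_mem_right h.adj) (adj_mem_right h.right.adj)).1 h, rfl, rfl⟩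

lemma tri_old_of_chartAdj (E : ExtData B n ℓ φ) {v a b : V} (hv : IsSphere B n ℓ v)
    (h : ChartAdj (φ v) a b) (ha : a ∈ vertices B) (hb : b ∈ vertices B) : Tri B v a b := by
  obtain ⟨m, m', h, rfl, rfl⟩ := h
  exact (E.tri v hv m m' ha hb).2 h

lemma adj_old_of_chartAdj (E : ExtData B n ℓ φ) {v a b : V} (hv : IsSphere B n ℓ v)
    (h : ChartAdj (φ v) a b) (ha : a ∈ vertices B) : (skeleton B).Adj v a := by
  obtain ⟨m, m', h, rfl, rfl⟩ := h
  exact E.old v hv m ha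

lemma tri_extend_of_tri {S : V → Prop} {a b c : V} (h : Tri B a b c) : Tri (extend B S φ) a b c :=
  tri_iff.2 ⟨Or.inl h.mem, (tri_iff.1 h).2⟩

lemma tri_extend_iff (E : ExtData B n ℓ φ) {a b c : V} :
    Tri (extend B (IsSphere B n ℓ) φ) a b c ↔ Tri B a b c ∨
      (IsSphere B n ℓ a ∧ ChartAdj (φ a) b c) ∨ (IsSphere B n ℓ b ∧ ChartAdj (φ b) a c) ∨
      (IsSphere B n ℓ c ∧ ChartAdj (φ c) a b) := by
  constructor
  · intro h
    obtain ⟨h1, hab, hac, hbc⟩ := tri_iff.1 h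
    rcases h1 with h1 | ⟨-, v, m, m', hv, hm, hs⟩
    · exact Or.inl (tri_iff.2 ⟨h1, hab, hac, hbc⟩)
    · have hL : ChartAdj (φ v) (φ v m) (φ v m') := ⟨m, m', hm, rfl, rfl⟩
      have hL' := hL.symm
      have ha : a ∈ ({v, φ v m, φ v m'} : Finset V) := hs (by simp)
      have hb : b ∈ ({v, φ v m, φ v m'} : Finset V) := hs (by simp)
      have hc : c ∈ ({v, φ v m, φ v m'} : Finset V) := hs (by simp)
      simp only [Finset.mem_insert, Finset.mem_singleton] at ha hb hc
      generalize φ v m = p at *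
      generalize φ v m' = q at *
      right
      rcases ha with rfl | rfl | rfl <;> rcases hb with rfl | rfl | rfl <;>
        rcases hc with rfl | rfl | rfl <;> first
        | exact absurd rfl hab
        | exact absurd rfl hac
        | exact absurd rfl hbc
        | tauto
  · rintro (h | ⟨hv, h⟩ | ⟨hv, h⟩ | ⟨hv, h⟩)
    · exact tri_extend_of_tri h
    · exact E.tri_of_chartAdj hv h
    · exact (E.tri_of_chartAdj hv h).left
    · exact (E.tri_of_chartAdj hv h).rot

lemma adj_extend_of_adj {S : V → Prop} {a b : V} (h : (skeleton B).Adj a b) :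
    (skeleton (extend B S φ)).Adj a b :=
  ⟨h.1, Or.inl h.2⟩

lemma adj_extend_iff (E : ExtData B n ℓ φ) {a b : V} :
    (skeleton (extend B (IsSphere B n ℓ) φ)).Adj a b ↔ (skeleton B).Adj a b ∨
      ∃ c, Tri (extend B (IsSphere B n ℓ) φ) a b c := by
  constructor
  · rintro ⟨hab, h | ⟨-, v, m, m', hv, hm, hs⟩⟩
    · exact Or.inl ⟨hab, h⟩
    · have hL := E.tri_of_chartAdj hv ⟨m, m', hm, rfl, rfl⟩
      have ha : a ∈ ({v, φ v m, φ v m'} : Finset V) := hs (by simp)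
      have hb : b ∈ ({v, φ v m, φ v m'} : Finset V) := hs (by simp)
      simp only [Finset.mem_insert, Finset.mem_singleton] at ha hb
      right
      rcases ha with rfl | rfl | rfl <;> rcases hb with rfl | rfl | rfl <;>
        first
        | exact absurd rfl hab
        | exact ⟨_, hL⟩
        | exact ⟨_, hL.right⟩
        | exact ⟨_, hL.left⟩
        | exact ⟨_, hL.rot⟩
        | exact ⟨_, hL.rot.rot⟩
        | exact ⟨_, hL.rot.left⟩
  · rintro (h | ⟨c, h⟩)
    · exact adj_extend_of_adj h
    · exact h.adj

lemma mem_vertices_extend_iff {S : V → Prop} {v : V} : v ∈ vertices (extend B S φ) ↔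
    v ∈ vertices B ∨ ∃ u, S u ∧ (v = u ∨ v ∈ Set.range (φ u)) := by
  refine mem_extend.trans (or_congr_right ?_)
  simp only [Finset.singleton_nonempty, true_and, Finset.singleton_subset_iff, Finset.mem_insert,
    Finset.mem_singleton]
  constructor
  · rintro ⟨u, m, m', hu, -, h | h | h⟩
    · exact ⟨u, hu, Or.inl h⟩
    · exact ⟨u, hu, Or.inr ⟨m, h.symm⟩⟩
    · exact ⟨u, hu, Or.inr ⟨m', h.symm⟩⟩
  · rintro ⟨u, hu, h⟩
    rcases h with h | ⟨m, h⟩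
    · exact ⟨u, .inl 0, .inl 1, hu, by decide, Or.inl h⟩
    · exact ⟨u, m, mkNbr m 0, hu, (mk_adj_iff _ _).2 ⟨0, rfl⟩, Or.inr (Or.inl h.symm)⟩

lemma tri_old (E : ExtData B n ℓ φ) {a b c : V}
    (h : Tri (extend B (IsSphere B n ℓ) φ) a b c) (ha : a ∈ vertices B) (hb : b ∈ vertices B)
    (hc : c ∈ vertices B) : Tri B a b c := by
  rcases E.tri_extend_iff.1 h with h | ⟨hv, h⟩ | ⟨hv, h⟩ | ⟨hv, h⟩
  · exact h
  · exact E.tri_old_of_chartAdj hv h hb hc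
  · exact (E.tri_old_of_chartAdj hv h ha hc).left
  · exact (E.tri_old_of_chartAdj hv h ha hb).rot

lemma adj_old (E : ExtData B n ℓ φ) {a b : V}
    (h : (skeleton (extend B (IsSphere B n ℓ) φ)).Adj a b) (ha : a ∈ vertices B)
    (hb : b ∈ vertices B) : (skeleton B).Adj a b := by
  rcases E.adj_extend_iff.1 h with h | ⟨c, h⟩
  · exact h
  · rcases E.tri_extend_iff.1 h with h | ⟨hv, h⟩ | ⟨hv, h⟩ | ⟨hv, h⟩
    · exact h.adj
    · exact E.adj_old_of_chartAdj hv h hb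
    · exact (E.adj_old_of_chartAdj hv h ha).symm
    · exact (E.tri_old_of_chartAdj hv h ha hb).adj'

/-- The link of a vertex of level `n` in the extension is the prescribed one. -/
lemma tri_sphere_iff (E : ExtData B n ℓ φ) {v b c : V} (hv : IsSphere B n ℓ v) :
    Tri (extend B (IsSphere B n ℓ) φ) v b c ↔ ChartAdj (φ v) b c := by
  refine ⟨fun h => ?_, E.tri_of_chartAdj hv⟩
  have key : ∀ {b c}, IsSphere B n ℓ b → ChartAdj (φ b) v c → ChartAdj (φ v) b c := by
    intro b c hb h
    by_cases hc : c ∈ vertices B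
    · exact E.chartAdj_of_tri hv (E.tri_old_of_chartAdj hb h hv.1 hc).left
    · exact E.compat b v c hb hv hc h
  rcases E.tri_extend_iff.1 h with h | ⟨hv, h⟩ | ⟨hb, h⟩ | ⟨hc, h⟩
  · exact E.chartAdj_of_tri hv h
  · exact h
  · exact key hb h
  · exact (key hc h).symm

lemma adj_sphere_iff (E : ExtData B n ℓ φ) {v b : V} (hv : IsSphere B n ℓ v) :
    (skeleton (extend B (IsSphere B n ℓ) φ)).Adj v b ↔ b ∈ Set.range (φ v) := by
  rw [E.adj_extend_iff]
  constructor
  · rintro (h | ⟨c, h⟩)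
    · exact E.nbr v hv b h
    · obtain ⟨m, m', -, rfl, -⟩ := (E.tri_sphere_iff hv).1 h
      exact ⟨m, rfl⟩
  · rintro ⟨m, rfl⟩
    exact Or.inr ⟨φ v (mkNbr m 0), (E.tri_sphere_iff hv).2
      ⟨m, _, (mk_adj_iff _ _).2 ⟨0, rfl⟩, rfl, rfl⟩⟩

lemma isChart (E : ExtData B n ℓ φ) {v : V} (hv : IsSphere B n ℓ v) :
    IsChart (extend B (IsSphere B n ℓ) φ) v (φ v) := by
  refine ⟨E.inj v hv, fun u => E.adj_sphere_iff hv, fun m m' => ?_⟩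
  rw [E.tri_sphere_iff hv]
  constructor
  · rintro ⟨p, q, h, e, e'⟩
    rwa [← E.inj v hv e, ← E.inj v hv e']
  · exact fun h => ⟨m, m', h, rfl, rfl⟩

/-- If `u` is an interior vertex then the three triangles on an edge `u v` belong to `B`. -/
lemma mem_vertices_of_chartAdj (hB : IsGood B x n ℓ) (E : ExtData B n ℓ φ) {v u w : V}
    (hv : IsSphere B n ℓ v) (hu : u ∈ vertices B) (hun : ℓ u < n) (h : ChartAdj (φ v) u w) :
    w ∈ vertices B := by
  have hM := hB.hasMKLink u hu (by exact_mod_cast hun)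
  obtain ⟨f, hf, hfw⟩ := hM.cubic (E.adj_old_of_chartAdj hv h hu).symm
  have ht : ∀ i, Tri B v u (f i) := fun i => Tri.left ((hfw (f i)).2 ⟨i, rfl⟩)
  obtain ⟨m, m', hm, rfl, rfl⟩ := h
  have hex : ∀ i, ∃ j, φ v (mkNbr m j) = f i := by
    intro i
    obtain ⟨m₁, e⟩ := E.nbr v hv _ (ht i).right.adj
    have := ht i
    rw [← e, E.tri v hv m m₁ hu (by rw [e]; exact adj_mem_right (ht i).right.adj),
      mk_adj_iff] at this
    obtain ⟨j, rfl⟩ := this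
    exact ⟨j, e⟩
  choose g hg using hex
  have hgi : Function.Injective g := by
    intro i j e
    apply hf
    rw [← hg, ← hg, e]
  obtain ⟨j, rfl⟩ := (mk_adj_iff _ _).1 hm
  obtain ⟨i, rfl⟩ := (Finite.injective_iff_surjective.1 hgi) j
  rw [hg]
  exact adj_mem_right (ht i).right.adj

lemma tri_interior_iff (hB : IsGood B x n ℓ) (E : ExtData B n ℓ φ) {u b c : V}
    (hu : u ∈ vertices B) (hun : ℓ u < n) :
    Tri (extend B (IsSphere B n ℓ) φ) u b c ↔ Tri B u b c := by
  refine ⟨fun h => ?_, tri_extend_of_tri⟩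
  have key : ∀ {b c}, IsSphere B n ℓ b → ChartAdj (φ b) u c → Tri B u b c := by
    intro b c hb h
    exact (E.tri_old_of_chartAdj hb h hu (E.mem_vertices_of_chartAdj hB hb hu hun h)).left
  rcases E.tri_extend_iff.1 h with h | ⟨hv, h⟩ | ⟨hb, h⟩ | ⟨hc, h⟩
  · exact h
  · exact absurd hv.2 hun.ne
  · exact key hb h
  · exact (key hc h).right

lemma adj_interior_iff (hB : IsGood B x n ℓ) (E : ExtData B n ℓ φ) {u b : V}
    (hu : u ∈ vertices B) (hun : ℓ u < n) :
    (skeleton (extend B (IsSphere B n ℓ) φ)).Adj u b ↔ (skeleton B).Adj u b := by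
  rw [E.adj_extend_iff]
  refine ⟨?_, Or.inl⟩
  rintro (h | ⟨c, h⟩)
  · exact h
  · exact ((E.tri_interior_iff hB hu hun).1 h).adj

lemma adj_new (hB : IsGood B x n ℓ) (E : ExtData B n ℓ φ) {v w : V} (hv : v ∈ vertices B)
    (hw : w ∉ vertices B) (h : (skeleton (extend B (IsSphere B n ℓ) φ)).Adj v w) :
    IsSphere B n ℓ v ∧ w ∈ Set.range (φ v) := by
  have hle : ℓ v ≤ n := by exact_mod_cast hB.level_le v hv
  rcases hle.lt_or_eq with hlt | heq
  · exact absurd (adj_mem_right ((E.adj_interior_iff hB hv hlt).1 h)) hw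
  · exact ⟨⟨hv, heq⟩, (E.adj_sphere_iff ⟨hv, heq⟩).1 h⟩

lemma tri_new (E : ExtData B n ℓ φ) {w b c : V} (hw : w ∉ vertices B)
    (h : Tri (extend B (IsSphere B n ℓ) φ) w b c) : IsSphere B n ℓ b ∨ IsSphere B n ℓ c := by
  rcases E.tri_extend_iff.1 h with h | ⟨hv, h⟩ | ⟨hb, h⟩ | ⟨hc, h⟩
  · exact absurd (adj_mem_left h.adj) hw
  · exact absurd hv.1 hw
  · exact Or.inl hb
  · exact Or.inr hc

omit [DecidableEq V] in
lemma extendLevel_old {v : V} (hv : v ∈ vertices B) : extendLevel B n ℓ v = ℓ v := if_pos hv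

omit [DecidableEq V] in
lemma extendLevel_new {v : V} (hv : v ∉ vertices B) : extendLevel B n ℓ v = n + 1 := if_neg hv

omit [DecidableEq V] in
lemma mem_vertices_of_extendLevel {v : V} (h : extendLevel B n ℓ v ≤ n) : v ∈ vertices B := by
  by_contra hv
  rw [extendLevel_new hv] at h
  omega

lemma level_le' (hB : IsGood B x n ℓ) {v : V} (hv : v ∈ vertices B) : ℓ v ≤ n := by
  exact_mod_cast hB.level_le v hv

/-- The extension of a good ball of radius `n` is a good ball of radius `n + 1`. -/
theorem isGood_extend (hB : IsGood B x n ℓ) (E : ExtData B n ℓ φ) :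
    IsGood (extend B (IsSphere B n ℓ) φ) x (n + 1 : ℕ) (extendLevel B n ℓ) := by
  have hsph : ∀ {v}, extendLevel B n ℓ v = n → IsSphere B n ℓ v := fun {v} h => by
    have hv := mem_vertices_of_extendLevel h.le
    exact ⟨hv, by rwa [extendLevel_old hv] at h⟩
  have hlow : ∀ {u v}, v ∈ vertices B → extendLevel B n ℓ u + 1 = extendLevel B n ℓ v →
      u ∈ vertices B := fun {u v} hv h => by
    have := level_le' hB hv
    rw [extendLevel_old hv] at h
    exact mem_vertices_of_extendLevel (n := n) (ℓ := ℓ) (by omega)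
  have hdown : ∀ {u v}, v ∉ vertices B → extendLevel B n ℓ u + 1 = extendLevel B n ℓ v →
      IsSphere B n ℓ u := fun {u v} hv h => hsph (by rw [extendLevel_new hv] at h; omega)
  have hsame : ∀ {u v}, v ∈ vertices B → extendLevel B n ℓ u = extendLevel B n ℓ v →
      u ∈ vertices B := fun {u v} hv h => by
    have := level_le' hB hv
    rw [extendLevel_old hv] at h
    exact mem_vertices_of_extendLevel (n := n) (ℓ := ℓ) (by omega)
  have hlink : ∀ {v}, IsSphere B n ℓ v → HasMKLink (extend B (IsSphere B n ℓ) φ) v :=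
    fun hv => ⟨_, E.isChart hv⟩
  have hmeet : ∀ {w u u'}, w ∉ vertices B → IsSphere B n ℓ u → IsSphere B n ℓ u' → u ≠ u' →
      (skeleton (extend B (IsSphere B n ℓ) φ)).Adj w u →
      (skeleton (extend B (IsSphere B n ℓ) φ)).Adj w u' →
      Tri (extend B (IsSphere B n ℓ) φ) u u' w := fun hw hu hu' ne a a' =>
    (E.tri_sphere_iff hu).2 (E.meet _ _ _ hu hu' ne hw ((E.adj_sphere_iff hu).1 a.symm)
      ((E.adj_sphere_iff hu').1 a'.symm))
  constructor
  case card_le =>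
    rintro s (hs | ⟨-, v, m, m', -, -, hs⟩)
    · exact hB.card_le s hs
    · exact (Finset.card_le_card hs).trans Finset.card_le_three
  case base_mem => exact Or.inl hB.base_mem
  case level_eq_zero =>
    intro v _
    by_cases hv : v ∈ vertices B
    · rw [extendLevel_old hv, hB.level_eq_zero v hv]
    · rw [extendLevel_new hv]
      exact ⟨fun h => by omega, fun h => absurd (h ▸ hB.base_mem) hv⟩
  case level_le =>
    intro v _
    rw [Nat.cast_le]
    by_cases hv : v ∈ vertices B
    · have := level_le' hB hv
      rw [extendLevel_old hv]
      omega
    · rw [extendLevel_new hv]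
  case level_adj =>
    intro u v a
    by_cases hu : u ∈ vertices B <;> by_cases hv : v ∈ vertices B
    · rw [extendLevel_old hu, extendLevel_old hv]
      exact hB.level_adj u v (E.adj_old a hu hv)
    · have := level_le' hB hu
      rw [extendLevel_old hu, extendLevel_new hv]
      omega
    · have := (E.adj_new hB hv hu a.symm).1.2
      rw [extendLevel_old hv, extendLevel_new hu]
      omega
    · rw [extendLevel_new hu, extendLevel_new hv]
      omega
  case finite =>
    intro k
    have hf : (vertices B).Finite := (hB.finite n).subset fun v hv => ⟨hv, level_le' hB hv⟩
    have hS : {v | IsSphere B n ℓ v}.Finite := hf.subset fun v hv => hv.1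
    refine (hf.union (hS.biUnion fun v _ => Set.finite_range (φ v))).subset ?_
    rintro v ⟨hv, -⟩
    rcases mem_vertices_extend_iff.1 hv with h | ⟨u, hu, rfl | h⟩
    · exact Or.inl h
    · exact Or.inl hu.1
    · exact Or.inr (Set.mem_biUnion (show u ∈ {v | IsSphere B n ℓ v} from hu) h)
  case hasMKLink =>
    intro v _ h
    rw [Nat.cast_lt] at h
    have hv : v ∈ vertices B := mem_vertices_of_extendLevel (n := n) (ℓ := ℓ) (by omega)
    rcases (level_le' hB hv).lt_or_eq with hlt | heq
    · exact (hB.hasMKLink v hv (by exact_mod_cast hlt)).transfer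
        (fun u => E.adj_interior_iff hB hv hlt) fun a b => E.tri_interior_iff hB hv hlt
    · exact hlink ⟨hv, heq⟩
  case down_exists =>
    intro v hv hx
    rcases mem_vertices_extend_iff.1 hv with hvB | ⟨u, hu, h⟩
    · obtain ⟨u, a, g⟩ := hB.down_exists v hvB hx
      refine ⟨u, adj_extend_of_adj a, ?_⟩
      rwa [extendLevel_old hvB, extendLevel_old (adj_mem_right a)]
    · by_cases hvB : v ∈ vertices B
      · obtain ⟨u, a, g⟩ := hB.down_exists v hvB hx
        refine ⟨u, adj_extend_of_adj a, ?_⟩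
        rwa [extendLevel_old hvB, extendLevel_old (adj_mem_right a)]
      · have hvu : v ∈ Set.range (φ u) := h.resolve_left (by rintro rfl; exact hvB hu.1)
        refine ⟨u, ((E.adj_sphere_iff hu).2 hvu).symm, ?_⟩
        rw [extendLevel_old hu.1, extendLevel_new hvB, hu.2]
  case down_tri =>
    intro v u u' a a' g g' ne
    by_cases hv : v ∈ vertices B
    · have hu := hlow hv g
      have hu' := hlow hv g'
      rw [extendLevel_old hv, extendLevel_old hu] at g
      rw [extendLevel_old hv, extendLevel_old hu'] at g'
      exact tri_extend_of_tri (hB.down_tri v u u' (E.adj_old a hv hu) (E.adj_old a' hv hu') g g' ne)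
    · exact (hmeet hv (hdown hv g) (hdown hv g') ne a a').rot.rot
  case down_two =>
    intro v u u' u'' a a' a'' g g' g''
    by_cases hv : v ∈ vertices B
    · have hu := hlow hv g
      have hu' := hlow hv g'
      have hu'' := hlow hv g''
      rw [extendLevel_old hv, extendLevel_old hu] at g
      rw [extendLevel_old hv, extendLevel_old hu'] at g'
      rw [extendLevel_old hv, extendLevel_old hu''] at g''
      exact hB.down_two v u u' u'' (E.adj_old a hv hu) (E.adj_old a' hv hu')
        (E.adj_old a'' hv hu'') g g' g''
    · by_contra! hne
      obtain ⟨ne1, ne2, ne3⟩ := hne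
      have hu := hdown hv g
      have hu' := hdown hv g'
      have hu'' := hdown hv g''
      have t1 := hmeet hv hu hu' ne1 a a'
      have t2 := hmeet hv hu hu'' ne2 a a''
      obtain ⟨d, td, gd⟩ := hB.same_exists u u' (E.adj_old t1.adj hu.1 hu'.1) (hu.2.trans hu'.2.symm)
      obtain ⟨d', td', gd'⟩ := hB.same_exists u u'' (E.adj_old t2.adj hu.1 hu''.1)
        (hu.2.trans hu''.2.symm)
      by_cases hd : d = d'
      · subst hd
        -- `u'`, `v`, `u''`, `d` is a closed path of length four in the link of `u`
        rcases (hlink hu).quad t1 t2.right (tri_extend_of_tri td') (tri_extend_of_tri td.right)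
          with h | h
        · exact ne3 h
        · exact hv (h ▸ adj_mem_right td.adj')
      · have td2 := hB.down_tri u d d' td.right.adj td'.right.adj gd gd' hd
        exact (hlink hu).pent t1 t2.right (tri_extend_of_tri td') (tri_extend_of_tri td2.right)
          (tri_extend_of_tri td.right)
  case same_exists =>
    intro v w a g
    by_cases hv : v ∈ vertices B
    · have hw := hsame hv g.symm
      rw [extendLevel_old hv, extendLevel_old hw] at g
      obtain ⟨u, t, gu⟩ := hB.same_exists v w (E.adj_old a hv hw) g
      refine ⟨u, tri_extend_of_tri t, ?_⟩
      rwa [extendLevel_old hv, extendLevel_old (adj_mem_right t.adj')]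
    · have hw : w ∉ vertices B := fun hw => hv (hsame hw g)
      rcases E.adj_extend_iff.1 a with h | ⟨c, h⟩
      · exact absurd (adj_mem_left h) hv
      · have hc := (E.tri_new hv h).resolve_left fun h => hw h.1
        refine ⟨c, h, ?_⟩
        rw [extendLevel_old hc.1, extendLevel_new hv, hc.2]
  case same_unique =>
    intro v w u u' t t' g gu gu'
    by_cases hv : v ∈ vertices B
    · have hw := hsame hv g.symm
      have hu := hlow hv gu
      have hu' := hlow hv gu'
      rw [extendLevel_old hv, extendLevel_old hw] at g
      rw [extendLevel_old hv, extendLevel_old hu] at gu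
      rw [extendLevel_old hv, extendLevel_old hu'] at gu'
      exact hB.same_unique v w u u' (E.tri_old t hv hw hu) (E.tri_old t' hv hw hu') g gu gu'
    · by_contra hne
      have hw : w ∉ vertices B := fun hw => hv (hsame hw g)
      have hu := hdown hv gu
      have hu' := hdown hv gu'
      have t1 := hmeet hv hu hu' hne t.right.adj t'.right.adj
      have t2 := hmeet hw hu hu' hne t.adj' t'.adj'
      -- `u'`, `v`, `w` would be a triangle in the link of `u`
      exact (hlink hu).no_triangle t1 t.rot.rot t2.right
  case no_flat =>
    intro u v w t g g'
    by_cases hu : u ∈ vertices B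
    · have hv := hsame hu g.symm
      have hw := hsame hv g'.symm
      rw [extendLevel_old hu, extendLevel_old hv] at g
      rw [extendLevel_old hv, extendLevel_old hw] at g'
      exact hB.no_flat u v w (E.tri_old t hu hv hw) g g'
    · rcases E.tri_new hu t with h | h
      · exact hu (hsame h.1 g)
      · exact hu (hsame h.1 (g.trans g'))

/-- The extension does not change the ball of radius `n`. -/
theorem ball_extend (hB : IsGood B x n ℓ) (E : ExtData B n ℓ φ) :
    ball (extend B (IsSphere B n ℓ) φ) x n = B := by
  have hG := E.isGood_extend hB
  refine SetLike.ext fun s => ?_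
  rw [hG.mem_ball_iff]
  constructor
  · rintro ⟨hs, hl⟩
    have hv : ∀ v ∈ s, v ∈ vertices B := fun v h => mem_vertices_of_extendLevel (hl v h)
    exact mem_of_card_le hs (hG.card_le s hs) hv
      (fun a ha b hb h => E.adj_old h (hv a ha) (hv b hb))
      fun a ha b hb c hc h => E.tri_old h (hv a ha) (hv b hb) (hv c hc)
  · intro hs
    refine ⟨Or.inl hs, fun v hv => ?_⟩
    have := mem_vertices_of_mem hs hv
    rw [extendLevel_old this]
    exact level_le' hB this

end ExtData
end Extend

/-! ### Extensions from labelled links -/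

section Label

variable {V : Type*} [DecidableEq V] {B : PreAbstractSimplicialComplex V}

/-- `m` is not in the image under `ι v` of the link of `v` in `B`. -/
def IsNew (B : PreAbstractSimplicialComplex V) (ι : V → V → ZMod 8 ⊕ ZMod 8) (v : V)
    (m : ZMod 8 ⊕ ZMod 8) : Prop :=
  ∀ u, (skeleton B).Adj v u → ι v u ≠ m

/-- For every vertex `v` of level `n`, the map `ι v` embeds the link of `v` in the Moebius-Kantor
graph. -/
structure LinkEmbedding (B : PreAbstractSimplicialComplex V) (n : ℕ) (ℓ : V → ℕ)
    (ι : V → V → ZMod 8 ⊕ ZMod 8) : Prop where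
  inj : ∀ v, IsSphere B n ℓ v → ∀ u u', (skeleton B).Adj v u → (skeleton B).Adj v u' →
    ι v u = ι v u' → u = u'
  tri : ∀ v, IsSphere B n ℓ v → ∀ u u', (skeleton B).Adj v u → (skeleton B).Adj v u' →
    (Tri B v u u' ↔ moebiusKantor.Adj (ι v u) (ι v u'))

/-- Embeddings `ι v` of the links in the Moebius-Kantor graph, and a labelling `lab v` of the
vertices of the latter. The vertices outside the image of `ι v` stand for new vertices; if `v` and
`v'` are adjacent, then the labels tell which new vertices on the edge `v v'` as seen from `v` and
as seen from `v'` are to be identified. -/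
structure LabelData (B : PreAbstractSimplicialComplex V) (n : ℕ) (ℓ : V → ℕ) {K : Type*}
    (ι : V → V → ZMod 8 ⊕ ZMod 8) (lab : V → ZMod 8 ⊕ ZMod 8 → K) : Prop
    extends LinkEmbedding B n ℓ ι where
  lab_inj : ∀ v, IsSphere B n ℓ v → ∀ m m', IsNew B ι v m → IsNew B ι v m' →
    lab v m = lab v m' →
    (∀ v', IsSphere B n ℓ v' → (skeleton B).Adj v v' →
      (moebiusKantor.Adj (ι v v') m ↔ moebiusKantor.Adj (ι v v') m')) → m = m'
  compat : ∀ v v' m, IsSphere B n ℓ v → IsSphere B n ℓ v' → (skeleton B).Adj v v' →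
    IsNew B ι v m → moebiusKantor.Adj (ι v v') m →
    ∃ m', IsNew B ι v' m' ∧ moebiusKantor.Adj (ι v' v) m' ∧ lab v' m' = lab v m

/-- The vertices of level `n` joined to the new vertex which `m` stands for in the link of `v`. -/
def downSet (B : PreAbstractSimplicialComplex V) (n : ℕ) (ℓ : V → ℕ)
    (ι : V → V → ZMod 8 ⊕ ZMod 8) (v : V) (m : ZMod 8 ⊕ ZMod 8) : Set V :=
  {u | u = v ∨ (IsSphere B n ℓ u ∧ (skeleton B).Adj v u ∧ moebiusKantor.Adj (ι v u) m)}

lemma exists_fresh {α V : Type*} [Infinite V] {F : Set α} (hF : F.Finite) {A : Set V}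
    (hA : A.Finite) : ∃ g : α → V, Set.InjOn g F ∧ ∀ a ∈ F, g a ∉ A := by
  have hinf : (Aᶜ).encard = ⊤ := hA.infinite_compl.encard_eq
  obtain ⟨g, h1, h2⟩ := hF.exists_injOn_of_encard_le (t := Aᶜ) (by rw [hinf]; exact le_top)
  exact ⟨g, h2, fun a ha => h1 ha⟩

namespace LinkEmbedding

variable {x : V} {n : ℕ} {ℓ : V → ℕ} {ι : V → V → ZMod 8 ⊕ ZMod 8}

/-- A new vertex in the link of `v` is adjacent there to at most one vertex of level `n`. -/
lemma downSet_unique (hB : IsGood B x n ℓ) (D : LinkEmbedding B n ℓ ι) {v u u' : V}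
    {m : ZMod 8 ⊕ ZMod 8} (hv : IsSphere B n ℓ v) (hu : IsSphere B n ℓ u)
    (hu' : IsSphere B n ℓ u') (hm : IsNew B ι v m) (a : (skeleton B).Adj v u)
    (a' : (skeleton B).Adj v u') (h : moebiusKantor.Adj (ι v u) m)
    (h' : moebiusKantor.Adj (ι v u') m) : u = u' := by
  by_contra hne
  obtain ⟨d, t, g⟩ := hB.same_exists v u a (hv.2.trans hu.2.symm)
  obtain ⟨d', t', g'⟩ := hB.same_exists v u' a' (hv.2.trans hu'.2.symm)
  have e := (D.tri v hv u d a t.right.adj).1 t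
  have e' := (D.tri v hv u' d' a' t'.right.adj).1 t'
  by_cases hd : d = d'
  · subst hd
    rcases mk_quad h h'.symm e' e.symm with q | q
    · exact hne (D.inj v hv _ _ a a' q)
    · exact hm d t.right.adj q.symm
  · have t2 := hB.down_tri v d d' t.right.adj t'.right.adj g g' hd
    exact mk_pent h h'.symm e' ((D.tri v hv d d' t.right.adj t'.right.adj).1 t2).symm e.symm

end LinkEmbedding

namespace LabelData

variable {x : V} {n : ℕ} {ℓ : V → ℕ} {K : Type*} {ι : V → V → ZMod 8 ⊕ ZMod 8}
  {lab : V → ZMod 8 ⊕ ZMod 8 → K}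

lemma downSet_eq (hB : IsGood B x n ℓ) (D : LabelData B n ℓ ι lab) {v u : V}
    {m : ZMod 8 ⊕ ZMod 8} (hv : IsSphere B n ℓ v) (hu : IsSphere B n ℓ u)
    (hm : IsNew B ι v m) (a : (skeleton B).Adj v u)
    (h : moebiusKantor.Adj (ι v u) m) : downSet B n ℓ ι v m = {v, u} := by
  ext w
  constructor
  · rintro (rfl | ⟨hw, aw, h'⟩)
    · exact Or.inl rfl
    · exact Or.inr (D.downSet_unique hB hv hw hu hm aw a h' h)
  · rintro (rfl | rfl)
    · exact Or.inl rfl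
    · exact Or.inr ⟨hu, a, h⟩

/-- Labelled links determine extension data; here `μ` recovers the labels of the new vertices. -/
theorem exists_extData [Infinite V] (hB : IsGood B x n ℓ) (D : LabelData B n ℓ ι lab) :
    ∃ (φ : V → ZMod 8 ⊕ ZMod 8 → V) (μ : V → K), ExtData B n ℓ φ ∧
      (∀ v, IsSphere B n ℓ v → ∀ u, (skeleton B).Adj v u → φ v (ι v u) = u) ∧
      ∀ v, IsSphere B n ℓ v → ∀ m, IsNew B ι v m →
        φ v m ∉ vertices B ∧ μ (φ v m) = lab v m := by
  classical
  have hf : (vertices B).Finite :=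
    (hB.finite n).subset fun v hv => ⟨hv, ExtData.level_le' hB hv⟩
  have hS : {v | IsSphere B n ℓ v}.Finite := hf.subset fun v hv => hv.1
  -- a new vertex is named after the vertices of level `n` below it and its label
  set key : V × (ZMod 8 ⊕ ZMod 8) → Set V × K := fun p => (downSet B n ℓ ι p.1 p.2, lab p.1 p.2)
    with hkey
  set F : Set (Set V × K) := key '' ({v | IsSphere B n ℓ v} ×ˢ Set.univ) with hF
  have hFf : F.Finite := (hS.prod Set.finite_univ).image key
  have hkF : ∀ v, IsSphere B n ℓ v → ∀ m, key (v, m) ∈ F := fun v hv m =>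
    ⟨(v, m), ⟨hv, trivial⟩, rfl⟩
  obtain ⟨name, hinj, hname⟩ := exists_fresh hFf hf
  set φ : V → ZMod 8 ⊕ ZMod 8 → V := fun v m =>
    if h : ∃ u, (skeleton B).Adj v u ∧ ι v u = m then h.choose else name (key (v, m)) with hφ
  have hold : ∀ v, IsSphere B n ℓ v → ∀ u, (skeleton B).Adj v u → φ v (ι v u) = u := by
    intro v hv u a
    have h : ∃ w, (skeleton B).Adj v w ∧ ι v w = ι v u := ⟨u, a, rfl⟩
    simp only [hφ, dif_pos h]
    exact D.inj v hv _ _ h.choose_spec.1 a h.choose_spec.2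
  have hnew : ∀ v m, IsNew B ι v m → φ v m = name (key (v, m)) := by
    intro v m hm
    have h : ¬ ∃ w, (skeleton B).Adj v w ∧ ι v w = m := fun ⟨w, a, e⟩ => hm w a e
    simp only [hφ, dif_neg h]
  have hnewB : ∀ v, IsSphere B n ℓ v → ∀ m, IsNew B ι v m → φ v m ∉ vertices B := by
    intro v hv m hm
    rw [hnew v m hm]
    exact hname _ (hkF v hv m)
  have hcases : ∀ v m, IsNew B ι v m ∨ ∃ u, (skeleton B).Adj v u ∧ ι v u = m := by
    intro v m
    by_cases h : ∃ u, (skeleton B).Adj v u ∧ ι v u = m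
    · exact Or.inr h
    · exact Or.inl fun u a e => h ⟨u, a, e⟩
  have holdB : ∀ v, IsSphere B n ℓ v → ∀ m, φ v m ∈ vertices B →
      ∃ u, (skeleton B).Adj v u ∧ ι v u = m ∧ φ v m = u := by
    intro v hv m h
    rcases hcases v m with h' | ⟨u, a, rfl⟩
    · exact absurd h (hnewB v hv m h')
    · exact ⟨u, a, rfl, hold v hv u a⟩
  have hnew' : ∀ v, IsSphere B n ℓ v → ∀ m, φ v m ∉ vertices B → IsNew B ι v m := by
    intro v hv m h
    rcases hcases v m with h' | ⟨u, a, rfl⟩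
    · exact h'
    · rw [hold v hv u a] at h
      exact absurd (adj_mem_right a) h
  have hkeq : ∀ v v', IsSphere B n ℓ v → IsSphere B n ℓ v' → ∀ m m', IsNew B ι v m →
      IsNew B ι v' m' → φ v m = φ v' m' → key (v, m) = key (v', m') := by
    intro v v' hv hv' m m' hm hm' e
    rw [hnew v m hm, hnew v' m' hm'] at e
    exact hinj (hkF v hv m) (hkF v' hv' m') e
  refine ⟨φ, fun w => if h : ∃ k ∈ F, name k = w then h.choose.2 else lab x (Sum.inl 0),
    ⟨?_, ?_, ?_, ?_, ?_, ?_⟩, hold, fun v hv m hm => ⟨hnewB v hv m hm, ?_⟩⟩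
  · intro v hv m m' e
    rcases hcases v m with hm | ⟨u, a, rfl⟩ <;> rcases hcases v m' with hm' | ⟨u', a', rfl⟩
    · have hk := hkeq v v hv hv m m' hm hm' e
      refine D.lab_inj v hv m m' hm hm' (congrArg Prod.snd hk) fun v' hv' a => ?_
      have h1 : downSet B n ℓ ι v m = downSet B n ℓ ι v m' := congrArg Prod.fst hk
      have h2 := Set.ext_iff.1 h1 v'
      constructor
      · exact fun h => ((h2.1 (Or.inr ⟨hv', a, h⟩)).resolve_left a.ne').2.2
      · exact fun h => ((h2.2 (Or.inr ⟨hv', a, h⟩)).resolve_left a.ne').2.2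
    · rw [hold v hv u' a'] at e
      exact absurd (e ▸ adj_mem_right a') (hnewB v hv m hm)
    · rw [hold v hv u a] at e
      exact absurd (e ▸ adj_mem_right a) (hnewB v hv m' hm')
    · rw [hold v hv u a, hold v hv u' a'] at e
      rw [e]
  · exact fun v hv u a => ⟨ι v u, hold v hv u a⟩
  · intro v hv m h
    obtain ⟨u, a, rfl, e⟩ := holdB v hv m h
    rwa [e]
  · intro v hv m m' h h'
    obtain ⟨u, a, rfl, e⟩ := holdB v hv m h
    obtain ⟨u', a', rfl, e'⟩ := holdB v hv m' h'
    rw [e, e']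
    exact D.tri v hv u u' a a'
  · rintro v v' w hv hv' hw ⟨m, m', hm, e, rfl⟩
    obtain ⟨u, a, rfl, e'⟩ := holdB v hv m (by rw [e]; exact hv'.1)
    obtain rfl : v' = u := e.symm.trans e'
    have hm' := hnew' v hv m' hw
    obtain ⟨m'', h1, h2, h3⟩ := D.compat v v' m' hv hv' a hm' hm
    refine ⟨ι v' v, m'', h2, hold v' hv' v a.symm, ?_⟩
    rw [hnew v m' hm', hnew v' m'' h1]
    simp only [hkey, D.downSet_eq hB hv hv' hm' a hm, D.downSet_eq hB hv' hv h1 a.symm h2, h3,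
      Set.pair_comm v v']
  · rintro v v' w hv hv' hne hw ⟨m, rfl⟩ ⟨m', e⟩
    have hm := hnew' v hv m hw
    have hm' := hnew' v' hv' m' (by rw [e]; exact hw)
    have h1 : downSet B n ℓ ι v' m' = downSet B n ℓ ι v m :=
      congrArg Prod.fst (hkeq v' v hv' hv m' m hm' hm e)
    have h2 : v' ∈ downSet B n ℓ ι v m := h1 ▸ Or.inl rfl
    obtain ⟨-, a, h3⟩ := h2.resolve_left hne.symm
    exact ⟨ι v v', m, h3, hold v hv v' a, rfl⟩
  · have h : ∃ k ∈ F, name k = φ v m := ⟨key (v, m), hkF v hv m, (hnew v m hm).symm⟩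
    simp only [dif_pos h]
    have := hinj h.choose_spec.1 (hkF v hv m) (h.choose_spec.2.trans (hnew v m hm))
    rw [this]

end LabelData
end Label

/-! ### Increasing unions of good balls -/

section Limit

variable {V : Type*} [DecidableEq V]

namespace IsGood

variable {X : PreAbstractSimplicialComplex V} {x : V} {n : ℕ∞} {ℓ : V → ℕ}

lemma dist_isGood (h : IsGood X x n ℓ) : IsGood X x n ((skeleton X).dist x) :=
  h.congr_level fun _ hv => h.dist_eq hv

lemma level_unique {ℓ' : V → ℕ} {n' : ℕ∞} (h : IsGood X x n ℓ) (h' : IsGood X x n' ℓ') {v : V}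
    (hv : v ∈ vertices X) : ℓ v = ℓ' v := by
  rw [← h.dist_eq hv, ← h'.dist_eq hv]

lemma ball_ball (h : IsGood X x n ℓ) {a b : ℕ} (ha : (a : ℕ∞) ≤ n) (hab : b ≤ a) :
    ball (ball X x a) x b = ball X x b := by
  refine SetLike.ext fun s => ?_
  rw [(h.ball_isGood ha).mem_ball_iff, h.mem_ball_iff, h.mem_ball_iff]
  constructor
  · rintro ⟨⟨h1, -⟩, h2⟩
    exact ⟨h1, h2⟩
  · rintro ⟨h1, h2⟩
    exact ⟨⟨h1, fun v hv => (h2 v hv).trans hab⟩, h2⟩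

end IsGood

/-- The union of a sequence of complexes. -/
def union (B : ℕ → PreAbstractSimplicialComplex V) : PreAbstractSimplicialComplex V where
  faces := {s | ∃ k, s ∈ B k}
  isRelLowerSet_faces := by
    rintro s ⟨k, hs⟩
    exact ⟨nonempty_of_mem hs, fun t hts ht => ⟨k, mem_of_subset hs hts ht⟩⟩

/-- A sequence of good balls of radius `m`, `m + 1`, ..., each of which is the ball of the
corresponding radius in the next one, is the sequence of balls of a good complex. -/
theorem exists_limit {B : ℕ → PreAbstractSimplicialComplex V} {x : V} {m : ℕ}
    (hG : ∀ k, ∃ ℓ, IsGood (B k) x (m + k : ℕ) ℓ) (hb : ∀ k, ball (B (k + 1)) x (m + k) = B k) :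
    ∃ ℓ, IsGood (union B) x ⊤ ℓ ∧ ∀ k, ball (union B) x (m + k) = B k := by
  classical
  set L : ℕ → V → ℕ := fun k => (skeleton (B k)).dist x with hL
  replace hG : ∀ k, IsGood (B k) x (m + k : ℕ) (L k) := fun k => (hG k).choose_spec.dist_isGood
  have hball : ∀ j k, ball (B (j + k)) x (m + j) = B j := by
    intro j k
    induction k with
    | zero =>
      refine SetLike.ext fun s => (hG j).mem_ball_iff.trans ⟨fun h => h.1, fun h => ⟨h, ?_⟩⟩
      exact fun v hv => by exact_mod_cast (hG j).level_le v (mem_vertices_of_mem h hv)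
    | succ k ih =>
      have h := (hG (j + (k + 1))).ball_ball (a := m + (j + k)) (b := m + j)
        (by exact_mod_cast (by omega : m + (j + k) ≤ m + (j + (k + 1)))) (by omega)
      rw [← h]
      have h2 := hb (j + k)
      rw [← add_assoc j k 1, h2, ih]
  have hball' : ∀ {j k}, j ≤ k → ball (B k) x (m + j) = B j := fun {j k} h => by
    obtain ⟨i, rfl⟩ := Nat.exists_eq_add_of_le h
    exact hball j i
  have hmono : ∀ {j k}, j ≤ k → ∀ {s}, s ∈ B j → s ∈ B k := fun h s hs => by
    rw [← hball' h] at hs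
    exact hs.1
  have hlev : ∀ {j k}, j ≤ k → ∀ {v}, v ∈ vertices (B j) → L k v = L j v := by
    intro j k h v hv
    have h1 := (hG k).ball_isGood (k := m + j)
      (by exact_mod_cast (by omega : m + j ≤ m + k))
    rw [hball' h] at h1
    exact h1.level_unique (hG j) hv
  set ℓ : V → ℕ := fun v => if h : ∃ k, v ∈ vertices (B k) then L (Nat.find h) v else 0 with hℓ
  have hℓL : ∀ {k v}, v ∈ vertices (B k) → ℓ v = L k v := by
    intro k v hv
    have h : ∃ k, v ∈ vertices (B k) := ⟨k, hv⟩
    simp only [hℓ, dif_pos h]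
    exact (hlev (Nat.find_le hv) (Nat.find_spec h)).symm
  have hGℓ : ∀ k, IsGood (B k) x (m + k : ℕ) ℓ := fun k => (hG k).congr_level fun v hv => hℓL hv
  have hle : ∀ k v, v ∈ vertices (B k) → ℓ v ≤ m + k := fun k v hv => by
    exact_mod_cast (hGℓ k).level_le v hv
  have hfull : ∀ k s, s ∈ union B → (∀ v ∈ s, ℓ v ≤ m + k) → s ∈ B k := by
    rintro k s ⟨j, hj⟩ hs
    rcases le_total j k with h | h
    · exact hmono h hj
    · rw [← hball' h]
      exact (hGℓ j).mem_ball_iff.2 ⟨hj, hs⟩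
  have hadj : ∀ {a b}, (skeleton (union B)).Adj a b → ∀ {k}, ℓ a ≤ m + k → ℓ b ≤ m + k →
      (skeleton (B k)).Adj a b := fun h k ha hb =>
    ⟨h.1, hfull k _ h.2 (by simp [ha, hb])⟩
  have htri : ∀ {a b c}, Tri (union B) a b c → ∀ {k}, ℓ a ≤ m + k → ℓ b ≤ m + k → ℓ c ≤ m + k →
      Tri (B k) a b c := fun h k ha hb hc =>
    tri_iff.2 ⟨hfull k _ h.mem (by simp [ha, hb, hc]), (tri_iff.1 h).2⟩
  have hadj' : ∀ {k a b}, (skeleton (B k)).Adj a b → (skeleton (union B)).Adj a b :=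
    fun h => ⟨h.1, _, h.2⟩
  have htri' : ∀ {k a b c}, Tri (B k) a b c → Tri (union B) a b c :=
    fun h => tri_iff.2 ⟨⟨_, h.mem⟩, (tri_iff.1 h).2⟩
  have hvert : ∀ {v}, v ∈ vertices (union B) → ∀ {k}, ℓ v ≤ m + k → v ∈ vertices (B k) :=
    fun h k hk => hfull k _ h (by simp [hk])
  have hladj : ∀ u v, (skeleton (union B)).Adj u v → ℓ u ≤ ℓ v + 1 := fun u v a =>
    (hGℓ (ℓ u + ℓ v)).level_adj u v (hadj a (by omega) (by omega))
  have good : IsGood (union B) x ⊤ ℓ := by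
    constructor
    case card_le =>
      rintro s ⟨k, hs⟩
      exact (hG k).card_le s hs
    case base_mem => exact ⟨0, (hG 0).base_mem⟩
    case level_eq_zero =>
      exact fun v hv => (hGℓ (ℓ v)).level_eq_zero v (hvert hv (by omega))
    case level_le => exact fun v _ => le_top
    case level_adj => exact hladj
    case finite =>
      exact fun k => ((hGℓ k).finite k).subset fun v hv =>
        ⟨hvert hv.1 (hv.2.trans (by omega)), hv.2⟩
    case hasMKLink =>
      intro v hv _
      have h := (hGℓ (ℓ v + 1)).hasMKLink v (hvert hv (by omega))
        (by exact_mod_cast (by omega : ℓ v < m + (ℓ v + 1)))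
      refine h.transfer (fun u => ⟨fun a => hadj a (by omega) ?_, hadj'⟩) fun a b =>
        ⟨fun t => htri t (by omega) ?_ ?_, htri'⟩
      · have := hladj _ _ a.symm
        omega
      · have := hladj _ _ t.adj.symm
        omega
      · have := hladj _ _ t.right.adj.symm
        omega
    case down_exists =>
      intro v hv hx
      obtain ⟨u, a, g⟩ := (hGℓ (ℓ v)).down_exists v (hvert hv (by omega)) hx
      exact ⟨u, hadj' a, g⟩
    case down_tri =>
      intro v u u' a a' g g' ne
      exact htri' ((hGℓ (ℓ v)).down_tri v u u' (hadj a (by omega) (by omega))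
        (hadj a' (by omega) (by omega)) g g' ne)
    case down_two =>
      intro v u u' u'' a a' a'' g g' g''
      exact (hGℓ (ℓ v)).down_two v u u' u'' (hadj a (by omega) (by omega))
        (hadj a' (by omega) (by omega)) (hadj a'' (by omega) (by omega)) g g' g''
    case same_exists =>
      intro v w a g
      obtain ⟨u, t, gu⟩ := (hGℓ (ℓ v)).same_exists v w (hadj a (by omega) (by omega)) g
      exact ⟨u, htri' t, gu⟩
    case same_unique =>
      intro v w u u' t t' g gu gu'
      exact (hGℓ (ℓ v)).same_unique v w u u' (htri t (by omega) (by omega) (by omega))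
        (htri t' (by omega) (by omega) (by omega)) g gu gu'
    case no_flat =>
      intro u v w t g g'
      exact (hGℓ (ℓ u)).no_flat u v w (htri t (by omega) (by omega) (by omega)) g g'
  refine ⟨ℓ, good, fun k => SetLike.ext fun s => good.mem_ball_iff.trans ⟨?_, ?_⟩⟩
  · exact fun h => hfull k s h.1 h.2
  · exact fun h => ⟨⟨k, h⟩, fun v hv => hle k v (mem_vertices_of_mem h hv)⟩

end Limit

/-! ### Developing a complex of rank `7/4` -/

section Covering

variable {V : Type*} [DecidableEq V] {X B : PreAbstractSimplicialComplex V}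

/-- `π` restricts to a simplicial map from `B` to `X` fixing `x` which is an isomorphism from the
star of every vertex onto a full subcomplex of the star of its image. -/
structure IsDeveloping (X B : PreAbstractSimplicialComplex V) (x : V) (π : V → V) : Prop where
  base : π x = x
  vert : ∀ v ∈ vertices B, π v ∈ vertices X
  adj : ∀ u v, (skeleton B).Adj u v → (skeleton X).Adj (π u) (π v)
  inj : ∀ v u u', (skeleton B).Adj v u → (skeleton B).Adj v u' → π u = π u' → u = u'
  tri : ∀ v u u', (skeleton B).Adj v u → (skeleton B).Adj v u' →
    (Tri B v u u' ↔ Tri X (π v) (π u) (π u'))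

/-- A good ball which is developed in `X` can be extended by one layer. -/
lemma IsDeveloping.exists_extend [Infinite V] (hX : ∀ v ∈ vertices X, HasMKLink X v) {x : V} {n : ℕ}
    {ℓ : V → ℕ} (hB : IsGood B x n ℓ) {π : V → V} (hπ : IsDeveloping X B x π) :
    ∃ (B' : PreAbstractSimplicialComplex V) (π' : V → V) (ℓ' : V → ℕ),
      IsGood B' x (n + 1 : ℕ) ℓ' ∧ ball B' x n = B ∧ IsDeveloping X B' x π' ∧
      ∀ v ∈ vertices B, π' v = π v := by
  classical
  have hch : ∀ v, ∃ ψ, π v ∈ vertices X → IsChart X (π v) ψ := by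
    intro v
    by_cases hv : π v ∈ vertices X
    · obtain ⟨ψ, h⟩ := hX _ hv
      exact ⟨ψ, fun _ => h⟩
    · exact ⟨fun _ => v, fun h => absurd h hv⟩
  choose ψ hψ using hch
  replace hψ : ∀ v ∈ vertices B, IsChart X (π v) (ψ v) := fun v hv => hψ v (hπ.vert v hv)
  set ι : V → V → ZMod 8 ⊕ ZMod 8 := fun v u => Function.invFun (ψ v) (π u) with hι
  have hψι : ∀ {v u}, (skeleton B).Adj v u → ψ v (ι v u) = π u := fun {v u} a =>
    Function.invFun_eq (((hψ v (adj_mem_left a)).adj_iff (π u)).1 (hπ.adj v u a))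
  have htriι : ∀ {v u u'}, (skeleton B).Adj v u → (skeleton B).Adj v u' →
      (Tri B v u u' ↔ moebiusKantor.Adj (ι v u) (ι v u')) := fun {v u u'} a a' => by
    rw [hπ.tri v u u' a a', ← (hψ v (adj_mem_left a)).tri_iff, hψι a, hψι a']
  have D : LabelData B n ℓ ι ψ := by
    refine ⟨⟨fun v hv u u' a a' e => ?_, fun v hv u u' a a' => htriι a a'⟩,
      fun v hv m m' _ _ e _ => (hψ v hv.1).inj e, fun v v' m hv hv' a hm hadj => ?_⟩
    · apply hπ.inj v u u' a a'
      rw [← hψι a, ← hψι a', e]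
    · have t : Tri X (π v) (π v') (ψ v m) := by
        rw [← hψι a]
        exact ((hψ v hv.1).tri_iff _ _).2 hadj
      obtain ⟨m', hm'⟩ := ((hψ v' hv'.1).adj_iff _).1 t.adj'
      refine ⟨m', ?_, ?_, hm'⟩
      · rintro u au rfl
        rw [hψι au] at hm'
        rw [← hm'] at t
        have t' := ((hπ.tri v' v u a.symm au).2 t.left).left
        refine hm u t'.right.adj ((hψ v hv.1).inj ?_)
        rw [hψι t'.right.adj, hm']
      · rw [← (hψ v' hv'.1).tri_iff, hψι a.symm, hm']
        exact t.left
  obtain ⟨φ, μ, E, hφ, hμ⟩ := D.exists_extData hB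
  set π' : V → V := fun w => if w ∈ vertices B then π w else μ w with hπ'
  have hold : ∀ {v}, v ∈ vertices B → π' v = π v := fun h => if_pos h
  have hnew : ∀ {v}, IsSphere B n ℓ v → ∀ m, π' (φ v m) = ψ v m := by
    intro v hv m
    by_cases h : IsNew B ι v m
    · obtain ⟨h1, h2⟩ := hμ v hv m h
      simp only [hπ', if_neg h1, h2]
    · unfold IsNew at h
      push Not at h
      obtain ⟨u, a, rfl⟩ := h
      rw [hφ v hv u a, hold (adj_mem_right a), hψι a]
  set B' := extend B (IsSphere B n ℓ) φ with hB'
  have hG := E.isGood_extend hB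
  have htS : ∀ {v a b}, IsSphere B n ℓ v → Tri B' v a b → Tri X (π' v) (π' a) (π' b) := by
    intro v a b hv t
    obtain ⟨m, m', hm, rfl, rfl⟩ := (E.tri_sphere_iff hv).1 t
    rw [hnew hv, hnew hv, hold hv.1]
    exact ((hψ v hv.1).tri_iff _ _).2 hm
  have ht : ∀ {a b c}, Tri B' a b c → Tri X (π' a) (π' b) (π' c) := by
    intro a b c t
    rcases E.tri_extend_iff.1 t with h | ⟨hv, -⟩ | ⟨hv, -⟩ | ⟨hv, -⟩
    · rw [hold (adj_mem_left h.adj), hold (adj_mem_right h.adj), hold (adj_mem_right h.adj')]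
      exact (hπ.tri a b c h.adj h.right.adj).1 h
    · exact htS hv t
    · exact (htS hv t.left).left
    · exact (htS hv t.rot.rot).rot
  have ha : ∀ {a b}, (skeleton B').Adj a b → (skeleton X).Adj (π' a) (π' b) := by
    intro a b h
    rcases E.adj_extend_iff.1 h with h | ⟨c, t⟩
    · rw [hold (adj_mem_left h), hold (adj_mem_right h)]
      exact hπ.adj a b h
    · exact (ht t).adj
  have hinjS : ∀ {s u u'}, IsSphere B n ℓ s → (skeleton B').Adj s u → (skeleton B').Adj s u' →
      π' u = π' u' → u = u' := by
    intro s u u' hs a a' e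
    obtain ⟨m, rfl⟩ := (E.adj_sphere_iff hs).1 a
    obtain ⟨m', rfl⟩ := (E.adj_sphere_iff hs).1 a'
    rw [hnew hs, hnew hs] at e
    rw [(hψ s hs.1).inj e]
  have hinjI : ∀ {s u u'}, s ∈ vertices B → (skeleton B').Adj s u → (skeleton B').Adj s u' →
      π' u = π' u' → u = u' := by
    intro s u u' hs a a' e
    rcases (ExtData.level_le' hB hs).lt_or_eq with hlt | heq
    · rw [hB', E.adj_interior_iff hB hs hlt] at a a'
      rw [hold (adj_mem_right a), hold (adj_mem_right a')] at e
      exact hπ.inj s u u' a a' e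
    · exact hinjS ⟨hs, heq⟩ a a' e
  have hmeet : ∀ {w u u'}, w ∉ vertices B → IsSphere B n ℓ u → IsSphere B n ℓ u' → u ≠ u' →
      (skeleton B').Adj w u → (skeleton B').Adj w u' → Tri B' u u' w := fun hw hu hu' ne a a' =>
    (E.tri_sphere_iff hu).2 (E.meet _ _ _ hu hu' ne hw ((E.adj_sphere_iff hu).1 a.symm)
      ((E.adj_sphere_iff hu').1 a'.symm))
  have hnbr : ∀ {w u}, w ∉ vertices B → (skeleton B').Adj w u →
      IsSphere B n ℓ u ∨ (u ∉ vertices B ∧ ∃ s, IsSphere B n ℓ s ∧ Tri B' s w u) := by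
    intro w u hw a
    by_cases hu : u ∈ vertices B
    · exact Or.inl (E.adj_new hB hu hw a.symm).1
    · rcases E.adj_extend_iff.1 a with h | ⟨c, t⟩
      · exact absurd (adj_mem_left h) hw
      · have hc := (E.tri_new hw t).resolve_left fun h => hu h.1
        exact Or.inr ⟨hu, c, hc, t.rot.rot⟩
  have hvert : ∀ v ∈ vertices B', π' v ∈ vertices X := by
    intro v hv
    by_cases h : v ∈ vertices B
    · rw [hold h]
      exact hπ.vert v h
    · have hvx : v ≠ x := by
        rintro rfl
        exact h hB.base_mem
      obtain ⟨u, a, -⟩ := hG.down_exists v hv hvx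
      exact adj_mem_left (ha a)
  have hinj : ∀ v u u', (skeleton B').Adj v u → (skeleton B').Adj v u' → π' u = π' u' →
      u = u' := by
    intro v u u' a a' e
    by_cases hv : v ∈ vertices B
    · exact hinjI hv a a' e
    · -- the remaining case of two neighbours of different kinds
      have mixed : ∀ {u u'}, (skeleton B').Adj v u → (skeleton B').Adj v u' → π' u = π' u' →
          IsSphere B n ℓ u → (∃ s, IsSphere B n ℓ s ∧ Tri B' s v u') → u = u' := by
        rintro u u' a a' e hu ⟨s, hs, t⟩
        by_cases hsu : s = u
        · subst hsu
          exact absurd e (ha t.right.adj).ne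
        · have t' := hmeet hv hs hu hsu t.adj.symm a
          exact hinjS hs t'.adj t.right.adj e
      rcases hnbr hv a with hu | ⟨-, s, hs, t⟩ <;> rcases hnbr hv a' with hu' | ⟨-, s', hs', t'⟩
      · by_contra hne
        exact (ha (hmeet hv hu hu' hne a a').adj).ne e
      · exact mixed a a' e hu ⟨s', hs', t'⟩
      · exact (mixed a' a e.symm hu' ⟨s, hs, t⟩).symm
      · by_cases hss : s = s'
        · subst hss
          exact hinjS hs t.right.adj t'.right.adj e
        · have t2 := ht (hmeet hv hs hs' hss t.adj.symm t'.adj.symm)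
          have t3 := ht t
          have t4 := ht t'
          rw [← e] at t4
          exact ((hX _ (adj_mem_right t2.adj')).no_triangle t2.rot.rot t4.left
            t3.left.right).elim
  refine ⟨B', π', _, hG, E.ball_extend hB, ⟨?_, hvert, fun u v a => ha a, hinj, ?_⟩,
    fun v hv => hold hv⟩
  · rw [hold hB.base_mem, hπ.base]
  · refine fun v u u' a a' => ⟨ht, fun t => ?_⟩
    by_cases hv : v ∈ vertices B
    · rcases (ExtData.level_le' hB hv).lt_or_eq with hlt | heq
      · rw [hB', E.adj_interior_iff hB hv hlt] at a a'
        rw [hold hv, hold (adj_mem_right a), hold (adj_mem_right a')] at t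
        exact ExtData.tri_extend_of_tri ((hπ.tri v u u' a a').2 t)
      · have hs : IsSphere B n ℓ v := ⟨hv, heq⟩
        obtain ⟨m, rfl⟩ := (E.adj_sphere_iff hs).1 a
        obtain ⟨m', rfl⟩ := (E.adj_sphere_iff hs).1 a'
        rw [hnew hs, hnew hs, hold hv, (hψ v hv).tri_iff] at t
        exact (E.tri_sphere_iff hs).2 ⟨m, m', t, rfl, rfl⟩
    · -- a triangle of `X` at a new vertex having a vertex of level `n` lifts
      have lift : ∀ {u u'}, (skeleton B').Adj v u → (skeleton B').Adj v u' →
          Tri X (π' v) (π' u) (π' u') → IsSphere B n ℓ u → Tri B' v u u' := by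
        intro u u' a a' t hu
        obtain ⟨m, rfl⟩ := (E.adj_sphere_iff hu).1 a.symm
        rw [hnew hu, hold hu.1] at t
        obtain ⟨i, e⟩ := (hψ u hu.1).tri_cases t.left
        have t1 : Tri B' u (φ u m) (φ u (mkNbr m i)) :=
          (E.tri_sphere_iff hu).2 ⟨m, _, (mk_adj_iff _ _).2 ⟨i, rfl⟩, rfl, rfl⟩
        have e2 := hinj _ _ _ a' t1.adj' (by rw [hnew hu, e])
        rw [e2]
        exact t1.left
      rcases hnbr hv a with hu | ⟨hu, s, hs, t1⟩
      · exact lift a a' t hu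
      · rcases hnbr hv a' with hu' | ⟨hu', s', hs', t2⟩
        · exact (lift a' a t.right hu').right
        · exfalso
          have hM := hX _ (adj_mem_left t.adj)
          have t1' := ht t1
          have t2' := ht t2
          by_cases hss : s = s'
          · subst hss
            exact hM.no_triangle t1'.left t (t2'.left.right)
          · have t3 := ht (hmeet hv hs hs' hss t1.adj.symm t2.adj.symm)
            rcases hM.quad t1'.left t t2'.left.right t3.rot.rot.right with q | q
            · exact hu' (hinj _ _ _ t1.adj.symm a' q ▸ hs.1)
            · exact hu (hinj _ _ _ a t2.adj.symm q ▸ hs'.1)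

end Covering

/-! ### Balls in simply connected complexes of rank `7/4` -/

section Lifting

variable {V : Type*} [DecidableEq V] {X Y : PreAbstractSimplicialComplex V}

/-- The complex consisting of a single vertex. -/
def point (x : V) : PreAbstractSimplicialComplex V where
  faces := {{x}}
  isRelLowerSet_faces := by
    rintro s rfl
    refine ⟨by simp, fun t hts ht => ?_⟩
    exact (Finset.subset_singleton_iff.1 hts).resolve_left ht.ne_empty

omit [DecidableEq V] in
lemma mem_point {x : V} {s : Finset V} : s ∈ point x ↔ s = {x} := Iff.rfl

lemma point_not_adj {x a b : V} (h : (skeleton (point x)).Adj a b) : False := by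
  have h2 := congrArg Finset.card (mem_point.1 h.2)
  rw [Finset.card_pair h.1] at h2
  simp at h2

omit [DecidableEq V] in
lemma mem_vertices_point {x v : V} : v ∈ vertices (point x) ↔ v = x := by
  refine mem_point.trans ?_
  simp

lemma point_isGood (x : V) : IsGood (point x) x (0 : ℕ) (fun _ => 0) := by
  have no : ∀ {a b c : V}, Tri (point x) a b c → False := fun t => point_not_adj t.adj
  constructor
  case card_le =>
    intro s hs
    rw [mem_point.1 hs]
    simp
  case base_mem => exact rfl
  case level_eq_zero => simp [mem_vertices_point]
  case level_le => simp
  case level_adj => simp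
  case finite =>
    refine fun k => (Set.finite_singleton x).subset fun v hv => mem_vertices_point.1 hv.1
  case hasMKLink => simp
  case down_exists => exact fun v hv hx => absurd (mem_vertices_point.1 hv) hx
  case down_tri => exact fun v u u' a => (point_not_adj a).elim
  case down_two => exact fun v u u' u'' a => (point_not_adj a).elim
  case same_exists => exact fun v w a => (point_not_adj a).elim
  case same_unique => exact fun v w u u' t => (no t).elim
  case no_flat => exact fun u v w t => (no t).elim

/-- Dependent choice of a sequence which starts at stage `m`, where a condition `R` is imposed on
consecutive terms. -/
lemma exists_seq {α : Type*} {good : ℕ → α → Prop} {R : ℕ → α → α → Prop} {m : ℕ} {a₀ : α}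
    (h0 : good m a₀) (hs : ∀ n, m ≤ n → ∀ a, good n a → ∃ a', good (n + 1) a' ∧ R n a a') :
    ∃ a : ℕ → α, a 0 = a₀ ∧ (∀ k, good (m + k) (a k)) ∧ ∀ k, R (m + k) (a k) (a (k + 1)) := by
  classical
  let f : ∀ k, {a : α // good (m + k) a} := fun k =>
    Nat.rec (motive := fun k => {a : α // good (m + k) a}) ⟨a₀, h0⟩
      (fun k a => ⟨(hs (m + k) (by omega) a.1 a.2).choose,
        (hs (m + k) (by omega) a.1 a.2).choose_spec.1⟩) k
  exact ⟨fun k => (f k).1, rfl, fun k => (f k).2,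
    fun k => (hs (m + k) (by omega) (f k).1 (f k).2).choose_spec.2⟩

/-- Every complex all of whose links are Moebius-Kantor graphs is developed by a good complex. -/
lemma exists_developing [Infinite V] (hX : ∀ v ∈ vertices X, HasMKLink X v) {x : V}
    (hx : x ∈ vertices X) :
    ∃ (Y : PreAbstractSimplicialComplex V) (ℓ : V → ℕ) (π : V → V), IsGood Y x ⊤ ℓ ∧
      IsDeveloping X Y x π := by
  classical
  obtain ⟨a, -, ha, haR⟩ := exists_seq
    (α := PreAbstractSimplicialComplex V × (V → V))
    (good := fun n a => (∃ ℓ, IsGood a.1 x n ℓ) ∧ IsDeveloping X a.1 x a.2)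
    (R := fun n a a' => ball a'.1 x n = a.1 ∧ ∀ v ∈ vertices a.1, a'.2 v = a.2 v)
    (m := 0) (a₀ := (point x, id))
    ⟨⟨_, point_isGood x⟩, ⟨rfl, fun v hv => by rw [mem_vertices_point.1 hv]; exact hx,
      fun u v h => (point_not_adj h).elim, fun v u u' h => (point_not_adj h).elim,
      fun v u u' h => (point_not_adj h).elim⟩⟩
    (fun n _ a ha => by
      obtain ⟨⟨ℓ, hG⟩, hD⟩ := ha
      obtain ⟨B', π', ℓ', h1, h2, h3, h4⟩ := hD.exists_extend hX hG
      exact ⟨(B', π'), ⟨⟨ℓ', h1⟩, h3⟩, h2, h4⟩)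
  obtain ⟨ℓ, hG, hb⟩ := exists_limit (B := fun k => (a k).1) (x := x) (m := 0)
    (fun k => (ha k).1) (fun k => (haR k).1)
  have hmono : ∀ {j k}, j ≤ k → ∀ {s}, s ∈ (a j).1 → s ∈ (a k).1 := by
    intro j k h s hs
    induction k, h using Nat.le_induction with
    | base => exact hs
    | succ k _ ih =>
      rw [← (haR k).1] at ih
      exact ih.1
  have hcoh : ∀ {j k}, j ≤ k → ∀ {v}, v ∈ vertices (a j).1 → (a k).2 v = (a j).2 v := by
    intro j k h v hv
    induction k, h using Nat.le_induction with
    | base => rfl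
    | succ k hk ih => rw [(haR k).2 v (hmono hk hv), ih]
  set Y := union fun k => (a k).1 with hY
  set π : V → V := fun v => (a (ℓ v)).2 v with hπ
  have hfull : ∀ k s, s ∈ Y → (∀ v ∈ s, ℓ v ≤ k) → s ∈ (a k).1 := by
    intro k s hs h
    rw [← hb k]
    exact hG.mem_ball_iff.2 ⟨hs, by simpa using h⟩
  have hvert : ∀ {v}, v ∈ vertices Y → ∀ {k}, ℓ v ≤ k → v ∈ vertices (a k).1 :=
    fun h k hk => hfull k _ h (by simp [hk])
  have hadj : ∀ {u v}, (skeleton Y).Adj u v → ∀ {k}, ℓ u ≤ k → ℓ v ≤ k →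
      (skeleton (a k).1).Adj u v := fun h k hu hv => ⟨h.1, hfull k _ h.2 (by simp [hu, hv])⟩
  have hπk : ∀ {v}, v ∈ vertices Y → ∀ {k}, ℓ v ≤ k → π v = (a k).2 v :=
    fun h k hk => (hcoh hk (hvert h le_rfl)).symm
  refine ⟨Y, ℓ, π, hG, ⟨?_, fun v hv => (ha (ℓ v)).2.vert v (hvert hv le_rfl),
    fun u v h => ?_, fun v u u' h h' e => ?_, fun v u u' h h' => ?_⟩⟩
  · exact (ha (ℓ x)).2.base
  · rw [hπk (adj_mem_left h) (k := ℓ u + ℓ v) (by omega), hπk (adj_mem_right h)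
      (k := ℓ u + ℓ v) (by omega)]
    exact (ha _).2.adj u v (hadj h (by omega) (by omega))
  · rw [hπk (adj_mem_right h) (k := ℓ v + ℓ u + ℓ u') (by omega), hπk (adj_mem_right h')
      (k := ℓ v + ℓ u + ℓ u') (by omega)] at e
    exact (ha _).2.inj v u u' (hadj h (by omega) (by omega)) (hadj h' (by omega) (by omega)) e
  · have hk1 : ℓ v ≤ ℓ v + ℓ u + ℓ u' := by omega
    have hk2 : ℓ u ≤ ℓ v + ℓ u + ℓ u' := by omega
    have hk3 : ℓ u' ≤ ℓ v + ℓ u + ℓ u' := by omega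
    rw [hπk (adj_mem_left h) hk1, hπk (adj_mem_right h) hk2, hπk (adj_mem_right h') hk3]
    rw [← (ha _).2.tri v u u' (hadj h hk1 hk2) (hadj h' hk1 hk3)]
    constructor
    · exact fun t => tri_iff.2 ⟨hfull _ _ t.mem (by simp [hk1, hk2, hk3]), (tri_iff.1 t).2⟩
    · exact fun t => tri_iff.2 ⟨⟨_, t.mem⟩, (tri_iff.1 t).2⟩

namespace IsDeveloping

variable {x : V} {π : V → V}

/-- A developing map of a complex without boundary is surjective on stars. -/
lemma exists_lift (h : IsDeveloping X Y x π) (hX : ∀ v ∈ vertices X, HasMKLink X v)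
    (hY : ∀ v ∈ vertices Y, HasMKLink Y v) {y w : V} (hy : y ∈ vertices Y)
    (hw : (skeleton X).Adj (π y) w) : ∃ z, (skeleton Y).Adj y z ∧ π z = w := by
  obtain ⟨φ, hφ⟩ := hY y hy
  obtain ⟨ψ, hψ⟩ := hX _ (h.vert y hy)
  have ha : ∀ m, (skeleton Y).Adj y (φ m) := fun m => (hφ.adj_iff _).2 ⟨m, rfl⟩
  choose g hg using fun m => (hψ.adj_iff _).1 (h.adj _ _ (ha m))
  have hinj : Function.Injective g := fun m m' e => hφ.inj (h.inj y _ _ (ha m) (ha m') (by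
    rw [← hg, ← hg, e]))
  obtain ⟨m', rfl⟩ := (hψ.adj_iff _).1 hw
  obtain ⟨m, rfl⟩ := Finite.injective_iff_surjective.1 hinj m'
  exact ⟨φ m, ha m, (hg m).symm⟩

end IsDeveloping

open Classical in
/-- The lift to `Y`, starting from `y`, of an edge whose end point is `w`. -/
noncomputable def liftStep (Y : PreAbstractSimplicialComplex V) (π : V → V) (y w : V) : V :=
  if h : ∃ z, (skeleton Y).Adj y z ∧ π z = w then h.choose else y

/-- The end point of the lift to `Y`, starting from `y`, of an edge path of `X`. -/
noncomputable def liftEnd (Y : PreAbstractSimplicialComplex V) (π : V → V) :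
    {u v : V} → (skeleton X).Walk u v → V → V
  | _, _, .nil, y => y
  | _, _, .cons (v := w) _ p, y => liftEnd Y π p (liftStep Y π y w)

namespace IsDeveloping

variable {x : V} {π : V → V}

lemma liftStep_eq (h : IsDeveloping X Y x π) {y z : V} (a : (skeleton Y).Adj y z) :
    liftStep Y π y (π z) = z := by
  have hex : ∃ z', (skeleton Y).Adj y z' ∧ π z' = π z := ⟨z, a, rfl⟩
  rw [liftStep, dif_pos hex]
  exact h.inj y _ _ hex.choose_spec.1 a hex.choose_spec.2

lemma liftEnd_spec (h : IsDeveloping X Y x π) (hX : ∀ v ∈ vertices X, HasMKLink X v)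
    (hY : ∀ v ∈ vertices Y, HasMKLink Y v) {u v : V} (p : (skeleton X).Walk u v) :
    ∀ y ∈ vertices Y, π y = u → liftEnd Y π p y ∈ vertices Y ∧ π (liftEnd Y π p y) = v := by
  induction p with
  | nil => exact fun y hy e => ⟨hy, e⟩
  | cons a p ih =>
    rintro y hy rfl
    obtain ⟨z, az, rfl⟩ := h.exists_lift hX hY hy a
    rw [liftEnd, h.liftStep_eq az]
    exact ih z (adj_mem_right az) rfl

lemma liftEnd_homotopic (h : IsDeveloping X Y x π) (hX : ∀ v ∈ vertices X, HasMKLink X v)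
    (hY : ∀ v ∈ vertices Y, HasMKLink Y v) {u v : V} {p q : (skeleton X).Walk u v}
    (hpq : EdgeHomotopic X p q) :
    ∀ y ∈ vertices Y, π y = u → liftEnd Y π p y = liftEnd Y π q y := by
  induction hpq with
  | refl p => exact fun _ _ _ => rfl
  | symm _ ih => exact fun y hy e => (ih y hy e).symm
  | trans _ _ ih ih' => exact fun y hy e => (ih y hy e).trans (ih' y hy e)
  | cons a _ ih =>
    rintro y hy rfl
    obtain ⟨z, az, rfl⟩ := h.exists_lift hX hY hy a
    rw [liftEnd, liftEnd, h.liftStep_eq az]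
    exact ih z (adj_mem_right az) rfl
  | backtrack a a' p =>
    rintro y hy rfl
    obtain ⟨z, az, rfl⟩ := h.exists_lift hX hY hy a
    rw [liftEnd, liftEnd, h.liftStep_eq az, h.liftStep_eq az.symm]
  | triangle a b c hm p =>
    rintro y hy rfl
    obtain ⟨z, az, rfl⟩ := h.exists_lift hX hY hy a
    obtain ⟨w, aw, rfl⟩ := h.exists_lift hX hY hy c
    have t := (h.tri y z w az aw).2 (tri_iff.2 ⟨hm, a.ne, c.ne, b.ne⟩)
    rw [liftEnd, liftEnd, liftEnd, h.liftStep_eq az, h.liftStep_eq t.adj', h.liftStep_eq aw]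

lemma exists_project (h : IsDeveloping X Y x π) {y z : V} (q : (skeleton Y).Walk y z) :
    ∀ b, π z = b → ∃ p : (skeleton X).Walk (π y) b, liftEnd Y π p y = z := by
  induction q with
  | nil =>
    rintro b rfl
    exact ⟨.nil, rfl⟩
  | cons a q ih =>
    intro b hb
    obtain ⟨p, hp⟩ := ih b hb
    refine ⟨.cons (h.adj _ _ a) p, ?_⟩
    rw [liftEnd, h.liftStep_eq a, hp]

/-- The developing map of a simply connected complex is bijective on vertices. -/
lemma bijOn (h : IsDeveloping X Y x π) (hX : ∀ v ∈ vertices X, HasMKLink X v)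
    (hY : ∀ v ∈ vertices Y, HasMKLink Y v) (hx : x ∈ vertices X) (hxY : x ∈ vertices Y)
    (hXs : IsSimplyConnected X) (hYs : IsSimplyConnected Y) :
    Set.BijOn π (vertices Y) (vertices X) := by
  refine ⟨h.vert, fun y hy z hz e => ?_, fun v hv => ?_⟩
  · obtain ⟨q⟩ := hYs.2.1 y hy z hz
    obtain ⟨p, hp⟩ := h.exists_project q (π y) e.symm
    rw [← hp, h.liftEnd_homotopic hX hY (hXs.2.2 _ (h.vert y hy) p) y hy rfl]
    rfl
  · obtain ⟨p⟩ := hXs.2.1 x hx v hv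
    obtain ⟨h1, h2⟩ := h.liftEnd_spec hX hY p x hxY h.base
    exact ⟨_, h1, h2⟩

end IsDeveloping

/-- A simply connected complex of rank `7/4` is good with respect to the distance to any of its
vertices. -/
theorem exists_isGood [Infinite V] (hX : IsRankSevenFourths X) (hs : IsSimplyConnected X) {x : V}
    (hx : x ∈ vertices X) : ∃ ℓ, IsGood X x ⊤ ℓ := by
  classical
  have hM : ∀ v ∈ vertices X, HasMKLink X v := fun v hv => hasMKLink_iff.1 (hX.2 v hv)
  obtain ⟨Y, ℓ, π, hG, hπ⟩ := exists_developing hM hx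
  have hMY : ∀ v ∈ vertices Y, HasMKLink Y v := fun v hv =>
    hG.hasMKLink v hv (ENat.natCast_lt_top _)
  have hbij := hπ.bijOn hM hMY hx hG.base_mem hs hG.isSimplyConnected
  set σ : V → V := Function.invFunOn π (vertices Y) with hσ
  have hσv : ∀ {v}, v ∈ vertices X → σ v ∈ vertices Y := fun hv =>
    Function.invFunOn_mem (hbij.surjOn hv)
  have hπσ : ∀ {v}, v ∈ vertices X → π (σ v) = v := fun hv =>
    Function.invFunOn_eq (hbij.surjOn hv)
  have hσπ : ∀ {v}, v ∈ vertices Y → σ (π v) = v := fun hv =>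
    hbij.injOn (hσv (hπ.vert _ hv)) hv (hπσ (hπ.vert _ hv))
  have hσi : ∀ {v w}, v ∈ vertices X → w ∈ vertices X → σ v = σ w → v = w := fun hv hw e => by
    rw [← hπσ hv, e, hπσ hw]
  have hadj : ∀ {u v}, (skeleton X).Adj u v → (skeleton Y).Adj (σ u) (σ v) := by
    intro u v a
    have hu := adj_mem_left a
    rw [← hπσ hu] at a
    obtain ⟨z, az, rfl⟩ := hπ.exists_lift hM hMY (hσv hu) a
    rwa [hσπ (adj_mem_right az)]
  have htri : ∀ {a b c}, Tri X a b c → Tri Y (σ a) (σ b) (σ c) := by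
    intro a b c t
    rw [hπ.tri _ _ _ (hadj t.adj) (hadj t.right.adj), hπσ (adj_mem_left t.adj),
      hπσ (adj_mem_right t.adj), hπσ (adj_mem_right t.adj')]
    exact t
  have hadj' : ∀ {y z}, (skeleton Y).Adj y z → (skeleton X).Adj (π y) (π z) :=
    fun a => hπ.adj _ _ a
  have htri' : ∀ {a b c}, Tri Y a b c → Tri X (π a) (π b) (π c) :=
    fun t => (hπ.tri _ _ _ t.adj t.right.adj).1 t
  refine ⟨fun v => ℓ (σ v), ?_⟩
  constructor
  case card_le => exact hX.1
  case base_mem => exact hx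
  case level_eq_zero =>
    intro v hv
    rw [hG.level_eq_zero _ (hσv hv)]
    constructor
    · intro e
      rw [← hπσ hv, e, hπ.base]
    · rintro rfl
      rw [← hπ.base, hσπ hG.base_mem, hπ.base]
  case level_le => exact fun _ _ => le_top
  case level_adj => exact fun u v a => hG.level_adj _ _ (hadj a)
  case finite =>
    refine fun k => ((hG.finite k).image π).subset fun v hv => ⟨σ v, ⟨hσv hv.1, hv.2⟩, hπσ hv.1⟩
  case hasMKLink => exact fun v hv _ => hM v hv
  case down_exists =>
    intro v hv hvx
    have hne : σ v ≠ x := by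
      rintro e
      exact hvx (by rw [← hπσ hv, e, hπ.base])
    obtain ⟨u, a, g⟩ := hG.down_exists _ (hσv hv) hne
    refine ⟨π u, ?_, by rw [hσπ (adj_mem_right a)]; exact g⟩
    have := hadj' a
    rwa [hπσ hv] at this
  case down_tri =>
    intro v u u' a a' g g' ne
    have t := htri' (hG.down_tri _ _ _ (hadj a) (hadj a') g g'
      fun e => ne (hσi (adj_mem_right a) (adj_mem_right a') e))
    rwa [hπσ (adj_mem_left a), hπσ (adj_mem_right a), hπσ (adj_mem_right a')] at t
  case down_two =>
    intro v u u' u'' a a' a'' g g' g''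
    exact (hG.down_two _ _ _ _ (hadj a) (hadj a') (hadj a'') g g' g'').imp
      (hσi (adj_mem_right a) (adj_mem_right a')) (Or.imp (hσi (adj_mem_right a) (adj_mem_right a''))
        (hσi (adj_mem_right a') (adj_mem_right a'')))
  case same_exists =>
    intro v w a g
    obtain ⟨u, t, gu⟩ := hG.same_exists _ _ (hadj a) g
    refine ⟨π u, ?_, by rw [hσπ (adj_mem_right t.adj')]; exact gu⟩
    have := htri' t
    rwa [hπσ (adj_mem_left a), hπσ (adj_mem_right a)] at this
  case same_unique =>
    intro v w u u' t t' g gu gu'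
    exact hσi (adj_mem_right t.adj') (adj_mem_right t'.adj')
      (hG.same_unique _ _ _ _ (htri t) (htri t') g gu gu')
  case no_flat => exact fun u v w t => hG.no_flat _ _ _ (htri t)

end Lifting

/-! ### The parity of a face -/

section Parity

variable {V : Type*} [DecidableEq V] {X Y : PreAbstractSimplicialComplex V}

open Classical in
/-- The contribution to the parity of the roots in the link of `v` with end points `y` and `z`:
it is `1` if they have rank two, and `0` otherwise. -/
noncomputable def rho (X : PreAbstractSimplicialComplex V) (v y z : V) : ZMod 2 :=
  if Full (linkGraph X v) y z then 1 else 0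

lemma rho_congr {v y z : V} (h : ∀ a b, Tri Y v a b ↔ Tri X v a b) : rho Y v y z = rho X v y z := by
  have e : linkGraph Y v = linkGraph X v := by
    ext a b
    exact h a b
  rw [rho, rho, e]

lemma rho_symm {v y z : V} (hv : HasMKLink X v) (hy : (skeleton X).Adj v y)
    (hz : (skeleton X).Adj v z) : rho X v y z = rho X v z y := by
  classical exact if_congr (hv.full_symm hy hz) rfl rfl

lemma rho_toggle {v y c b z z' : V} (hv : HasMKLink X v) (h1 : Tri X v y c) (h2 : Tri X v c b)
    (h3 : Tri X v b z) (h3' : Tri X v b z') (hyb : y ≠ b) (hz : z ≠ c) (hz' : z' ≠ c)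
    (hzz : z ≠ z') : rho X v y z' = rho X v y z + 1 := by
  have h := hv.full_toggle h1 h2 h3 h3' hyb hz hz' hzz
  by_cases h' : Full (linkGraph X v) y z'
  · simp only [rho, h', h, not_true_eq_false, if_true, if_false]
    rfl
  · simp only [rho, h', h, not_false_eq_true, if_true, if_false]
    rfl

/-- `a b c` is the centerpiece, and `x`, `y`, `z` are the opposite corners, of a 2-triangle. -/
structure IsTwoTriangle (X : PreAbstractSimplicialComplex V) (a b c x y z : V) : Prop where
  center : Tri X a b c
  hx : Tri X x b c
  hy : Tri X a y c
  hz : Tri X a b z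
  x_ne : x ≠ a
  y_ne : y ≠ b
  z_ne : z ≠ c

/-- The number modulo two of sides of rank two of a 2-triangle, in terms of its centerpiece and
its corners. -/
noncomputable def paritySum (X : PreAbstractSimplicialComplex V) (a b c x y z : V) : ZMod 2 :=
  rho X a y z + rho X b z x + rho X c x y

namespace IsTwoTriangle

variable {a b c x y z : V}

lemma rot (h : IsTwoTriangle X a b c x y z) : IsTwoTriangle X b c a y z x :=
  ⟨h.center.rot, h.hy.left.right, h.hz.left.right, h.hx.rot, h.y_ne, h.z_ne, h.x_ne⟩

lemma swap (h : IsTwoTriangle X a b c x y z) : IsTwoTriangle X b a c y x z :=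
  ⟨h.center.left, h.hy.left, h.hx.left, h.hz.left, h.y_ne, h.x_ne, h.z_ne⟩

lemma paritySum_rot : paritySum X b c a y z x = paritySum X a b c x y z := by
  simp only [paritySum]
  ring

lemma paritySum_swap (h : IsTwoTriangle X a b c x y z) (ha : HasMKLink X a) (hb : HasMKLink X b)
    (hc : HasMKLink X c) : paritySum X b a c y x z = paritySum X a b c x y z := by
  simp only [paritySum]
  rw [rho_symm hb h.hx.left.adj h.hz.left.right.adj, rho_symm ha h.hz.right.adj h.hy.adj,
    rho_symm hc h.hy.rot.rot.right.adj h.hx.rot.rot.adj]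
  ring

lemma paritySum_change_z (h : IsTwoTriangle X a b c x y z) (ha : HasMKLink X a)
    (hb : HasMKLink X b) {z' : V} (hz : Tri X a b z') (hz' : z' ≠ c) :
    paritySum X a b c x y z' = paritySum X a b c x y z := by
  by_cases hzz : z = z'
  · rw [hzz]
  · have e1 := rho_toggle ha h.hy h.center.right h.hz hz h.y_ne h.z_ne hz' hzz
    have e2 := rho_toggle hb h.hx.left h.center.rot h.hz.left hz.left h.x_ne h.z_ne hz' hzz
    rw [rho_symm hb h.hx.left.adj hz.rot.adj, rho_symm hb h.hx.left.adj h.hz.rot.adj] at e2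
    have h2 : (1 : ZMod 2) + 1 = 0 := rfl
    simp only [paritySum]
    rw [e1, e2]
    linear_combination h2

lemma paritySum_eq (h : IsTwoTriangle X a b c x y z) (ha : HasMKLink X a) (hb : HasMKLink X b)
    (hc : HasMKLink X c) {x' y' z' : V} (h' : IsTwoTriangle X a b c x' y' z') :
    paritySum X a b c x' y' z' = paritySum X a b c x y z := by
  have h1 : IsTwoTriangle X a b c x y z' :=
    ⟨h.center, h.hx, h.hy, h'.hz, h.x_ne, h.y_ne, h'.z_ne⟩
  have h2 : IsTwoTriangle X a b c x' y z' :=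
    ⟨h.center, h'.hx, h.hy, h'.hz, h'.x_ne, h.y_ne, h'.z_ne⟩
  rw [← h.paritySum_change_z ha hb h'.hz h'.z_ne, ← paritySum_rot, ← paritySum_rot (b := b),
    ← h1.rot.paritySum_change_z hb hc h2.rot.hz h2.rot.z_ne, ← paritySum_rot,
    ← paritySum_rot (b := c)]
  exact h2.rot.rot.paritySum_change_z hc ha h'.rot.rot.hz h'.rot.rot.z_ne

lemma rankTwoSides_eq (T : TwoTriangle X) (ha : HasMKLink X T.a) (hb : HasMKLink X T.b)
    (hc : HasMKLink X T.c) :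
    (T.rankTwoSides : ZMod 2) = paritySum X T.a T.b T.c T.x T.y T.z := by
  have h1 : Tri X T.a T.b T.c := T.center_mem
  have h2 : Tri X T.x T.b T.c := T.x_mem
  have h3 : Tri X T.a T.y T.c := T.y_mem
  have h4 : Tri X T.a T.b T.z := T.z_mem
  rw [TwoTriangle.rankTwoSides]
  push_cast
  classical
  exact congrArg₂ (· + ·) (congrArg₂ (· + ·)
    (if_congr (ha.rootRank_eq_two_iff h3 h1.right h4 T.y_ne T.z_ne.symm) rfl rfl)
    (if_congr (hb.rootRank_eq_two_iff h4.left.right h1.left h2.left.right T.z_ne T.x_ne.symm)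
      rfl rfl))
    (if_congr (hc.rootRank_eq_two_iff h2.rot.rot h1.rot.rot.right h3.rot.rot T.x_ne T.y_ne.symm)
      rfl rfl)

/-- The parity of a face can be computed from any 2-triangle which has it as a centerpiece. -/
theorem hasParity (h : IsTwoTriangle X a b c x y z) (ha : HasMKLink X a) (hb : HasMKLink X b)
    (hc : HasMKLink X c) : HasParity X {a, b, c} (paritySum X a b c x y z) := by
  refine ⟨⟨⟨a, b, c, x, y, z, h.center, h.hx, h.hy, h.hz, h.x_ne, h.y_ne, h.z_ne⟩, rfl⟩,
    fun T hT => ?_⟩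
  have hT' : IsTwoTriangle X T.a T.b T.c T.x T.y T.z :=
    ⟨T.center_mem, T.x_mem, T.y_mem, T.z_mem, T.x_ne, T.y_ne, T.z_ne⟩
  have mA : T.a ∈ ({a, b, c} : Finset V) := hT ▸ (by simp [TwoTriangle.center])
  have mB : T.b ∈ ({a, b, c} : Finset V) := hT ▸ (by simp [TwoTriangle.center])
  have mC : T.c ∈ ({a, b, c} : Finset V) := hT ▸ (by simp [TwoTriangle.center])
  obtain ⟨-, nab, nac, nbc⟩ := tri_iff.1 hT'.center
  have all : ∀ v ∈ ({a, b, c} : Finset V), HasMKLink X v := by simp [ha, hb, hc]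
  rw [rankTwoSides_eq T (all _ mA) (all _ mB) (all _ mC)]
  generalize T.a = A at *
  generalize T.b = A' at *
  generalize T.c = A'' at *
  simp only [Finset.mem_insert, Finset.mem_singleton] at mA mB mC
  rcases mA with rfl | rfl | rfl <;> rcases mB with rfl | rfl | rfl <;>
    rcases mC with rfl | rfl | rfl
  all_goals first
    | exact absurd rfl nab
    | exact absurd rfl nac
    | exact absurd rfl nbc
    | skip
  · exact h.paritySum_eq ha hb hc hT'
  · exact (h.swap.rot.paritySum_eq ha hc hb hT').trans
      (paritySum_rot.trans (h.paritySum_swap ha hb hc))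
  · exact (h.swap.paritySum_eq hb ha hc hT').trans (h.paritySum_swap ha hb hc)
  · exact (h.rot.paritySum_eq hb hc ha hT').trans paritySum_rot
  · exact (h.rot.rot.paritySum_eq hc ha hb hT').trans (paritySum_rot.trans paritySum_rot)
  · exact (h.swap.rot.rot.paritySum_eq hc hb ha hT').trans
      (paritySum_rot.trans (paritySum_rot.trans (h.paritySum_swap ha hb hc)))

end IsTwoTriangle

lemma HasParity.exists_isTwoTriangle {f : Finset V} {ε : ZMod 2} (h : HasParity X f ε)
    (hM : ∀ v ∈ f, HasMKLink X v) : ∃ a b c x y z, f = {a, b, c} ∧ IsTwoTriangle X a b c x y z ∧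
      paritySum X a b c x y z = ε := by
  obtain ⟨⟨T, hT⟩, h⟩ := h
  have e := h T hT
  subst hT
  rw [IsTwoTriangle.rankTwoSides_eq T (hM _ (by simp [TwoTriangle.center]))
    (hM _ (by simp [TwoTriangle.center])) (hM _ (by simp [TwoTriangle.center]))] at e
  exact ⟨_, _, _, _, _, _, rfl, ⟨T.center_mem, T.x_mem, T.y_mem, T.z_mem, T.x_ne, T.y_ne, T.z_ne⟩,
    e⟩

/-- The parity of a face of the ball of radius `n` can be computed in the ball of radius
`n + 1`. -/
lemma IsGood.hasParity_of_ball {x : V} {n : ℕ} {ℓ : V → ℕ} (hX : IsGood X x ⊤ ℓ) {f : Finset V}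
    (hf : ∀ v ∈ f, v ∈ vertices X ∧ ℓ v ≤ n) {ε : ZMod 2} (h : HasParity (ball X x (n + 1)) f ε) :
    HasParity X f ε := by
  have hM : ∀ v ∈ f, HasMKLink X v := fun v hv => hX.hasMKLink v (hf v hv).1 (ENat.natCast_lt_top _)
  obtain ⟨a, b, c, p, q, r, rfl, hT, rfl⟩ := h.exists_isTwoTriangle fun v hv =>
    hX.ball_hasMKLink (hM v hv) (Nat.lt_succ_of_le (hf v hv).2)
  have hT' : IsTwoTriangle X a b c p q r :=
    ⟨(hX.ball_tri_iff.1 hT.center).1, (hX.ball_tri_iff.1 hT.hx).1, (hX.ball_tri_iff.1 hT.hy).1,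
      (hX.ball_tri_iff.1 hT.hz).1, hT.x_ne, hT.y_ne, hT.z_ne⟩
  have hrho : ∀ v ∈ ({a, b, c} : Finset V), ∀ y z,
      rho (ball X x (n + 1)) v y z = rho X v y z := by
    intro v hv y z
    refine rho_congr fun s t => ⟨fun h => (hX.ball_tri_iff.1 h).1, fun h => hX.ball_tri_iff.2 ?_⟩
    have h0 := (hf v hv).2
    have h1 := hX.level_adj _ _ h.adj.symm
    have h2 := hX.level_adj _ _ h.right.adj.symm
    exact ⟨h, by omega, by omega, by omega⟩
  rw [paritySum, hrho a (by simp), hrho b (by simp), hrho c (by simp)]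
  exact hT'.hasParity (hM a (by simp)) (hM b (by simp)) (hM c (by simp))

end Parity

/-! ### Embeddings of the links of boundary vertices -/

section Embedding

variable {V : Type*} [DecidableEq V] {B : PreAbstractSimplicialComplex V}

lemma HasMKLink.cubic_at {v a b : V} (hv : HasMKLink B v) (hb : Tri B v a b) (k : Fin 3) :
    ∃ f : Fin 3 → V, Function.Injective f ∧ f k = b ∧ ∀ w, Tri B v a w ↔ ∃ i, w = f i := by
  obtain ⟨f, hf, hw⟩ := hv.cubic hb.adj
  obtain ⟨i, rfl⟩ := (hw b).1 hb
  refine ⟨f ∘ Equiv.swap k i, hf.comp (Equiv.injective _), by simp, fun w => ?_⟩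
  rw [hw]
  exact (Equiv.swap k i).exists_congr_left.trans (by simp)

open Classical in
/-- The analogue of `rho` in the Moebius-Kantor graph. -/
noncomputable def mkRho (m m' : ZMod 8 ⊕ ZMod 8) : ZMod 2 :=
  if Full moebiusKantor m m' then 1 else 0

lemma mkRho_symm (m m' : ZMod 8 ⊕ ZMod 8) : mkRho m m' = mkRho m' m := by
  classical exact if_congr (mk_full_symm m m') rfl rfl

lemma mkRho_toggle {y c b z z' : ZMod 8 ⊕ ZMod 8} (h1 : moebiusKantor.Adj y c)
    (h2 : moebiusKantor.Adj c b) (h3 : moebiusKantor.Adj b z) (h3' : moebiusKantor.Adj b z')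
    (hyb : y ≠ b) (hz : z ≠ c) (hz' : z' ≠ c) (hzz : z ≠ z') : mkRho y z' = mkRho y z + 1 := by
  have h := mk_full_toggle h1 h2 h3 h3' hyb hz hz' hzz
  by_cases h' : Full moebiusKantor y z'
  · simp only [mkRho, h', h, not_true_eq_false, if_true, if_false]
    rfl
  · simp only [mkRho, h', h, not_false_eq_true, if_true, if_false]
    rfl

lemma IsChart.rho_eq {v : V} {φ : ZMod 8 ⊕ ZMod 8 → V} (h : IsChart B v φ) (m m') :
    rho B v (φ m) (φ m') = mkRho m m' := by
  classical exact if_congr (h.full_iff m m') rfl rfl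

/-- An embedding of the link of a vertex `v` in the Moebius-Kantor graph. -/
structure IsLinkEmbedding (B : PreAbstractSimplicialComplex V) (v : V)
    (ι : V → ZMod 8 ⊕ ZMod 8) : Prop where
  inj : ∀ u u', (skeleton B).Adj v u → (skeleton B).Adj v u' → ι u = ι u' → u = u'
  tri : ∀ u u', (skeleton B).Adj v u → (skeleton B).Adj v u' →
    (Tri B v u u' ↔ moebiusKantor.Adj (ι u) (ι u'))

namespace IsGood

variable {x : V} {n : ℕ} {ℓ : V → ℕ}

lemma adj_sphere (hB : IsGood B x n ℓ) {v w : V} (hv : IsSphere B n ℓ v)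
    (a : (skeleton B).Adj v w) : ℓ w + 1 = n ∨ IsSphere B n ℓ w := by
  have h1 := ExtData.level_le' hB (adj_mem_right a)
  have h2 := hB.level_adj _ _ a
  have h3 := hv.2
  rcases h1.lt_or_eq with h | h
  · exact Or.inl (by omega)
  · exact Or.inr ⟨adj_mem_right a, h⟩

lemma hasMKLink_of_lt (hB : IsGood B x n ℓ) {u : V} (hu : u ∈ vertices B) (h : ℓ u < n) :
    HasMKLink B u := hB.hasMKLink u hu (by exact_mod_cast h)

/-- If only one vertex `u` of the preceding level is adjacent to `v`, then the link of `v` is the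
star of `u`. -/
lemma exists_embedding_star (hB : IsGood B x n ℓ) {v u : V} (hv : IsSphere B n ℓ v)
    (a : (skeleton B).Adj v u) (hu : ℓ u + 1 = n)
    (huniq : ∀ u', (skeleton B).Adj v u' → ℓ u' + 1 = n → u' = u) :
    ∃ ι, IsLinkEmbedding B v ι := by
  classical
  obtain ⟨f, hf, hfw⟩ := (hB.hasMKLink_of_lt (adj_mem_right a) (by omega)).cubic a.symm
  have ht : ∀ i, Tri B v u (f i) := fun i => Tri.left ((hfw (f i)).2 ⟨i, rfl⟩)
  have hfu : ∀ i, f i ≠ u := fun i => (ht i).adj'.ne'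
  have hfs : ∀ i, IsSphere B n ℓ (f i) := fun i =>
    (hB.adj_sphere hv (ht i).right.adj).resolve_left fun h => hfu i (huniq _ (ht i).right.adj h)
  have hnbr : ∀ w, (skeleton B).Adj v w → w = u ∨ ∃ i, w = f i := by
    intro w aw
    rcases hB.adj_sphere hv aw with h | h
    · exact Or.inl (huniq w aw h)
    · obtain ⟨d, t, g⟩ := hB.same_exists v w aw (hv.2.trans h.2.symm)
      obtain rfl := huniq d t.right.adj (g.trans hv.2)
      exact Or.inr ((hfw w).1 t.rot.rot)
  have hff : ∀ i j, ¬ Tri B v (f i) (f j) := fun i j t =>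
    hB.no_flat _ _ _ t (hv.2.trans (hfs i).2.symm) ((hfs i).2.trans (hfs j).2.symm)
  have e0 : ∀ i, moebiusKantor.Adj (.inl 0) (mkNbr (.inl 0) i) := fun i =>
    (mk_adj_iff _ _).2 ⟨i, rfl⟩
  have e1 : ∀ i j, ¬ moebiusKantor.Adj (mkNbr (.inl 0) i) (mkNbr (.inl 0) j) := fun i j h =>
    mk_no_triangle (e0 i) h (e0 j).symm
  set ι : V → ZMod 8 ⊕ ZMod 8 :=
    fun w => if w = u then .inl 0 else mkNbr (.inl 0) (Function.invFun f w) with hι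
  have hιu : ι u = .inl 0 := if_pos rfl
  have hιf : ∀ i, ι (f i) = mkNbr (.inl 0) i := fun i => by
    simp only [hι, if_neg (hfu i), Function.leftInverse_invFun hf i]
  refine ⟨ι, fun w w' aw aw' e => ?_, fun w w' aw aw' => ?_⟩
  · rcases hnbr w aw with rfl | ⟨i, rfl⟩ <;> rcases hnbr w' aw' with rfl | ⟨j, rfl⟩
    · rfl
    · rw [hιu, hιf] at e
      exact absurd e (e0 j).ne
    · rw [hιu, hιf] at e
      exact absurd e (e0 i).ne'
    · rw [hιf, hιf] at e
      rw [mkNbr_injective _ _ _ e]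
  · rcases hnbr w aw with rfl | ⟨i, rfl⟩ <;> rcases hnbr w' aw' with rfl | ⟨j, rfl⟩
    · exact iff_of_false (fun h => h.adj'.ne rfl) fun h => h.ne rfl
    · rw [hιu, hιf]
      exact iff_of_true (ht j) (e0 j)
    · rw [hιu, hιf]
      exact iff_of_true (ht i).right (e0 i).symm
    · rw [hιf, hιf]
      exact iff_of_false (hff i j) (e1 i j)

/-- If two vertices `u`, `u'` of the preceding level are adjacent to `v`, then the link of `v` is
the ball of radius one around the edge `u u'`. It has two essentially different embeddings in the
Moebius-Kantor graph, so that the rank of a root whose middle edge is `u u'` can be prescribed. -/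
lemma exists_embedding_edge (hB : IsGood B x n ℓ) {v u u' : V} (hv : IsSphere B n ℓ v)
    (t : Tri B v u u') (hu : ℓ u + 1 = n) (hu' : ℓ u' + 1 = n) :
    ∃ y z, Tri B v y u' ∧ Tri B v u z ∧ y ≠ u ∧ z ≠ u' ∧
      ∀ ε, ∃ ι, IsLinkEmbedding B v ι ∧ mkRho (ι y) (ι z) = ε := by
  classical
  obtain ⟨f, hf, hf0, hfw⟩ :=
    (hB.hasMKLink_of_lt (adj_mem_right t.adj) (by omega)).cubic_at t.left 0
  obtain ⟨g, hg, hg1, hgw⟩ :=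
    (hB.hasMKLink_of_lt (adj_mem_right t.adj') (by omega)).cubic_at t.right.left 1
  have hne : u ≠ u' := t.adj'.ne
  have htf : ∀ i, Tri B v u (f i) := fun i => Tri.left ((hfw (f i)).2 ⟨i, rfl⟩)
  have htg : ∀ i, Tri B v u' (g i) := fun i => Tri.left ((hgw (g i)).2 ⟨i, rfl⟩)
  have huniq : ∀ w, (skeleton B).Adj v w → ℓ w + 1 = n → w = u ∨ w = u' := by
    intro w aw hw
    have h2 := hv.2
    rcases hB.down_two v u u' w t.adj t.right.adj aw (by omega) (by omega) (by omega)
      with h | h | h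
    · exact absurd h hne
    · exact Or.inl h.symm
    · exact Or.inr h.symm
  have hfs : ∀ i, i ≠ 0 → IsSphere B n ℓ (f i) := fun i hi =>
    (hB.adj_sphere hv (htf i).right.adj).resolve_left fun h => by
      rcases huniq _ (htf i).right.adj h with e | e
      · exact (htf i).adj'.ne e.symm
      · exact hi (hf (e.trans hf0.symm))
  have hgs : ∀ i, i ≠ 1 → IsSphere B n ℓ (g i) := fun i hi =>
    (hB.adj_sphere hv (htg i).right.adj).resolve_left fun h => by
      rcases huniq _ (htg i).right.adj h with e | e
      · exact hi (hg (e.trans hg1.symm))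
      · exact (htg i).adj'.ne e.symm
  have hnbr : ∀ w, (skeleton B).Adj v w → (∃ i, w = f i) ∨ ∃ i, w = g i := by
    intro w aw
    rcases hB.adj_sphere hv aw with h | h
    · rcases huniq w aw h with rfl | rfl
      · exact Or.inr ⟨1, hg1.symm⟩
      · exact Or.inl ⟨0, hf0.symm⟩
    · obtain ⟨d, td, gd⟩ := hB.same_exists v w aw (hv.2.trans h.2.symm)
      rcases huniq d td.right.adj (gd.trans hv.2) with rfl | rfl
      · exact Or.inl ((hfw w).1 td.rot.rot)
      · exact Or.inr ((hgw w).1 td.rot.rot)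
  have hboth : ∀ w, IsSphere B n ℓ w → Tri B v u w → Tri B v u' w → False := fun w hw t1 t2 =>
    hne (hB.same_unique v w u u' t1.right t2.right (hv.2.trans hw.2.symm) (hu.trans hv.2.symm)
      (hu'.trans hv.2.symm))
  have hflat : ∀ w w', IsSphere B n ℓ w → IsSphere B n ℓ w' → ¬ Tri B v w w' := fun w w' h h' t =>
    hB.no_flat _ _ _ t (hv.2.trans h.2.symm) (h.2.trans h'.2.symm)
  have hgf : ∀ j, ¬ ∃ i, f i = g j := by
    rintro j ⟨i, e⟩
    by_cases hj : j = 1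
    · rw [hj, hg1] at e
      exact (htf i).adj'.ne e.symm
    · exact hboth _ (hgs j hj) (e ▸ htf i) (htg j)
  have hff : ∀ i j, ¬ Tri B v (f i) (f j) := by
    intro i j h
    by_cases hi : i = 0 <;> by_cases hj : j = 0
    · exact h.adj'.ne (by rw [hi, hj])
    · rw [hi, hf0] at h
      exact hboth _ (hfs j hj) (htf j) h
    · rw [hj, hf0] at h
      exact hboth _ (hfs i hi) (htf i) h.right
    · exact hflat _ _ (hfs i hi) (hfs j hj) h
  have hgg : ∀ i j, ¬ Tri B v (g i) (g j) := by
    intro i j h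
    by_cases hi : i = 1 <;> by_cases hj : j = 1
    · exact h.adj'.ne (by rw [hi, hj])
    · rw [hi, hg1] at h
      exact hboth _ (hgs j hj) h (htg j)
    · rw [hj, hg1] at h
      exact hboth _ (hgs i hi) h.right (htg i)
    · exact hflat _ _ (hgs i hi) (hgs j hj) h
  have hfg : ∀ i j, Tri B v (f i) (g j) ↔ i = 0 ∨ j = 1 := by
    intro i j
    constructor
    · intro h
      by_contra! hij
      exact hflat _ _ (hfs i hij.1) (hgs j hij.2) h
    · rintro (rfl | rfl)
      · rw [hf0]
        exact htg j
      · rw [hg1]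
        exact (htf i).right
  -- `σ` exchanges the two neighbours of `u'` other than `u`, or it does not
  have main : ∀ σ : Equiv.Perm (Fin 3), σ 1 = 1 → ∃ ι, IsLinkEmbedding B v ι ∧
      (∀ i, ι (f i) = mkNbr (.inl 0) i) ∧ ∀ j, ι (g j) = mkNbr (.inl 1) (σ j) := by
    intro σ hσ
    set ι : V → ZMod 8 ⊕ ZMod 8 := fun w => if ∃ i, f i = w then
      mkNbr (.inl 0) (Function.invFun f w) else mkNbr (.inl 1) (σ (Function.invFun g w)) with hι
    have hιf : ∀ i, ι (f i) = mkNbr (.inl 0) i := fun i => by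
      simp only [hι, if_pos (⟨i, rfl⟩ : ∃ j, f j = f i), Function.leftInverse_invFun hf i]
    have hιg : ∀ j, ι (g j) = mkNbr (.inl 1) (σ j) := fun j => by
      simp only [hι, if_neg (hgf j), Function.leftInverse_invFun hg j]
    have e0 : ∀ i j, ¬ moebiusKantor.Adj (mkNbr (.inl 0) i) (mkNbr (.inl 0) j) := by
      decide +kernel
    have e1 : ∀ i j, ¬ moebiusKantor.Adj (mkNbr (.inl 1) i) (mkNbr (.inl 1) j) := by
      decide +kernel
    have e2 : ∀ i j, moebiusKantor.Adj (mkNbr (.inl 0) i) (mkNbr (.inl 1) j) ↔ i = 0 ∨ j = 1 := by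
      decide +kernel
    have e3 : ∀ i j, mkNbr (.inl 0) i ≠ mkNbr (.inl 1) j := by decide +kernel
    have hσ1 : ∀ j, σ j = 1 ↔ j = 1 := fun j =>
      ⟨fun h => σ.injective (h.trans hσ.symm), fun h => by rw [h, hσ]⟩
    refine ⟨ι, ⟨fun w w' aw aw' e => ?_, fun w w' aw aw' => ?_⟩, hιf, hιg⟩
    · rcases hnbr w aw with ⟨i, rfl⟩ | ⟨i, rfl⟩ <;> rcases hnbr w' aw' with ⟨j, rfl⟩ | ⟨j, rfl⟩
      · rw [hιf, hιf] at e
        rw [mkNbr_injective _ _ _ e]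
      · rw [hιf, hιg] at e
        exact absurd e (e3 _ _)
      · rw [hιf, hιg] at e
        exact absurd e.symm (e3 _ _)
      · rw [hιg, hιg] at e
        rw [σ.injective (mkNbr_injective _ _ _ e)]
    · rcases hnbr w aw with ⟨i, rfl⟩ | ⟨i, rfl⟩ <;> rcases hnbr w' aw' with ⟨j, rfl⟩ | ⟨j, rfl⟩
      · rw [hιf, hιf]
        exact iff_of_false (hff i j) (e0 i j)
      · rw [hιf, hιg, hfg, e2, hσ1]
      · rw [hιf, hιg]
        exact (⟨Tri.right, Tri.right⟩ : Tri B v (g i) (f j) ↔ Tri B v (f j) (g i)).trans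
          (by rw [hfg, SimpleGraph.adj_comm, e2, hσ1])
      · rw [hιg, hιg]
        exact iff_of_false (hgg i j) (e1 _ _)
  have htog : mkRho (mkNbr (.inl 1) 2) (mkNbr (.inl 0) 1) =
      mkRho (mkNbr (.inl 1) 0) (mkNbr (.inl 0) 1) + 1 := by
    rw [mkRho_symm, mkRho_symm (mkNbr (.inl 1) 0)]
    exact mkRho_toggle (c := .inl 0) (b := .inl 1) (by decide) (by decide) (by decide) (by decide)
      (by decide) (by decide) (by decide) (by decide)
  refine ⟨g 0, f 1, (htg 0).right, htf 1, fun e => absurd (hg (e.trans hg1.symm)) (by decide),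
    fun e => absurd (hf (e.trans hf0.symm)) (by decide), fun ε => ?_⟩
  by_cases hε : mkRho (mkNbr (.inl 1) 0) (mkNbr (.inl 0) 1) = ε
  · obtain ⟨ι, h1, h2, h3⟩ := main 1 rfl
    exact ⟨ι, h1, by rw [h2, h3]; exact hε⟩
  · obtain ⟨ι, h1, h2, h3⟩ := main (Equiv.swap 0 2) (by decide)
    refine ⟨ι, h1, ?_⟩
    rw [h2, h3, Equiv.swap_apply_left, htog]
    have key : ∀ a b : ZMod 2, a ≠ b → a + 1 = b := by decide
    exact key _ _ hε

/-- The link of a vertex `v` of level `n` can be embedded in the Moebius-Kantor graph in such a way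
that the parity of the triangle formed by `v` and two vertices of the preceding level, if there is
one, is the prescribed one. -/
lemma exists_embedding (hB : IsGood B x n ℓ) (p : Finset V → ZMod 2) {v : V}
    (hv : IsSphere B n ℓ v) : ∃ ι, IsLinkEmbedding B v ι ∧
      ∀ u₁ u₂, Tri B v u₁ u₂ → ℓ u₁ + 1 = n → ℓ u₂ + 1 = n →
        ∃ u u' w y z, ({v, u₁, u₂} : Finset V) = {v, u, u'} ∧ IsTwoTriangle B v u u' w y z ∧
          ℓ u + 1 = n ∧ ℓ u' + 1 = n ∧
          mkRho (ι y) (ι z) + rho B u z w + rho B u' w y = p {v, u₁, u₂} := by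
  have h2 := hv.2
  by_cases hvx : v = x
  · subst hvx
    rw [hB.level_base] at h2
    have no : ∀ u, ¬ (skeleton B).Adj v u := by
      intro u a
      have h3 := ExtData.level_le' hB (adj_mem_right a)
      exact a.ne ((hB.level_eq_zero u (adj_mem_right a)).1 (by omega)).symm
    exact ⟨fun _ => .inl 0, ⟨fun u u' a => absurd a (no u), fun u u' a => absurd a (no u)⟩,
      fun u₁ u₂ t => absurd t.adj (no u₁)⟩
  · obtain ⟨u, a, hu⟩ := hB.down_exists v hv.1 hvx
    rw [h2] at hu
    by_cases huniq : ∀ u', (skeleton B).Adj v u' → ℓ u' + 1 = n → u' = u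
    · obtain ⟨ι, hι⟩ := hB.exists_embedding_star hv a hu huniq
      refine ⟨ι, hι, fun u₁ u₂ t h h' => ?_⟩
      exact absurd ((huniq _ t.adj h).trans (huniq _ t.right.adj h').symm) t.adj'.ne
    · push Not at huniq
      obtain ⟨u', a', hu', hne⟩ := huniq
      have t := hB.down_tri v u u' a a' (by omega) (by omega) hne.symm
      obtain ⟨y, z, hy, hz, hyu, hzu, hε⟩ := hB.exists_embedding_edge hv t hu hu'
      obtain ⟨w, hwv, tw⟩ :=
        (hB.hasMKLink_of_lt (adj_mem_right a) (by omega)).exists_other t.rot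
      have T : IsTwoTriangle B v u u' w y z := ⟨t, tw.rot.rot, hy, hz, hwv, hyu, hzu⟩
      obtain ⟨ι, hι, e⟩ := hε (p {v, u, u'} - rho B u z w - rho B u' w y)
      refine ⟨ι, hι, fun u₁ u₂ t' h h' => ?_⟩
      have hset : ({v, u₁, u₂} : Finset V) = {v, u, u'} := by
        have key : ∀ s, (skeleton B).Adj v s → ℓ s + 1 = n → s = u ∨ s = u' := by
          intro s as hs
          rcases hB.down_two v u u' s a a' as (by omega) (by omega) (by omega) with h | h | h
          · exact absurd h hne.symm
          · exact Or.inl h.symm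
          · exact Or.inr h.symm
        rcases key _ t'.adj h with rfl | rfl <;> rcases key _ t'.right.adj h' with rfl | rfl
        · exact absurd rfl t'.adj'.ne
        · rfl
        · rw [Finset.pair_comm]
        · exact absurd rfl t'.adj'.ne
      refine ⟨u, u', w, y, z, hset, T, hu, hu', ?_⟩
      rw [hset, e]
      ring

end IsGood
end Embedding

/-! ### Extension of a good ball with prescribed parities -/

section Step

variable {V : Type*} [DecidableEq V] {B : PreAbstractSimplicialComplex V}

/-- A symmetric function is the symmetrization of some function, off the diagonal. -/
lemma exists_add_swap_eq {V A : Type*} [AddMonoid A] (t : V → V → A) (ht : ∀ v w, t v w = t w v) :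
    ∃ s : V → V → A, ∀ v w, v ≠ w → s v w + s w v = t v w := by
  classical
  refine ⟨fun v w => if WellOrderingRel v w then t v w else 0, fun v w hvw => ?_⟩
  rcases trichotomous_of WellOrderingRel v w with h | h | h
  · simp only [if_pos h, if_neg (asymm h), add_zero]
  · exact absurd h hvw
  · simp only [if_pos h, if_neg (asymm h), zero_add, ht w v]

namespace IsGood

variable {x : V} {n : ℕ} {ℓ : V → ℕ}

/-- A triangle meeting the sphere of radius `n` has either one vertex on it, or two. -/
lemma triangle_cases (hB : IsGood B x n ℓ) {f : Finset V} (hf : f ∈ sphereTriangles B x n) :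
    ∃ v a b, f = {v, a, b} ∧ Tri B v a b ∧ IsSphere B n ℓ v ∧ ℓ a + 1 = n ∧
      (ℓ b + 1 = n ∨ IsSphere B n ℓ b) := by
  obtain ⟨⟨hfn, hc⟩, hfn'⟩ := hf
  rw [hB.mem_ball_iff] at hfn
  have hex : ∃ v ∈ f, IsSphere B n ℓ v := by
    by_contra! h
    refine hfn' ⟨hB.mem_ball_iff.2 ⟨hfn.1, fun v hv => ?_⟩, hc⟩
    have h1 := hfn.2 v hv
    have h2 : ℓ v ≠ n := fun e => h v hv ⟨mem_vertices_of_mem hfn.1 hv, e⟩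
    omega
  obtain ⟨v, hvf, hv⟩ := hex
  obtain ⟨a, b, hab, he⟩ := Finset.card_eq_two.1
    (show (f.erase v).card = 2 by rw [Finset.card_erase_of_mem hvf, hc])
  have hfe : f = {v, a, b} := by rw [← he, Finset.insert_erase hvf]
  have ht : Tri B v a b := by
    rw [hfe] at hfn hc
    exact ⟨hfn.1, hc⟩
  rcases hB.adj_sphere hv ht.adj with ha | ha
  · exact ⟨v, a, b, hfe, ht, hv, ha, hB.adj_sphere hv ht.right.adj⟩
  · refine ⟨v, b, a, by rw [hfe, Finset.pair_comm], ht.right, hv, ?_, Or.inr ha⟩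
    refine (hB.adj_sphere hv ht.right.adj).resolve_right fun hb => ?_
    exact hB.no_flat _ _ _ ht (hv.2.trans ha.2.symm) (ha.2.trans hb.2.symm)

/-- A good ball of radius `n` can be extended to a good ball of radius `n + 1` in such a way that
the triangles of the sphere of radius `n` have any prescribed parities. -/
theorem exists_extend_parity [Infinite V] (hB : IsGood B x n ℓ) (p : Finset V → ZMod 2) :
    ∃ (B' : PreAbstractSimplicialComplex V) (ℓ' : V → ℕ), IsGood B' x (n + 1 : ℕ) ℓ' ∧
      ball B' x n = B ∧ ∀ f ∈ sphereTriangles B x n, HasParity B' f (p f) := by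
  classical
  have hι : ∀ v, ∃ ι : V → ZMod 8 ⊕ ZMod 8, IsSphere B n ℓ v → IsLinkEmbedding B v ι ∧
      ∀ u₁ u₂, Tri B v u₁ u₂ → ℓ u₁ + 1 = n → ℓ u₂ + 1 = n →
        ∃ u u' w y z, ({v, u₁, u₂} : Finset V) = {v, u, u'} ∧ IsTwoTriangle B v u u' w y z ∧
          ℓ u + 1 = n ∧ ℓ u' + 1 = n ∧
          mkRho (ι y) (ι z) + rho B u z w + rho B u' w y = p {v, u₁, u₂} := by
    intro v
    by_cases hv : IsSphere B n ℓ v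
    · obtain ⟨ι, h⟩ := hB.exists_embedding p hv
      exact ⟨ι, fun _ => h⟩
    · exact ⟨fun _ => .inl 0, fun h => absurd h hv⟩
  choose ι hι hA using hι
  have L : LinkEmbedding B n ℓ ι := ⟨fun v hv => (hι v hv).inj, fun v hv => (hι v hv).tri⟩
  -- `d v v'` is below the edge `v v'`, and `y v v'` is a corner opposite to `v'` of a 2-triangle
  have hdy : ∀ v v', ∃ d y, IsSphere B n ℓ v → IsSphere B n ℓ v' → (skeleton B).Adj v v' →
      Tri B v v' d ∧ ℓ d + 1 = n ∧ y ≠ v' ∧ Tri B d v y := by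
    intro v v'
    by_cases h : IsSphere B n ℓ v ∧ IsSphere B n ℓ v' ∧ (skeleton B).Adj v v'
    · obtain ⟨hv, hv', a⟩ := h
      obtain ⟨d, t, g⟩ := hB.same_exists v v' a (hv.2.trans hv'.2.symm)
      have h2 := hv.2
      obtain ⟨y, hy, ty⟩ :=
        (hB.hasMKLink_of_lt (adj_mem_right t.adj') (by omega)).exists_other t.rot.rot
      exact ⟨d, y, fun _ _ _ => ⟨t, by omega, hy, ty⟩⟩
    · exact ⟨v, v, fun h1 h2 h3 => absurd ⟨h1, h2, h3⟩ h⟩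
  choose d y hdy using hdy
  have hdsymm : ∀ {v v'}, IsSphere B n ℓ v → IsSphere B n ℓ v' → (skeleton B).Adj v v' →
      d v' v = d v v' := by
    intro v v' hv hv' a
    obtain ⟨t, g, -, -⟩ := hdy v v' hv hv' a
    obtain ⟨t', g', -, -⟩ := hdy v' v hv' hv a.symm
    have h2 := hv.2
    exact hB.same_unique v v' _ _ t'.left t (hv.2.trans hv'.2.symm) (by omega) (by omega)
  have hMd : ∀ {v v'}, IsSphere B n ℓ v → IsSphere B n ℓ v' → (skeleton B).Adj v v' →
      HasMKLink B (d v v') := by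
    intro v v' hv hv' a
    obtain ⟨t, g, -, -⟩ := hdy v v' hv hv' a
    exact hB.hasMKLink_of_lt (adj_mem_right t.adj') (by omega)
  -- the discrepancy `t` to be corrected on the edge `v v'`, distributed over `v` and `v'`
  obtain ⟨s, hs⟩ : ∃ s : V → V → ZMod 2, ∀ v v', IsSphere B n ℓ v → IsSphere B n ℓ v' →
      (skeleton B).Adj v v' →
      s v v' + s v' v = p {d v v', v, v'} + rho B (d v v') (y v' v) (y v v') := by
    obtain ⟨s, hs⟩ := exists_add_swap_eq
      (fun v v' => if IsSphere B n ℓ v ∧ IsSphere B n ℓ v' ∧ (skeleton B).Adj v v' then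
        p {d v v', v, v'} + rho B (d v v') (y v' v) (y v v') else 0) (by
      intro v v'
      by_cases h : IsSphere B n ℓ v ∧ IsSphere B n ℓ v' ∧ (skeleton B).Adj v v'
      · obtain ⟨hv, hv', a⟩ := h
        rw [if_pos ⟨hv, hv', a⟩, if_pos ⟨hv', hv, a.symm⟩, hdsymm hv hv' a, Finset.pair_comm v v',
          rho_symm (hMd hv hv' a) ?_ (hdy v v' hv hv' a).2.2.2.right.adj]
        rw [← hdsymm hv hv' a]
        exact (hdy v' v hv' hv a.symm).2.2.2.right.adj
      · rw [if_neg h, if_neg fun h' => h ⟨h'.2.1, h'.1, h'.2.2.symm⟩])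
    refine ⟨s, fun v v' hv hv' a => ?_⟩
    rw [hs v v' a.ne, if_pos ⟨hv, hv', a⟩]
  set lab : V → ZMod 8 ⊕ ZMod 8 → ZMod 2 ⊕ (ZMod 8 ⊕ ZMod 8) := fun v m =>
    if h : ∃ v', IsSphere B n ℓ v' ∧ (skeleton B).Adj v v' ∧ moebiusKantor.Adj (ι v v') m then
      .inl (mkRho (ι v (y v h.choose)) m + s v h.choose) else .inr m with hlab
  have hlab1 : ∀ {v v' m}, IsSphere B n ℓ v → IsSphere B n ℓ v' → (skeleton B).Adj v v' →
      IsNew B ι v m → moebiusKantor.Adj (ι v v') m →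
      lab v m = .inl (mkRho (ι v (y v v')) m + s v v') := by
    intro v v' m hv hv' a hm h
    have hex : ∃ v', IsSphere B n ℓ v' ∧ (skeleton B).Adj v v' ∧ moebiusKantor.Adj (ι v v') m :=
      ⟨v', hv', a, h⟩
    have e := L.downSet_unique hB hv hex.choose_spec.1 hv' hm hex.choose_spec.2.1 a
      hex.choose_spec.2.2 h
    simp only [hlab, dif_pos hex, e]
  -- adjacencies in the Moebius-Kantor graph around the edge from `d v v'` to `v'`
  have hpath : ∀ {v v'}, IsSphere B n ℓ v → IsSphere B n ℓ v' → (skeleton B).Adj v v' →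
      moebiusKantor.Adj (ι v (y v v')) (ι v (d v v')) ∧
      moebiusKantor.Adj (ι v (d v v')) (ι v v') ∧ ι v (y v v') ≠ ι v v' := by
    intro v v' hv hv' a
    obtain ⟨t, g, hy, ty⟩ := hdy v v' hv hv' a
    exact ⟨(L.tri v hv _ _ ty.adj' t.right.adj).1 ty.rot,
      (L.tri v hv _ _ t.right.adj a).1 t.right, fun e => hy (L.inj v hv _ _ ty.adj' a e)⟩
  have htog : ∀ {v v' m m'}, IsSphere B n ℓ v → IsSphere B n ℓ v' → (skeleton B).Adj v v' →
      IsNew B ι v m → IsNew B ι v m' → moebiusKantor.Adj (ι v v') m →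
      moebiusKantor.Adj (ι v v') m' → m ≠ m' →
      mkRho (ι v (y v v')) m' = mkRho (ι v (y v v')) m + 1 := by
    intro v v' m m' hv hv' a hm hm' h h' hne
    obtain ⟨h1, h2, h3⟩ := hpath hv hv' a
    have hd := (hdy v v' hv hv' a).1.right.adj
    exact mkRho_toggle h1 h2 h h' h3 (hm _ hd).symm (hm' _ hd).symm hne
  have hlabne : ∀ a b : ZMod 2, a + 1 = b → a ≠ b := by decide
  have htwo : ∀ {v v'}, IsSphere B n ℓ v → IsSphere B n ℓ v' → (skeleton B).Adj v v' →
      ∃ m m', m ≠ m' ∧ IsNew B ι v m ∧ IsNew B ι v m' ∧ moebiusKantor.Adj (ι v v') m ∧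
        moebiusKantor.Adj (ι v v') m' := by
    intro v v' hv hv' a
    obtain ⟨t, g, -, -⟩ := hdy v v' hv hv' a
    have new : ∀ m, moebiusKantor.Adj (ι v v') m → m ≠ ι v (d v v') → IsNew B ι v m := by
      rintro m hm hne w aw rfl
      have tw := (L.tri v hv _ _ a aw).2 hm
      rcases hB.adj_sphere hv aw with h | h
      · have h2 := hv.2
        rw [hB.same_unique v v' w _ tw t (hv.2.trans hv'.2.symm) (by omega) (by omega)] at hne
        exact hne rfl
      · exact hB.no_flat _ _ _ tw (hv.2.trans hv'.2.symm) (hv'.2.trans h.2.symm)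
    obtain ⟨i, hi⟩ := (mk_adj_iff _ _).1 (hpath hv hv' a).2.1.symm
    have key : ∀ i : Fin 3, ∃ j k : Fin 3, j ≠ i ∧ k ≠ i ∧ j ≠ k := by decide
    obtain ⟨j, k, hj, hk, hjk⟩ := key i
    have adjm : ∀ j, moebiusKantor.Adj (ι v v') (mkNbr (ι v v') j) := fun j =>
      (mk_adj_iff _ _).2 ⟨j, rfl⟩
    exact ⟨mkNbr (ι v v') j, mkNbr (ι v v') k, fun e => hjk (mkNbr_injective _ _ _ e),
      new _ (adjm j) fun e => hj (mkNbr_injective _ _ _ (e.trans hi.symm)),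
      new _ (adjm k) fun e => hk (mkNbr_injective _ _ _ (e.trans hi.symm)), adjm j, adjm k⟩
  have D : LabelData B n ℓ ι lab := by
    refine ⟨L, fun v hv m m' hm hm' e hadj => ?_, fun v v' m hv hv' a hm h => ?_⟩
    · by_cases hex : ∃ v', IsSphere B n ℓ v' ∧ (skeleton B).Adj v v' ∧
        moebiusKantor.Adj (ι v v') m
      · obtain ⟨v', hv', a, h⟩ := hex
        have h' := (hadj v' hv' a).1 h
        by_contra hne
        rw [hlab1 hv hv' a hm h, hlab1 hv hv' a hm' h', Sum.inl.injEq, add_left_inj] at e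
        exact hlabne _ _ (htog hv hv' a hm hm' h h' hne).symm e
      · have hex' : ¬ ∃ v', IsSphere B n ℓ v' ∧ (skeleton B).Adj v v' ∧
            moebiusKantor.Adj (ι v v') m' := by
          rintro ⟨v', hv', a, h⟩
          exact hex ⟨v', hv', a, (hadj v' hv' a).2 h⟩
        simp only [hlab, dif_neg hex, dif_neg hex', Sum.inr.injEq] at e
        exact e
    · obtain ⟨m₁, m₂, hne, h1, h2, h3, h4⟩ := htwo hv' hv a.symm
      have e := htog hv' hv a.symm h1 h2 h3 h4 hne
      rw [hlab1 hv hv' a hm h]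
      have key : ∀ a b c : ZMod 2, a + c = b ∨ a + 1 + c = b := by decide
      rcases key (mkRho (ι v' (y v' v)) m₁) (mkRho (ι v (y v v')) m + s v v') (s v' v) with q | q
      · exact ⟨m₁, h1, h3, by rw [hlab1 hv' hv a.symm h1 h3, q]⟩
      · exact ⟨m₂, h2, h4, by rw [hlab1 hv' hv a.symm h2 h4, e, q]⟩
  obtain ⟨φ, μ, E, hφ, hμ⟩ := D.exists_extData hB
  have hG := E.isGood_extend hB
  have hMS : ∀ {v}, IsSphere B n ℓ v → HasMKLink (extend B (IsSphere B n ℓ) φ) v :=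
    fun hv => ⟨_, E.isChart hv⟩
  have hMI : ∀ {v}, v ∈ vertices B → ℓ v + 1 = n → HasMKLink (extend B (IsSphere B n ℓ) φ) v := by
    intro v hv h
    exact (hB.hasMKLink_of_lt hv (by omega)).transfer
      (fun u => E.adj_interior_iff hB hv (by omega)) fun a b => E.tri_interior_iff hB hv (by omega)
  have hrho : ∀ {u}, u ∈ vertices B → ℓ u + 1 = n → ∀ a b,
      rho (extend B (IsSphere B n ℓ) φ) u a b = rho B u a b := fun hu h a b =>
    rho_congr fun _ _ => E.tri_interior_iff hB hu (by omega)
  refine ⟨_, _, hG, E.ball_extend hB, fun f hf => ?_⟩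
  obtain ⟨v, a, b, rfl, t, hv, ha, hb | hb⟩ := hB.triangle_cases hf
  · obtain ⟨u, u', w, q, r, hset, T, hu, hu', e⟩ := hA v hv a b t ha hb
    have T' : IsTwoTriangle (extend B (IsSphere B n ℓ) φ) v u u' w q r :=
      ⟨ExtData.tri_extend_of_tri T.center, ExtData.tri_extend_of_tri T.hx,
        ExtData.tri_extend_of_tri T.hy, ExtData.tri_extend_of_tri T.hz, T.x_ne, T.y_ne, T.z_ne⟩
    have huB := adj_mem_right T.center.adj
    have huB' := adj_mem_right T.center.adj'
    have h := T'.hasParity (hMS hv) (hMI huB hu) (hMI huB' hu')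
    have e2 := (E.isChart hv).rho_eq (ι v q) (ι v r)
    rw [hφ v hv q T.hy.adj, hφ v hv r T.hz.right.adj] at e2
    rw [paritySum, hrho huB hu, hrho huB' hu', e2, e, ← hset] at h
    exact h
  · have av := t.right.adj
    obtain ⟨td, gd, hy1, ty1⟩ := hdy v b hv hb av
    obtain ⟨-, -, hy2, ty2⟩ := hdy b v hb hv av.symm
    have h2 := hv.2
    obtain rfl : a = d v b := hB.same_unique v b _ _ t.right td (hv.2.trans hb.2.symm)
      (by omega) (by omega)
    rw [hdsymm hv hb av] at ty2
    obtain ⟨m, -, -, hm, -, hmadj, -⟩ := htwo hv hb av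
    obtain ⟨hwB, hwμ⟩ := hμ v hv m hm
    have tw : Tri (extend B (IsSphere B n ℓ) φ) v b (φ v m) :=
      E.tri_of_chartAdj hv ⟨ι v b, m, hmadj, hφ v hv b av, rfl⟩
    obtain ⟨m', hm'⟩ := (E.adj_sphere_iff hb).1 tw.adj'
    have hm'new : IsNew B ι b m' := by
      rintro u au rfl
      rw [hφ b hb u au] at hm'
      exact hwB (hm' ▸ adj_mem_right au)
    have hm'adj : moebiusKantor.Adj (ι b v) m' := by
      rw [← (E.isChart hb).tri_iff, hφ b hb v av.symm, hm']
      exact tw.left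
    have hlabeq : lab v m = lab b m' := by
      rw [← hwμ, ← (hμ b hb m' hm'new).2, hm']
    rw [hlab1 hv hb av hm hmadj, hlab1 hb hv av.symm hm'new hm'adj, Sum.inl.injEq] at hlabeq
    have T : IsTwoTriangle (extend B (IsSphere B n ℓ) φ) (d v b) v b (φ v m) (y b v) (y v b) :=
      ⟨ExtData.tri_extend_of_tri t.left, tw.rot.rot, ExtData.tri_extend_of_tri ty2.right,
        ExtData.tri_extend_of_tri ty1, fun e => hwB (e ▸ adj_mem_right t.adj), hy2, hy1⟩
    have h := T.hasParity (hMI (adj_mem_right t.adj) ha) (hMS hv) (hMS hb)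
    have e1 := (E.isChart hv).rho_eq (ι v (y v b)) m
    rw [hφ v hv _ ty1.adj'] at e1
    have e2 := (E.isChart hb).rho_eq m' (ι b (y b v))
    rw [hφ b hb _ ty2.adj', hm', mkRho_symm] at e2
    rw [paritySum, hrho (adj_mem_right t.adj) ha, e1, e2] at h
    have hset : ({v, d v b, b} : Finset V) = {d v b, v, b} := Finset.insert_comm _ _ _
    rw [hset]
    have key : ∀ r c c' s s' q : ZMod 2, c + s = c' + s' → s + s' = q + r → r + c + c' = q := by
      decide
    rwa [key _ _ _ _ _ _ hlabeq (hs v b hv hb av)] at h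

end IsGood
end Step

/-! ### Free constructions -/

section Free

variable {V : Type*} [DecidableEq V] {X Y : PreAbstractSimplicialComplex V}

namespace IsGood

variable {x : V} {n : ℕ} {ℓ : V → ℕ}

lemma sphereTriangles_ball (h : IsGood X x ⊤ ℓ) (n : ℕ) :
    sphereTriangles (ball X x n) x n = sphereTriangles X x n := by
  rw [sphereTriangles, h.ball_ball le_top le_rfl, h.ball_ball le_top (Nat.sub_le n 1),
    sphereTriangles]

lemma mem_triangles_ball_iff (h : IsGood X x ⊤ ℓ) {f : Finset V} {n : ℕ} :
    f ∈ triangles (ball X x n) ↔ f ∈ triangles X ∧ ∀ v ∈ f, ℓ v ≤ n := by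
  change _ ∧ _ ↔ (_ ∧ _) ∧ _
  rw [h.mem_ball_iff]
  tauto

/-- Every triangle belongs to some sphere. -/
lemma exists_mem_sphereTriangles (h : IsGood X x ⊤ ℓ) {f : Finset V} (hf : f ∈ triangles X) :
    ∃ n, f ∈ sphereTriangles X x n := by
  classical
  have hex : ∃ n, f ∈ triangles (ball X x n) :=
    ⟨f.sup ℓ, h.mem_triangles_ball_iff.2 ⟨hf, fun v hv => Finset.le_sup hv⟩⟩
  refine ⟨Nat.find hex, Nat.find_spec hex, Nat.find_min hex ?_⟩
  have hpos : Nat.find hex ≠ 0 := by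
    intro e
    have h0 := Nat.find_spec hex
    rw [e, h.mem_triangles_ball_iff] at h0
    have hsub : f ⊆ {x} := fun v hv => Finset.mem_singleton.2
      ((h.level_eq_zero v (mem_vertices_of_mem hf.1 hv)).1 (Nat.le_zero.1 (h0.2 v hv)))
    have h1 := Finset.card_le_card hsub
    rw [hf.2, Finset.card_singleton] at h1
    omega
  omega

/-- The free construction: a good ball can be extended ball by ball, where at each step the
parities of the triangles on the sphere are prescribed in terms of the ball obtained so far. -/
theorem exists_free [Infinite V] {B : PreAbstractSimplicialComplex V} {m : ℕ}
    (hB : IsGood B x m ℓ) (P : ℕ → PreAbstractSimplicialComplex V → Finset V → ZMod 2) :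
    ∃ (Y : PreAbstractSimplicialComplex V) (ℓ' : V → ℕ), IsGood Y x ⊤ ℓ' ∧ ball Y x m = B ∧
      ∀ n, m ≤ n → ∀ f ∈ sphereTriangles Y x n, HasParity Y f (P n (ball Y x n) f) := by
  obtain ⟨a, ha0, ha, haR⟩ := exists_seq
    (good := fun n (C : PreAbstractSimplicialComplex V) => ∃ ℓ, IsGood C x n ℓ)
    (R := fun n C C' => ball C' x n = C ∧ ∀ f ∈ sphereTriangles C x n, HasParity C' f (P n C f))
    (m := m) ⟨ℓ, hB⟩ (fun n _ C hC => by
      obtain ⟨ℓ, hC⟩ := hC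
      obtain ⟨C', ℓ', h1, h2, h3⟩ := hC.exists_extend_parity (P n C)
      exact ⟨C', ⟨ℓ', h1⟩, h2, h3⟩)
  obtain ⟨ℓ', hG, hb⟩ := exists_limit ha fun k => (haR k).1
  refine ⟨union a, ℓ', hG, (hb 0).trans ha0, fun n hn f hf => ?_⟩
  obtain ⟨k, rfl⟩ := Nat.exists_eq_add_of_le hn
  have hf' := hG.mem_triangles_ball_iff.1 hf.1
  refine hG.hasParity_of_ball (n := m + k)
    (fun v hv => ⟨mem_vertices_of_mem hf'.1.1 hv, hf'.2 v hv⟩) ?_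
  rw [← hG.sphereTriangles_ball, hb k] at hf
  rw [add_assoc, hb (k + 1), hb k]
  exact (haR k).2 f hf

/-- The complex does not end: above every vertex there is a vertex of the next level. -/
lemma exists_up (h : IsGood X x ⊤ ℓ) {v : V} (hv : v ∈ vertices X) :
    ∃ w ∈ vertices X, ℓ w = ℓ v + 1 := by
  have hM : ∀ u ∈ vertices X, HasMKLink X u := fun u hu =>
    h.hasMKLink u hu (ENat.natCast_lt_top _)
  by_cases hvx : v = x
  · subst hvx
    obtain ⟨φ, hφ⟩ := hM v hv
    have a : (skeleton X).Adj v (φ (.inl 0)) := (hφ.adj_iff _).2 ⟨_, rfl⟩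
    have h1 := h.level_adj _ _ a.symm
    have h2 := h.level_base
    have h3 : ℓ (φ (.inl 0)) ≠ 0 := fun e =>
      a.ne ((h.level_eq_zero _ (adj_mem_right a)).1 e).symm
    exact ⟨_, adj_mem_right a, by omega⟩
  · obtain ⟨d, a, g⟩ := h.down_exists v hv hvx
    obtain ⟨e, te, he⟩ : ∃ e, Tri X v d e ∧ ℓ e = ℓ v := by
      obtain ⟨b, tb⟩ := (hM v hv).exists_tri a
      obtain ⟨b', hb', tb'⟩ := (hM v hv).exists_other tb
      have h1 := h.level_adj _ _ tb.right.adj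
      have h2 := h.level_adj _ _ tb.adj'.symm
      have h3 := h.level_adj _ _ tb'.right.adj
      have h4 := h.level_adj _ _ tb'.adj'.symm
      by_cases e1 : ℓ b = ℓ v
      · exact ⟨b, tb, e1⟩
      by_cases e2 : ℓ b' = ℓ v
      · exact ⟨b', tb', e2⟩
      rcases h.down_two v d b b' a tb.right.adj tb'.right.adj g (by omega) (by omega) with q | q | q
      · exact absurd q tb.adj'.ne
      · exact absurd q tb'.adj'.ne
      · exact absurd q.symm hb'
    obtain ⟨c, hc, tc⟩ := (hM v hv).exists_other te.right
    have h1 := h.level_adj _ _ tc.right.adj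
    have h2 := h.level_adj _ _ tc.right.adj.symm
    refine ⟨c, adj_mem_right tc.adj', ?_⟩
    have h3 : ℓ c ≠ ℓ v := fun q => h.no_flat _ _ _ tc he.symm (he.trans q.symm)
    have h4 : ℓ c + 1 ≠ ℓ v := fun q => hc (h.same_unique v e c d tc te.right he.symm q g)
    omega

lemma sphereTriangles_nonempty (h : IsGood X x ⊤ ℓ) (n : ℕ) :
    (sphereTriangles X x (n + 1)).Nonempty := by
  have hex : ∀ k, ∃ v ∈ vertices X, ℓ v = k := by
    intro k
    induction k with
    | zero => exact ⟨x, h.base_mem, h.level_base⟩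
    | succ k ih =>
      obtain ⟨v, hv, e⟩ := ih
      obtain ⟨w, hw, e'⟩ := h.exists_up hv
      exact ⟨w, hw, by omega⟩
  obtain ⟨v, hv, e⟩ := hex (n + 1)
  have hvx : v ≠ x := by
    rintro rfl
    rw [h.level_base] at e
    omega
  obtain ⟨d, a, g⟩ := h.down_exists v hv hvx
  obtain ⟨b, t⟩ := (h.hasMKLink v hv (ENat.natCast_lt_top _)).exists_tri a
  have h1 := h.level_adj _ _ t.adj'.symm
  refine ⟨{v, d, b}, h.mem_triangles_ball_iff.2 ⟨t, ?_⟩, fun hf => ?_⟩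
  · simp only [Finset.mem_insert, Finset.mem_singleton, forall_eq_or_imp, forall_eq]
    omega
  · have := (h.mem_triangles_ball_iff.1 hf).2 v (by simp)
    omega

lemma countable_vertices (h : IsGood X x ⊤ ℓ) : (vertices X).Countable := by
  refine (Set.countable_iUnion fun k : ℕ => (h.finite k).countable).mono fun v hv => ?_
  exact Set.mem_iUnion.2 ⟨ℓ v, hv, le_rfl⟩

end IsGood

/-! ### Invariance under isomorphisms -/

/-- `g` and `g'` are mutually inverse isomorphisms between `X` and `Y`. -/
structure IsIso (X Y : PreAbstractSimplicialComplex V) (g g' : V → V) : Prop where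
  vert : ∀ v ∈ vertices X, g v ∈ vertices Y
  vert' : ∀ v ∈ vertices Y, g' v ∈ vertices X
  left_inv : ∀ v ∈ vertices X, g' (g v) = v
  right_inv : ∀ v ∈ vertices Y, g (g' v) = v
  image_mem : ∀ s ∈ X, s.image g ∈ Y
  image_mem' : ∀ s ∈ Y, s.image g' ∈ X

lemma map_symm_map {α β : Type*} (e : α ≃ β) (s : Finset β) :
    (s.map e.symm.toEmbedding).map e.toEmbedding = s := by
  ext y
  simp

omit [DecidableEq V] in
lemma AreIsomorphic.refl (X : PreAbstractSimplicialComplex V) : AreIsomorphic X X :=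
  ⟨Equiv.refl _, fun s => by simp⟩

omit [DecidableEq V] in
lemma AreIsomorphic.symm (h : AreIsomorphic X Y) : AreIsomorphic Y X := by
  obtain ⟨e, h⟩ := h
  refine ⟨e.symm, fun s => ?_⟩
  have := h (s.map e.symm.toEmbedding)
  rw [map_symm_map] at this
  exact this.symm

omit [DecidableEq V] in
lemma AreIsomorphic.trans {Z : PreAbstractSimplicialComplex V} (h : AreIsomorphic X Y)
    (h' : AreIsomorphic Y Z) : AreIsomorphic X Z := by
  obtain ⟨e, h⟩ := h
  obtain ⟨e', h'⟩ := h'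
  refine ⟨e.trans e', fun s => ?_⟩
  have e1 : s.map (e.trans e').toEmbedding = (s.map e.toEmbedding).map e'.toEmbedding :=
    (Finset.map_map e.toEmbedding e'.toEmbedding s).symm
  rw [h s, h' (s.map e.toEmbedding), e1]

lemma AreIsomorphic.exists_isIso (h : AreIsomorphic X Y) : ∃ g g', IsIso X Y g g' := by
  classical
  obtain ⟨e, h⟩ := h
  set g : V → V := fun v => if hv : v ∈ vertices X then e ⟨v, hv⟩ else v with hg
  set g' : V → V := fun v => if hv : v ∈ vertices Y then e.symm ⟨v, hv⟩ else v with hg'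
  have hgv : ∀ v : vertices X, g v = e v := fun v => dif_pos v.2
  have hgv' : ∀ v : vertices Y, g' v = e.symm v := fun v => dif_pos v.2
  refine ⟨g, g', fun v hv => ?_, fun v hv => ?_, fun v hv => ?_, fun v hv => ?_, fun s hs => ?_,
    fun s hs => ?_⟩
  · rw [hgv ⟨v, hv⟩]
    exact (e _).2
  · rw [hgv' ⟨v, hv⟩]
    exact (e.symm _).2
  · rw [hgv ⟨v, hv⟩, hgv', e.symm_apply_apply]
  · rw [hgv' ⟨v, hv⟩, hgv, e.apply_symm_apply]
  · have e1 : (s.subtype (· ∈ vertices X)).map (Function.Embedding.subtype _) = s :=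
      Finset.subtype_map_of_mem fun v hv => mem_vertices_of_mem hs hv
    have h1 := (h (s.subtype (· ∈ vertices X))).1 (by rw [e1]; exact hs)
    convert h1 using 1
    conv_lhs => rw [← e1]
    rw [Finset.map_map, Finset.map_eq_image, Finset.map_eq_image, Finset.image_image]
    exact Finset.image_congr fun v _ => hgv v
  · have e1 : (s.subtype (· ∈ vertices Y)).map (Function.Embedding.subtype _) = s :=
      Finset.subtype_map_of_mem fun v hv => mem_vertices_of_mem hs hv
    have h1 := (h ((s.subtype (· ∈ vertices Y)).map e.symm.toEmbedding)).2 (by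
      rw [map_symm_map, e1]
      exact hs)
    convert h1 using 1
    conv_lhs => rw [← e1]
    rw [Finset.map_map, Finset.map_eq_image, Finset.map_eq_image, Finset.image_image]
    exact Finset.image_congr fun v _ => hgv' v

namespace IsIso

variable {g g' : V → V}

lemma symm (h : IsIso X Y g g') : IsIso Y X g' g :=
  ⟨h.vert', h.vert, h.right_inv, h.left_inv, h.image_mem', h.image_mem⟩

lemma injOn (h : IsIso X Y g g') {u v : V} (hu : u ∈ vertices X) (hv : v ∈ vertices X)
    (e : g u = g v) : u = v := by
  rw [← h.left_inv u hu, e, h.left_inv v hv]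

lemma adj (h : IsIso X Y g g') {u v : V} (a : (skeleton X).Adj u v) :
    (skeleton Y).Adj (g u) (g v) := by
  refine ⟨fun e => a.ne (h.injOn (adj_mem_left a) (adj_mem_right a) e), ?_⟩
  have := h.image_mem _ a.2
  rwa [Finset.image_insert, Finset.image_singleton] at this

lemma tri (h : IsIso X Y g g') {a b c : V} (t : Tri X a b c) : Tri Y (g a) (g b) (g c) := by
  have := h.image_mem _ t.mem
  rw [Finset.image_insert, Finset.image_insert, Finset.image_singleton] at this
  exact tri_iff.2 ⟨this, (h.adj t.adj).ne, (h.adj t.right.adj).ne, (h.adj t.adj').ne⟩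

lemma isChart (h : IsIso X Y g g') {v : V} {φ : ZMod 8 ⊕ ZMod 8 → V} (hφ : IsChart X v φ) :
    IsChart Y (g v) (g ∘ φ) := by
  have hv : v ∈ vertices X := adj_mem_left ((hφ.adj_iff _).2 ⟨.inl 0, rfl⟩)
  have hm : ∀ m, φ m ∈ vertices X := fun m => adj_mem_right ((hφ.adj_iff _).2 ⟨m, rfl⟩)
  refine ⟨fun m m' e => hφ.inj (h.injOn (hm m) (hm m') e), fun u => ?_, fun m m' => ?_⟩
  · constructor
    · intro a
      have a' := h.symm.adj a
      rw [h.left_inv v hv] at a'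
      obtain ⟨m, e⟩ := (hφ.adj_iff _).1 a'
      exact ⟨m, by rw [Function.comp_apply, e, h.right_inv u (adj_mem_right a)]⟩
    · rintro ⟨m, rfl⟩
      exact h.adj ((hφ.adj_iff _).2 ⟨m, rfl⟩)
  · rw [← hφ.tri_iff]
    refine ⟨fun t => ?_, fun t => h.tri t⟩
    have t' := h.symm.tri t
    rwa [h.left_inv v hv, Function.comp_apply, Function.comp_apply, h.left_inv _ (hm m),
      h.left_inv _ (hm m')] at t'

lemma rho_eq (h : IsIso X Y g g') {v y z : V} (hv : HasMKLink X v) (hy : (skeleton X).Adj v y)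
    (hz : (skeleton X).Adj v z) : rho Y (g v) (g y) (g z) = rho X v y z := by
  obtain ⟨φ, hφ⟩ := hv
  obtain ⟨m, rfl⟩ := (hφ.adj_iff y).1 hy
  obtain ⟨m', rfl⟩ := (hφ.adj_iff z).1 hz
  rw [hφ.rho_eq]
  exact (h.isChart hφ).rho_eq m m'

lemma hasMKLink (h : IsIso X Y g g') {v : V} (hv : HasMKLink X v) : HasMKLink Y (g v) := by
  obtain ⟨φ, hφ⟩ := hv
  exact ⟨_, h.isChart hφ⟩

lemma hasParity (h : IsIso X Y g g') (hM : ∀ v ∈ vertices X, HasMKLink X v) {f : Finset V}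
    (hf : f ∈ X) {ε : ZMod 2} (hp : HasParity X f ε) : HasParity Y (f.image g) ε := by
  obtain ⟨a, b, c, x, y, z, rfl, T, rfl⟩ :=
    hp.exists_isTwoTriangle fun v hv => hM v (mem_vertices_of_mem hf hv)
  have hv : ∀ v ∈ ({a, b, c} : Finset V), v ∈ vertices X := fun v hv => mem_vertices_of_mem hf hv
  have va := adj_mem_left T.center.adj
  have vb := adj_mem_right T.center.adj
  have vc := adj_mem_right T.center.adj'
  have T' : IsTwoTriangle Y (g a) (g b) (g c) (g x) (g y) (g z) :=
    ⟨h.tri T.center, h.tri T.hx, h.tri T.hy, h.tri T.hz,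
      fun e => T.x_ne (h.injOn (adj_mem_left T.hx.adj) va e),
      fun e => T.y_ne (h.injOn (adj_mem_right T.hy.adj) vb e),
      fun e => T.z_ne (h.injOn (adj_mem_right T.hz.adj') vc e)⟩
  have := T'.hasParity (h.hasMKLink (hM a va)) (h.hasMKLink (hM b vb)) (h.hasMKLink (hM c vc))
  rw [paritySum, h.rho_eq (hM a va) T.hy.adj T.hz.right.adj,
    h.rho_eq (hM b vb) T.hz.adj' T.hx.left.adj,
    h.rho_eq (hM c vc) T.hx.rot.rot.adj T.hy.rot.rot.right.adj] at this
  rwa [Finset.image_insert, Finset.image_insert, Finset.image_singleton]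

lemma level_le (h : IsIso X Y g g') {x : V} {ℓ ℓ' : V → ℕ} (hX : IsGood X x ⊤ ℓ)
    (hY : IsGood Y (g x) ⊤ ℓ') (k : ℕ) : ∀ v ∈ vertices X, ℓ v = k → ℓ' (g v) ≤ k := by
  induction k with
  | zero =>
    intro v hv e
    rw [(hX.level_eq_zero v hv).1 e, hY.level_base]
  | succ k ih =>
    intro v hv e
    have hvx : v ≠ x := by
      rintro rfl
      rw [hX.level_base] at e
      omega
    obtain ⟨u, a, g1⟩ := hX.down_exists v hv hvx
    have h1 := ih u (adj_mem_right a) (by omega)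
    have h2 := hY.level_adj _ _ (h.adj a)
    omega

lemma level_eq (h : IsIso X Y g g') {x : V} {ℓ ℓ' : V → ℕ} (hX : IsGood X x ⊤ ℓ)
    (hY : IsGood Y (g x) ⊤ ℓ') {v : V} (hv : v ∈ vertices X) : ℓ' (g v) = ℓ v := by
  refine le_antisymm (h.level_le hX hY _ v hv rfl) ?_
  have h1 := h.symm.level_le hY (by rw [h.left_inv x hX.base_mem]; exact hX) _ (g v)
    (h.vert v hv) rfl
  rwa [h.left_inv v hv] at h1

lemma image_mem_sphereTriangles (h : IsIso X Y g g') {x : V} {ℓ ℓ' : V → ℕ} (hX : IsGood X x ⊤ ℓ)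
    (hY : IsGood Y (g x) ⊤ ℓ') {n : ℕ} {f : Finset V} (hf : f ∈ sphereTriangles X x n) :
    f.image g ∈ sphereTriangles Y (g x) n := by
  have hf' := hX.mem_triangles_ball_iff.1 hf.1
  have hv : ∀ v ∈ f, v ∈ vertices X := fun v hv => mem_vertices_of_mem hf'.1.1 hv
  have ht : f.image g ∈ triangles Y := by
    refine ⟨h.image_mem f hf'.1.1, ?_⟩
    rw [Finset.card_image_of_injOn fun u hu v hv' e => h.injOn (hv u hu) (hv v hv') e]
    exact hf'.1.2
  have hl : ∀ k, (∀ v ∈ f.image g, ℓ' v ≤ k) ↔ ∀ v ∈ f, ℓ v ≤ k := by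
    intro k
    rw [Finset.forall_mem_image]
    exact forall₂_congr fun v hvf => by rw [h.level_eq hX hY (hv v hvf)]
  refine ⟨hY.mem_triangles_ball_iff.2 ⟨ht, (hl n).2 hf'.2⟩, fun hn => hf.2 ?_⟩
  exact hX.mem_triangles_ball_iff.2 ⟨hf'.1, (hl _).1 (hY.mem_triangles_ball_iff.1 hn).2⟩

end IsIso

lemma HasParity.unique {f : Finset V} {ε ε' : ZMod 2} (h : HasParity X f ε)
    (h' : HasParity X f ε') : ε = ε' := by
  obtain ⟨T, hT⟩ := h.1
  rw [← h.2 T hT, h'.2 T hT]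

/-- In the complexes `F s` constructed in the proof, all the triangles of the sphere of radius `n + 1`
around a fixed vertex have parity `s n`. Such a sequence `s` is determined by the isomorphism class
and the image of the base vertex, for which there are countably many possibilities. -/
theorem exists_uncountable (V : Type*) [DecidableEq V] [Infinite V] :
    ∃ S : Set (PreAbstractSimplicialComplex V), ¬ S.Countable ∧
      (∀ X ∈ S, IsRankSevenFourths X ∧ IsSimplyConnected X) ∧
      S.Pairwise fun X Y => ¬ AreIsomorphic X Y := by
  classical
  obtain ⟨x⟩ : Nonempty V := inferInstance
  have hF : ∀ s : ℕ → ZMod 2, ∃ (Y : PreAbstractSimplicialComplex V) (ℓ : V → ℕ),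
      IsGood Y x ⊤ ℓ ∧ ∀ n, ∀ f ∈ sphereTriangles Y x (n + 1), HasParity Y f (s n) := by
    intro s
    obtain ⟨Y, ℓ, hG, -, h⟩ := (point_isGood x).exists_free fun n _ _ => s (n - 1)
    exact ⟨Y, ℓ, hG, fun n f hf => h (n + 1) (Nat.zero_le _) f hf⟩
  choose F ℓ hG hF using hF
  have hM : ∀ s, ∀ v ∈ vertices (F s), HasMKLink (F s) v := fun s v hv =>
    (hG s).hasMKLink v hv (ENat.natCast_lt_top _)
  let r : Setoid (ℕ → ZMod 2) := ⟨fun s t => AreIsomorphic (F s) (F t),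
    ⟨fun s => .refl _, fun h => h.symm, fun h h' => h.trans h'⟩⟩
  have hcount : ∀ t, {s | AreIsomorphic (F s) (F t)}.Countable := by
    intro t
    refine ((hG t).countable_vertices.biUnion (t := fun y _ => {s : ℕ → ZMod 2 |
      ∀ n, ∀ f ∈ sphereTriangles (F t) y (n + 1), HasParity (F t) f (s n)})
      fun y hy => Set.Subsingleton.countable ?_).mono ?_
    · intro s hs s' hs'
      obtain ⟨ℓ', hG'⟩ := exists_isGood (hG t).isRankSevenFourths (hG t).isSimplyConnected hy
      funext n
      obtain ⟨f, hf⟩ := hG'.sphereTriangles_nonempty n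
      exact (hs n f hf).unique (hs' n f hf)
    · intro s hs
      obtain ⟨g, g', h⟩ := AreIsomorphic.exists_isIso hs
      have hy := h.vert x (hG s).base_mem
      obtain ⟨ℓ', hG'⟩ := exists_isGood (hG t).isRankSevenFourths (hG t).isSimplyConnected hy
      refine Set.mem_biUnion hy fun n f hf => ?_
      have hx : g' (g x) = x := h.left_inv x (hG s).base_mem
      have h1 := h.symm.image_mem_sphereTriangles hG' (by rw [hx]; exact hG s) hf
      rw [hx] at h1
      have hfY := (hG'.mem_triangles_ball_iff.1 hf.1).1.1
      have h2 := h.hasParity (hM s) (h.image_mem' f hfY) (hF s n _ h1)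
      have e3 : f.image (g ∘ g') = f := by
        conv_rhs => rw [← Finset.image_id (s := f)]
        exact Finset.image_congr fun v hv => h.right_inv v (mem_vertices_of_mem hfY hv)
      rwa [Finset.image_image, e3] at h2
  refine ⟨Set.range fun q : Quotient r => F q.out, fun hc => ?_, ?_, ?_⟩
  · have huniv : (Set.univ : Set (ℕ → ZMod 2)).Countable := by
      refine (hc.biUnion (t := fun Y _ => {s | AreIsomorphic (F s) Y}) ?_).mono ?_
      · rintro _ ⟨q, rfl⟩
        exact hcount q.out
      · intro s _
        refine Set.mem_biUnion (x := F (Quotient.mk r s).out) ⟨_, rfl⟩ ?_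
        exact (Quotient.exact (Quotient.out_eq (Quotient.mk r s)) : _).symm
    have : Uncountable (ℕ → ZMod 2) := by
      rw [← Cardinal.aleph0_lt_mk_iff]
      simpa using Cardinal.cantor Cardinal.aleph0
    exact Set.not_countable_univ huniv
  · rintro _ ⟨q, rfl⟩
    exact ⟨(hG _).isRankSevenFourths, (hG _).isSimplyConnected⟩
  · rintro _ ⟨q, rfl⟩ _ ⟨q', rfl⟩ hne h
    refine hne ?_
    have : q = q' := by
      rw [← Quotient.out_eq q, ← Quotient.out_eq q']
      exact Quotient.sound h
    rw [this]

end Free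
end Rank74

/-- (1) A ball `B_n` extends to a ball `B_{n+1}` (of a simply connected complex of rank `7/4`)
realizing any given parity on `S_n`. (2) Starting from any ball and any rule `P` that
prescribes the parities on `S_n` in terms of the ball `B_n` obtained so far, the free construction
can be carried out. (3) Any map can be prescribed as the parity map. (4) There are uncountably many
isomorphism classes. -/
theorem mainTheorem2 {V : Type*} [DecidableEq V] [Infinite V] :
    (∀ X : PreAbstractSimplicialComplex V,
      Rank74.IsRankSevenFourths X → Rank74.IsSimplyConnected X →
      ∀ x ∈ Rank74.vertices X, ∀ (n : ℕ) (p : Finset V → ZMod 2),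
      ∃ Y : PreAbstractSimplicialComplex V,
        Rank74.IsRankSevenFourths Y ∧ Rank74.IsSimplyConnected Y ∧
        Rank74.ball Y x n = Rank74.ball X x n ∧
        ∀ f ∈ Rank74.sphereTriangles X x n, Rank74.HasParity Y f (p f)) ∧
    (∀ X : PreAbstractSimplicialComplex V,
      Rank74.IsRankSevenFourths X → Rank74.IsSimplyConnected X →
      ∀ x ∈ Rank74.vertices X, ∀ (m : ℕ)
        (P : ℕ → PreAbstractSimplicialComplex V → Finset V → ZMod 2),
      ∃ Y : PreAbstractSimplicialComplex V,
        Rank74.IsRankSevenFourths Y ∧ Rank74.IsSimplyConnected Y ∧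
        Rank74.ball Y x m = Rank74.ball X x m ∧
        ∀ n, m ≤ n → ∀ f ∈ Rank74.sphereTriangles Y x n,
          Rank74.HasParity Y f (P n (Rank74.ball Y x n) f)) ∧
    (∀ p : Finset V → ZMod 2,
      ∃ Y : PreAbstractSimplicialComplex V,
        Rank74.IsRankSevenFourths Y ∧ Rank74.IsSimplyConnected Y ∧
        ∀ f ∈ Rank74.triangles Y, Rank74.HasParity Y f (p f)) ∧
    ∃ S : Set (PreAbstractSimplicialComplex V), ¬ S.Countable ∧
      (∀ X ∈ S, Rank74.IsRankSevenFourths X ∧ Rank74.IsSimplyConnected X) ∧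
      S.Pairwise fun X Y => ¬ Rank74.AreIsomorphic X Y := by
  refine ⟨fun X hX hs x hx n p => ?_, fun X hX hs x hx m P => ?_, fun p => ?_,
    Rank74.exists_uncountable V⟩
  · obtain ⟨ℓ, hG⟩ := Rank74.exists_isGood hX hs hx
    obtain ⟨Y, ℓ', hY, hb, hp⟩ := (hG.ball_isGood le_top).exists_free (m := n) fun _ _ => p
    refine ⟨Y, hY.isRankSevenFourths, hY.isSimplyConnected, hb, fun f hf => hp n le_rfl f ?_⟩
    rwa [← hY.sphereTriangles_ball, hb, hG.sphereTriangles_ball]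
  · obtain ⟨ℓ, hG⟩ := Rank74.exists_isGood hX hs hx
    obtain ⟨Y, ℓ', hY, hb, hp⟩ := (hG.ball_isGood le_top).exists_free (m := m) P
    exact ⟨Y, hY.isRankSevenFourths, hY.isSimplyConnected, hb, hp⟩
  · obtain ⟨x⟩ : Nonempty V := inferInstance
    obtain ⟨Y, ℓ, hY, -, hp⟩ := (Rank74.point_isGood x).exists_free fun _ _ => p
    refine ⟨Y, hY.isRankSevenFourths, hY.isSimplyConnected, fun f hf => ?_⟩
    obtain ⟨n, hn⟩ := hY.exists_mem_sphereTriangles hf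
    exact hp n (Nat.zero_le n) f hn
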